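/- Let $B\subset\mathbb{R}^2$ be the open unit disc, with polar coordinates $(R,\theta)$ and $e_R(\theta)=(\cos\theta,\sin\theta)$, $e_\theta(\theta)=(-\sin\theta,\cos\theta)$. Let $\nu>0$, $b\in\mathbb{R}^2$, $N\in\mathbb{N}$ with $N\ge 2$, and $a\in(N^2-N,N^2+N)$. Put $$f(x,\xi)=\nu\left[a(e_R^T\xi e_R)^2+(e_R^T\xi e_\theta)^2+a(e_\theta^T\xi e_R)^2+(e_\theta^T\xi e_\theta)^2\right],\qquad x\in B\setminus\{0\},\ \xi\in\mathbb{R}^{2\times2},$$ $E(u)=\int_B f(x,\nabla u)\,dx$ for $u\in W^{1,2}(B,\mathbb{R}^2)$, and let $\mathcal{A}^c$ be the set of all $u\in W^{1,2}(B,\mathbb{R}^2)$ with $\det\nabla u=1$ a.e. in $B$ and $u=\frac{1}{\sqrt N}e_R(N\theta)+b$ on $\partial B$ in the sense of traces. Then the following hold. (i) $f(x,\xi)=\nu M(x)\xi\cdot\xi$ for $x\in B\setminus\{0\}$ with $M\in L^\infty(B,\mathbb{R}^{16})$ given by $$M=a(e_R\otimes e_R)(e_R\otimes e_R)+(e_R\otimes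 e_\theta)(e_R\otimes e_\theta)+a(e_\theta\otimes e_R)(e_\theta\otimes e_R)+(e_\theta\otimes e_\theta)(e_\theta\otimes e_\theta),$$ where $((p\otimes q)(r\otimes s))\xi\cdot\xi=(p^T\xi q)(r^T\xi s)$; and $\nu|\xi|^2\le\nu M(x)\xi\cdot\xi$ for all $x\in B\setminus\{0\}$ and all $\xi$. (ii) $M$ has no limit at $0$, and neither has $x\mapsto f(x,\xi)$, for any $\xi\in\mathbb{R}^{2\times2}$ for which $\xi^T\xi$ is not a scalar multiple of the identity. (iii) $M$, and $x\mapsto f(x,\xi)$ for every $\xi$ as in (ii), belong to $W^{1,q}\setminus W^{1,2}$ on $B$ for all $1\le q<2$. (iv) The map $u=\frac{R}{\sqrt N}e_R(N\theta)+b$ is Lipschitz on $B$ but not in $C^1(B,\mathbb{R}^2)$. It is a stationary point of $E$ under the constraint $\det\nabla u=1$: $\frac{d}{dt}E(u+t\eta)|_{t=0}=0$ for all $\eta\in W_0^{1,2}(B,\mathbb{R}^2)$ with $\operatorname{cof}\nabla u\cdot\nabla\eta=0$ a.e. There is a corresponding pressure $\lambda$, with $\lambda\in W^{1,q}(B)$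 for all $1\le q<2$ and $$\int_B\nu M(x)\nabla u\cdot\nabla\eta\,dx=-\int_B\lambda\operatorname{cof}\nabla u\cdot\nabla\eta\,dx\quad\text{for all }\eta\in C_c^\infty(B,\mathbb{R}^2).$$ (v) $u$ is the unique global minimizer of $E$ in $\mathcal{A}^c$ (unique up to null sets). (vi) $\min_{v\in\mathcal{A}^c}E(v)=\nu\pi\left(\frac{a}{N}+N\right)$. -/

import Mathlib

open MeasureTheory Set Filter Topology
open scoped ContDiff ENNReal

noncomputable section

namespace IncompressibleDisc

/-- The Euclidean plane. -/
abbrev Plane : Type := EuclideanSpace ℝ (Fin 2)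

/-- Real two by two matrices. -/
abbrev Mat : Type := Matrix (Fin 2) (Fin 2) ℝ

/-- Fourth-order tensors, i.e. the sixteen-dimensional space of linear maps on matrices. -/
abbrev Tensor : Type := Fin 2 → Fin 2 → Fin 2 → Fin 2 → ℝ

/-- The open unit disc. -/
def disc : Set Plane := Metric.ball 0 1

/-- Lebesgue measure on the disc. -/
def discMeasure : Measure Plane := volume.restrict disc

/-! Polar coordinates -/

/-- The radial unit vector with angle `θ`. -/
def eR (θ : ℝ) : Plane := !₂[Real.cos θ, Real.sin θ]

/-- The angular unit vector with angle `θ`. -/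
def eTheta (θ : ℝ) : Plane := !₂[-Real.sin θ, Real.cos θ]

/-- The polar angle of a point; the polar radius is `‖x‖`. -/
def angle (x : Plane) : ℝ := Complex.arg ⟨x 0, x 1⟩

/-! Matrices and tensors -/

/-- The bilinear form `pᵀ ξ q`. -/
def sandwich (p : Plane) (ξ : Mat) (q : Plane) : ℝ := ∑ i, ∑ j, p i * ξ i j * q j

/-- The Frobenius inner product of two matrices. -/
def frob (ξ ζ : Mat) : ℝ := ∑ i, ∑ j, ξ i j * ζ i j

/-- The cofactor matrix, i.e. the transpose of the adjugate. -/
def cof (ξ : Mat) : Mat := ξ.adjugate.transpose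

/-- The tensor product `p ⊗ q` of two vectors. -/
def outer (p q : Plane) : Mat := Matrix.of fun i j => p i * q j

/-- The tensor `A B` acting by `(A B) ξ · ζ = (A · ξ) (B · ζ)`. -/
def tensorMul (A B : Mat) : Tensor := fun i j k l => A i j * B k l

/-- The action of a tensor on a matrix: `(T ξ)ₖₗ = ∑ᵢⱼ Tᵢⱼₖₗ ξᵢⱼ`. -/
def Tensor.act (T : Tensor) (ξ : Mat) : Mat := Matrix.of fun k l => ∑ i, ∑ j, T i j k l * ξ i j

/-- `ξ` is conformal or anticonformal (possibly zero): `ξᵀ ξ` is a multiple of the identity. -/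
def IsConformalMat (ξ : Mat) : Prop := ∃ c : ℝ, ξ.transpose * ξ = c • (1 : Mat)

/-! Sobolev spaces on the disc -/

/-- The `j`-th classical partial derivative of a scalar function. -/
def partialDeriv (j : Fin 2) (φ : Plane → ℝ) (x : Plane) : ℝ :=
  fderiv ℝ φ x (EuclideanSpace.single j 1)

/-- The classical gradient `(∇φ)ᵢⱼ = ∂ⱼ φᵢ` of a vector-valued map. -/
def jac (φ : Plane → Plane) (x : Plane) : Mat :=
  Matrix.of fun i j => fderiv ℝ φ x (EuclideanSpace.single j 1) i

/-- Smooth functions with compact support in the disc. -/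
def IsTest {F : Type*} [NormedAddCommGroup F] [NormedSpace ℝ F] (φ : Plane → F) : Prop :=
  ContDiff ℝ ∞ φ ∧ HasCompactSupport φ ∧ tsupport φ ⊆ disc

/-- `g` is the weak partial derivative of `f` in direction `j` on the disc. -/
def HasWeakPartial (j : Fin 2) (f g : Plane → ℝ) : Prop :=
  LocallyIntegrableOn f disc volume ∧ LocallyIntegrableOn g disc volume ∧
    ∀ φ : Plane → ℝ, IsTest φ →
      ∫ x, f x * partialDeriv j φ x ∂discMeasure = -∫ x, g x * φ x ∂discMeasure

/-- The space `W^{1,q}` of scalar functions on the disc. -/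
def MemW1 (q : ℝ≥0∞) (f : Plane → ℝ) : Prop :=
  MemLp f q discMeasure ∧
    ∀ j, ∃ g : Plane → ℝ, HasWeakPartial j f g ∧ MemLp g q discMeasure

/-- The space `W^{1,q}` of tensor fields on the disc. -/
def TensorMemW1 (q : ℝ≥0∞) (T : Plane → Tensor) : Prop :=
  ∀ i j k l, MemW1 q fun x => T x i j k l

/-- The space `W^{1,2}` of plane-valued maps on the disc. -/
def MapMemW12 (u : Plane → Plane) : Prop := ∀ i, MemW1 2 fun x => u x i

/-- `G` is a weak gradient of the map `u` on the disc, `Gᵢⱼ = ∂ⱼ uᵢ`. -/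
def HasWeakGrad (u : Plane → Plane) (G : Plane → Mat) : Prop :=
  ∀ i j, HasWeakPartial j (fun x => u x i) fun x => G x i j

open Classical in
/-- The weak gradient of a map (unique up to null sets of the disc when it exists). -/
def weakGrad (u : Plane → Plane) : Plane → Mat :=
  if h : ∃ G, HasWeakGrad u G then h.choose else 0

/-- Convergence in `W^{1,2}` on the disc of smooth maps `φ n` to `u ∈ W^{1,2}`. -/
def TendstoW12 (φ : ℕ → Plane → Plane) (u : Plane → Plane) : Prop :=
  Tendsto (fun n => eLpNorm (fun x => φ n x - u x) 2 discMeasure) atTop (𝓝 0) ∧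
    ∀ i j, Tendsto (fun n => eLpNorm (fun x => jac (φ n) x i j - weakGrad u x i j) 2 discMeasure)
      atTop (𝓝 0)

/-- The space `W₀^{1,2}` of plane-valued maps: the closure of the test maps in `W^{1,2}`. -/
def MapMemW012 (η : Plane → Plane) : Prop :=
  MapMemW12 η ∧ ∃ φ : ℕ → Plane → Plane, (∀ n, IsTest (φ n)) ∧ TendstoW12 φ η

/-- The map `u ∈ W^{1,2}` has trace `θ ↦ h θ` on the unit circle: for some maps, smooth up to the
boundary, that converge to `u` in `W^{1,2}`, the restrictions to the circle converge to `h` in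
`L²`. -/
def HasTrace (u : Plane → Plane) (h : ℝ → Plane) : Prop :=
  ∃ φ : ℕ → Plane → Plane, (∀ n, ContDiff ℝ ∞ (φ n)) ∧ TendstoW12 φ u ∧
    Tendsto (fun n => eLpNorm (fun θ => φ n (eR θ) - h θ) 2
      (volume.restrict (Ioc 0 (2 * Real.pi)))) atTop (𝓝 0)

/-- The incompressible maps in `W^{1,2}` of the disc with boundary values `h`. -/
def Admissible (h : ℝ → Plane) : Set (Plane → Plane) :=
  {u | MapMemW12 u ∧ (∀ᵐ x ∂discMeasure, (weakGrad u x).det = 1) ∧ HasTrace u h}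

/-- The energy `∫ f(x, ∇u) dx` over the disc. -/
def energy (f : Plane → Mat → ℝ) (u : Plane → Plane) : ℝ :=
  ∫ x, f x (weakGrad u x) ∂discMeasure

/-- `u` is a stationary point of the energy under the constraint `det ∇u = 1`: the first variation
vanishes in all directions `η ∈ W₀^{1,2}` that satisfy the linearized constraint. -/
def IsStationaryPoint (f : Plane → Mat → ℝ) (u : Plane → Plane) : Prop :=
  ∀ η : Plane → Plane, MapMemW012 η →
    (∀ᵐ x ∂discMeasure, frob (cof (weakGrad u x)) (weakGrad η x) = 0) →
      HasDerivAt (fun t : ℝ => energy f fun x => u x + t • η x) 0 0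

/-- `p` is a pressure of the map `u`, for the energy with integrand `T(x) ξ · ξ`: the
Euler-Lagrange equation `∫ T ∇u · ∇η = - ∫ p cof ∇u · ∇η` holds for all test maps `η`. -/
def IsPressure (T : Plane → Tensor) (u : Plane → Plane) (p : Plane → ℝ) : Prop :=
  ∀ η : Plane → Plane, IsTest η →
    ∫ x, frob ((T x).act (weakGrad u x)) (jac η x) ∂discMeasure =
      -∫ x, p x * frob (cof (weakGrad u x)) (jac η x) ∂discMeasure

/-! The concrete functional and the concrete map -/

/-- The quadratic integrand. -/
def integrand (ν a : ℝ) (x : Plane) (ξ : Mat) : ℝ :=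
  ν * (a * sandwich (eR (angle x)) ξ (eR (angle x)) ^ 2
    + sandwich (eR (angle x)) ξ (eTheta (angle x)) ^ 2
    + a * sandwich (eTheta (angle x)) ξ (eR (angle x)) ^ 2
    + sandwich (eTheta (angle x)) ξ (eTheta (angle x)) ^ 2)

/-- The coefficient tensor of the integrand. -/
def coeff (a : ℝ) (x : Plane) : Tensor :=
  let r := eR (angle x)
  let t := eTheta (angle x)
  a • tensorMul (outer r r) (outer r r) + tensorMul (outer r t) (outer r t)
    + a • tensorMul (outer t r) (outer t r) + tensorMul (outer t t) (outer t t)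

/-- The `N`-covering boundary values, shifted by `b`. -/
def boundaryData (N : ℕ) (b : Plane) (θ : ℝ) : Plane := (1 / √(N : ℝ)) • eR (N * θ) + b

/-- The one-homogeneous `N`-covering map, shifted by `b`. -/
def coveringMap (N : ℕ) (b : Plane) (x : Plane) : Plane :=
  (‖x‖ / √(N : ℝ)) • eR (N * angle x) + b

end IncompressibleDisc

end

open IncompressibleDisc

/-!
The covering map `u` solves the Euler-Lagrange equation with a logarithmic pressure: for a map `w`
with vanishing trace, `∫ M ∇u · ∇w = -(N² - a) / N ∫ log ‖x‖ cof ∇u · ∇w`, which is an integration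
by parts in polar coordinates.

If `v` is a competitor and `w = v - u`, then `det ∇v = det ∇u = 1` gives
`cof ∇u · ∇w = -det ∇w`. As the energy is quadratic, its excess is therefore
`ν (a ∫ |∂_r w|² + ∫ |r⁻¹ ∂_θ w|² + (N² - a) / N · 2 ∫ log ‖x‖ det ∇w)`. The determinant is a
divergence, so the last integral reduces to circles, where Wirtinger's inequality yields
`|2 ∫ log ‖x‖ det ∇w| ≤ ∫ |r⁻¹ ∂_θ w|²`. Since `|N² - a| ≤ N`, what remains of the excess is at
least `ν a ∫ |∂_r w|²`, and this vanishes only for `w = 0` because `w` is zero on the circle.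

The regularity statements come from homogeneity: the coefficients are homogeneous of degree `0`, so
they are as regular near the origin as `‖x‖⁻¹` is integrable, and they are in `W^{1,2}` only if they
are constant.
-/

noncomputable section

namespace IncompressibleDisc

open Real (cos sin pi_pos)

/-! ### Matrices in the polar frame -/

@[simp] lemma eR_zero (θ : ℝ) : eR θ 0 = cos θ := rfl
@[simp] lemma eR_one (θ : ℝ) : eR θ 1 = sin θ := rfl
@[simp] lemma eTheta_zero (θ : ℝ) : eTheta θ 0 = -sin θ := rfl
@[simp] lemma eTheta_one (θ : ℝ) : eTheta θ 1 = cos θ := rfl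

/-- The components of the radial derivative `G e_R(θ)` of a map with gradient `G`. -/
def radPart (G : Mat) (θ : ℝ) (i : Fin 2) : ℝ := G i 0 * cos θ + G i 1 * sin θ

/-- The components of the angular derivative `G e_θ(θ)` of a map with gradient `G`; in polar
coordinates this is `R⁻¹ ∂_θ`. -/
def tanPart (G : Mat) (θ : ℝ) (i : Fin 2) : ℝ := -(G i 0 * sin θ) + G i 1 * cos θ

/-- The bilinear form `M ξ · ζ` of the coefficient tensor, at a point with polar angle `θ`. -/
def polarForm (a θ : ℝ) (ξ ζ : Mat) : ℝ :=
  ∑ i, (a * radPart ξ θ i * radPart ζ θ i + tanPart ξ θ i * tanPart ζ θ i)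

lemma tensorMul_act (A B ξ : Mat) : (tensorMul A B).act ξ = frob A ξ • B := by
  ext k l
  simp only [Tensor.act, tensorMul, frob, Matrix.of_apply, Matrix.smul_apply, smul_eq_mul,
    Fin.sum_univ_two]
  ring

lemma Tensor.add_act (S T : Tensor) (ξ : Mat) : (S + T).act ξ = S.act ξ + T.act ξ := by
  ext k l
  simp only [Tensor.act, Matrix.of_apply, Matrix.add_apply, Pi.add_apply, add_mul,
    Finset.sum_add_distrib]

lemma Tensor.smul_act (c : ℝ) (T : Tensor) (ξ : Mat) : Tensor.act (c • T) ξ = c • T.act ξ := by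
  ext k l
  simp only [Tensor.act, Matrix.of_apply, Matrix.smul_apply, Pi.smul_apply, smul_eq_mul, mul_assoc,
    Finset.mul_sum]

lemma frob_add_left (ξ ξ' ζ : Mat) : frob (ξ + ξ') ζ = frob ξ ζ + frob ξ' ζ := by
  simp only [frob, Matrix.add_apply, add_mul, Finset.sum_add_distrib]

lemma frob_smul_left (c : ℝ) (ξ ζ : Mat) : frob (c • ξ) ζ = c * frob ξ ζ := by
  simp only [frob, Matrix.smul_apply, smul_eq_mul, mul_assoc, Finset.mul_sum]

lemma frob_outer (p q : Plane) (ξ : Mat) : frob (outer p q) ξ = sandwich p ξ q := by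
  simp only [frob, outer, sandwich, Matrix.of_apply, Fin.sum_univ_two]
  ring

lemma frob_coeff_act_eq_sandwich (a : ℝ) (x : Plane) (ξ ζ : Mat) :
    frob ((coeff a x).act ξ) ζ =
      a * (sandwich (eR (angle x)) ξ (eR (angle x)) * sandwich (eR (angle x)) ζ (eR (angle x)))
      + sandwich (eR (angle x)) ξ (eTheta (angle x)) * sandwich (eR (angle x)) ζ (eTheta (angle x))
      + a * (sandwich (eTheta (angle x)) ξ (eR (angle x))
        * sandwich (eTheta (angle x)) ζ (eR (angle x)))
      + sandwich (eTheta (angle x)) ξ (eTheta (angle x))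
        * sandwich (eTheta (angle x)) ζ (eTheta (angle x)) := by
  simp only [coeff, Tensor.add_act, Tensor.smul_act, tensorMul_act, frob_add_left, frob_smul_left,
    frob_outer]

lemma integrand_eq_frob_coeff_act (ν a : ℝ) (x : Plane) (ξ : Mat) :
    integrand ν a x ξ = ν * frob ((coeff a x).act ξ) ξ := by
  rw [integrand, frob_coeff_act_eq_sandwich]
  ring

-- Parseval's identity in the orthonormal frame `e_R`, `e_θ`.
lemma sandwich_mul_add_sandwich_mul (θ : ℝ) (ξ ζ : Mat) (q : Plane) :
    sandwich (eR θ) ξ q * sandwich (eR θ) ζ q + sandwich (eTheta θ) ξ q * sandwich (eTheta θ) ζ q =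
      ∑ i, (∑ j, ξ i j * q j) * ∑ j, ζ i j * q j := by
  simp only [sandwich, Fin.sum_univ_two, eR_zero, eR_one, eTheta_zero, eTheta_one]
  linear_combination ((ξ 0 0 * q 0 + ξ 0 1 * q 1) * (ζ 0 0 * q 0 + ζ 0 1 * q 1)
    + (ξ 1 0 * q 0 + ξ 1 1 * q 1) * (ζ 1 0 * q 0 + ζ 1 1 * q 1)) * Real.sin_sq_add_cos_sq θ

lemma frob_coeff_act (a : ℝ) (x : Plane) (ξ ζ : Mat) :
    frob ((coeff a x).act ξ) ζ = polarForm a (angle x) ξ ζ := by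
  have hR := sandwich_mul_add_sandwich_mul (angle x) ξ ζ (eR (angle x))
  have hT := sandwich_mul_add_sandwich_mul (angle x) ξ ζ (eTheta (angle x))
  rw [frob_coeff_act_eq_sandwich]
  simp only [polarForm, radPart, tanPart, Fin.sum_univ_two, eR_zero, eR_one, eTheta_zero,
    eTheta_one] at hR hT ⊢
  linear_combination a * hR + hT

lemma integrand_eq_polarForm (ν a : ℝ) (x : Plane) (ξ : Mat) :
    integrand ν a x ξ = ν * polarForm a (angle x) ξ ξ := by
  rw [integrand_eq_frob_coeff_act, frob_coeff_act]

lemma sum_radPart_sq_add_tanPart_sq (ξ : Mat) (θ : ℝ) :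
    ∑ i, (radPart ξ θ i ^ 2 + tanPart ξ θ i ^ 2) = frob ξ ξ := by
  simp only [Fin.sum_univ_two, radPart, tanPart, frob]
  linear_combination
    (ξ 0 0 ^ 2 + ξ 0 1 ^ 2 + ξ 1 0 ^ 2 + ξ 1 1 ^ 2) * Real.sin_sq_add_cos_sq θ

lemma frob_self_le_frob_coeff_act {a : ℝ} (ha : 1 ≤ a) (x : Plane) (ξ : Mat) :
    frob ξ ξ ≤ frob ((coeff a x).act ξ) ξ := by
  rw [frob_coeff_act, polarForm, ← sum_radPart_sq_add_tanPart_sq ξ (angle x)]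
  refine Finset.sum_le_sum fun i _ => ?_
  nlinarith [mul_le_mul_of_nonneg_right ha (sq_nonneg (radPart ξ (angle x) i))]

lemma det_eq_radPart_tanPart (G : Mat) (θ : ℝ) :
    G.det = radPart G θ 0 * tanPart G θ 1 - tanPart G θ 0 * radPart G θ 1 := by
  simp only [Matrix.det_fin_two, radPart, tanPart]
  linear_combination (G 0 1 * G 1 0 - G 0 0 * G 1 1) * Real.sin_sq_add_cos_sq θ

lemma frob_cof (ξ ζ : Mat) :
    frob (cof ξ) ζ = ξ 1 1 * ζ 0 0 - ξ 1 0 * ζ 0 1 - ξ 0 1 * ζ 1 0 + ξ 0 0 * ζ 1 1 := by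
  simp only [frob, cof, Matrix.adjugate_fin_two, Fin.sum_univ_two,
    Matrix.transpose_apply, Matrix.of_apply, Matrix.cons_val_zero, Matrix.cons_val_one]
  ring

lemma frob_cof_eq_radPart_tanPart (ξ ζ : Mat) (θ : ℝ) :
    frob (cof ξ) ζ = radPart ξ θ 0 * tanPart ζ θ 1 + radPart ζ θ 0 * tanPart ξ θ 1
      - tanPart ξ θ 0 * radPart ζ θ 1 - tanPart ζ θ 0 * radPart ξ θ 1 := by
  simp only [frob_cof, radPart, tanPart]
  linear_combination (-(ξ 0 0 * ζ 1 1) + ξ 0 1 * ζ 1 0 + ξ 1 0 * ζ 0 1 - ξ 1 1 * ζ 0 0) *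
    Real.sin_sq_add_cos_sq θ

lemma det_add_eq_add_frob_cof (ξ ζ : Mat) : (ξ + ζ).det = ξ.det + frob (cof ξ) ζ + ζ.det := by
  simp only [frob_cof, Matrix.det_fin_two, Matrix.add_apply]
  ring

lemma polarForm_add_smul (a θ : ℝ) (ξ ζ : Mat) (t : ℝ) :
    polarForm a θ (ξ + t • ζ) (ξ + t • ζ) =
      polarForm a θ ξ ξ + t * (2 * polarForm a θ ξ ζ) + t ^ 2 * polarForm a θ ζ ζ := by
  simp only [polarForm, Fin.sum_univ_two, radPart, tanPart, Matrix.add_apply, Matrix.smul_apply,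
    smul_eq_mul]
  ring

/-! ### Polar coordinates -/

lemma norm_eR (θ : ℝ) : ‖eR θ‖ = 1 := by
  simp [EuclideanSpace.norm_eq, Fin.sum_univ_two]

lemma norm_smul_eR {r : ℝ} (hr : 0 ≤ r) (θ : ℝ) : ‖r • eR θ‖ = r := by
  rw [norm_smul, norm_eR, mul_one, Real.norm_of_nonneg hr]

lemma smul_eR_ne_zero {r : ℝ} (hr : r ≠ 0) (θ : ℝ) : r • eR θ ≠ 0 :=
  smul_ne_zero hr (norm_ne_zero_iff.1 (by rw [norm_eR]; exact one_ne_zero))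

lemma norm_smul_eR_angle (x : Plane) : ‖x‖ • eR (angle x) = x := by
  have hnorm : ‖(⟨x 0, x 1⟩ : ℂ)‖ = ‖x‖ := by
    rw [EuclideanSpace.norm_eq, Complex.norm_def, Complex.normSq_apply, Fin.sum_univ_two]
    simp [sq]
  ext i
  fin_cases i
  · simpa [angle, hnorm] using Complex.norm_mul_cos_arg (⟨x 0, x 1⟩ : ℂ)
  · simpa [angle, hnorm] using Complex.norm_mul_sin_arg (⟨x 0, x 1⟩ : ℂ)

lemma eR_angle_smul_eR {r : ℝ} (hr : 0 < r) (θ : ℝ) : eR (angle (r • eR θ)) = eR θ := by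
  have h := norm_smul_eR_angle (r • eR θ)
  rw [norm_smul_eR hr.le] at h
  exact smul_right_injective _ hr.ne' h

lemma eR_eq_iff {θ θ' : ℝ} : eR θ = eR θ' ↔ cos θ = cos θ' ∧ sin θ = sin θ' := by
  refine ⟨fun h => ⟨congrArg (· 0) h, congrArg (· 1) h⟩, ?_⟩
  rintro ⟨hcos, hsin⟩
  simp [eR, hcos, hsin]

lemma cos_angle_smul_eR {r : ℝ} (hr : 0 < r) (θ : ℝ) : cos (angle (r • eR θ)) = cos θ :=
  (eR_eq_iff.1 (eR_angle_smul_eR hr θ)).1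

lemma sin_angle_smul_eR {r : ℝ} (hr : 0 < r) (θ : ℝ) : sin (angle (r • eR θ)) = sin θ :=
  (eR_eq_iff.1 (eR_angle_smul_eR hr θ)).2

lemma eTheta_angle_smul_eR {r : ℝ} (hr : 0 < r) (θ : ℝ) :
    eTheta (angle (r • eR θ)) = eTheta θ := by
  rw [eTheta, cos_angle_smul_eR hr, sin_angle_smul_eR hr, eTheta]

lemma cos_angle {x : Plane} (hx : x ≠ 0) : cos (angle x) = x 0 / ‖x‖ := by
  rw [eq_div_iff (norm_ne_zero_iff.2 hx), mul_comm]
  exact congrArg (· 0) (norm_smul_eR_angle x)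

lemma sin_angle {x : Plane} (hx : x ≠ 0) : sin (angle x) = x 1 / ‖x‖ := by
  rw [eq_div_iff (norm_ne_zero_iff.2 hx), mul_comm]
  exact congrArg (· 1) (norm_smul_eR_angle x)

lemma eR_nat_mul_congr (N : ℕ) {θ θ' : ℝ} (h : eR θ = eR θ') : eR (N * θ) = eR (N * θ') := by
  rw [eR_eq_iff] at h ⊢
  have hθ : ((N * θ : ℝ) : Real.Angle) = ((N * θ' : ℝ) : Real.Angle) := by
    rw [Real.Angle.natCast_mul_eq_nsmul, Real.Angle.natCast_mul_eq_nsmul,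
      Real.Angle.cos_sin_inj h.1 h.2]
  exact ⟨by rw [← Real.Angle.cos_coe, hθ, Real.Angle.cos_coe],
    by rw [← Real.Angle.sin_coe, hθ, Real.Angle.sin_coe]⟩

lemma eTheta_nat_mul_congr (N : ℕ) {θ θ' : ℝ} (h : eR θ = eR θ') :
    eTheta (N * θ) = eTheta (N * θ') := by
  obtain ⟨hcos, hsin⟩ := eR_eq_iff.1 (eR_nat_mul_congr N h)
  rw [eTheta, eTheta, hcos, hsin]

lemma eR_neg_pi : eR (-Real.pi) = eR Real.pi := by
  simp [eR_eq_iff]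

lemma eR_add_two_pi (θ : ℝ) : eR (θ + 2 * Real.pi) = eR θ := by
  rw [eR_eq_iff]
  exact ⟨Real.cos_add_two_pi θ, Real.sin_add_two_pi θ⟩

lemma abs_eR_apply_le (θ : ℝ) (i : Fin 2) : |eR θ i| ≤ 1 :=
  (PiLp.norm_apply_le (eR θ) i).trans (norm_eR θ).le

lemma abs_eTheta_apply_le (θ : ℝ) (i : Fin 2) : |eTheta θ i| ≤ 1 := by
  fin_cases i
  · simpa using Real.abs_sin_le_one θ
  · simpa using Real.abs_cos_le_one θ

lemma measurable_angle : Measurable angle := by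
  unfold angle
  exact Complex.measurable_arg.comp (Complex.measurableEquivRealProd.symm.measurable.comp
    (by fun_prop : Measurable fun x : Plane => (x 0, x 1)))

lemma eR_eq_add_single (θ : ℝ) : eR θ = cos θ • EuclideanSpace.single (0 : Fin 2) (1 : ℝ) +
    sin θ • EuclideanSpace.single (1 : Fin 2) (1 : ℝ) := by
  ext i
  fin_cases i <;> simp [eR]

lemma eTheta_eq_add_single (θ : ℝ) : eTheta θ =
    -sin θ • EuclideanSpace.single (0 : Fin 2) (1 : ℝ) +
      cos θ • EuclideanSpace.single (1 : Fin 2) (1 : ℝ) := by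
  ext i
  fin_cases i <;> simp [eTheta]

lemma hasDerivAt_eR (θ : ℝ) : HasDerivAt eR (eTheta θ) θ := by
  rw [eTheta_eq_add_single, funext eR_eq_add_single]
  exact ((Real.hasDerivAt_cos θ).smul_const _).add ((Real.hasDerivAt_sin θ).smul_const _)

lemma hasDerivAt_eTheta (θ : ℝ) : HasDerivAt eTheta (-eR θ) θ := by
  rw [eR_eq_add_single, funext eTheta_eq_add_single, neg_add, ← neg_smul, ← neg_smul]
  exact ((Real.hasDerivAt_sin θ).neg.smul_const _).add ((Real.hasDerivAt_cos θ).smul_const _)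

@[fun_prop]
lemma continuous_eR : Continuous eR :=
  continuous_iff_continuousAt.2 fun θ => (hasDerivAt_eR θ).continuousAt

@[fun_prop]
lemma continuous_eTheta : Continuous eTheta :=
  continuous_iff_continuousAt.2 fun θ => (hasDerivAt_eTheta θ).continuousAt

lemma continuous_smul_eR : Continuous fun p : ℝ × ℝ => p.1 • eR p.2 := by
  fun_prop

/-! ### Integration over the disc in polar coordinates -/

/-- The measure `dr dθ` on the coordinate rectangle `(0, 1) × (-π, π)` of the disc. -/
def polarMeasure : Measure (ℝ × ℝ) :=
  (volume.restrict (Ioo 0 1)).prod (volume.restrict (Ioo (-Real.pi) Real.pi))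

lemma polarMeasure_eq_restrict :
    polarMeasure = volume.restrict (Ioo (0 : ℝ) 1 ×ˢ Ioo (-Real.pi) Real.pi) := by
  rw [polarMeasure, Measure.prod_restrict]
  rfl

instance : IsFiniteMeasure polarMeasure := by unfold polarMeasure; infer_instance

instance : IsFiniteMeasure discMeasure := by
  unfold discMeasure disc
  exact isFiniteMeasure_restrict.2 measure_ball_lt_top.ne

lemma isOpen_disc : IsOpen disc := Metric.isOpen_ball

lemma ae_polarMeasure_mem :
    ∀ᵐ p ∂polarMeasure, p ∈ Ioo (0 : ℝ) 1 ×ˢ Ioo (-Real.pi) Real.pi := by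
  rw [polarMeasure_eq_restrict]
  exact ae_restrict_mem (measurableSet_Ioo.prod measurableSet_Ioo)

lemma ae_discMeasure_mem : ∀ᵐ x ∂discMeasure, x ∈ disc ∧ x ≠ 0 :=
  (ae_restrict_mem isOpen_disc.measurableSet).and (ae_restrict_of_ae (Measure.ae_ne volume 0))

lemma norm_mem_Ioo {x : Plane} (hx : x ∈ disc ∧ x ≠ 0) : ‖x‖ ∈ Ioo (0 : ℝ) 1 :=
  ⟨norm_pos_iff.2 hx.2, mem_ball_zero_iff.1 hx.1⟩

/-- The standard identification of the plane with `ℝ × ℝ`, where the polar coordinates of the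
library live. -/
def planeEquiv : Plane ≃ᵐ ℝ × ℝ :=
  (MeasurableEquiv.toLp 2 (Fin 2 → ℝ)).symm.trans MeasurableEquiv.finTwoArrow

lemma measurePreserving_planeEquiv : MeasurePreserving planeEquiv :=
  (volume_preserving_finTwoArrow ℝ).comp (PiLp.volume_preserving_ofLp (Fin 2))

lemma planeEquiv_symm_polarCoord_symm (p : ℝ × ℝ) :
    planeEquiv.symm (polarCoord.symm p) = p.1 • eR p.2 := by
  ext i
  fin_cases i <;> rfl

lemma lintegral_eq_lintegral_smul_eR (f : Plane → ℝ≥0∞) :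
    ∫⁻ x, f x = ∫⁻ p in Ioi (0 : ℝ) ×ˢ Ioo (-Real.pi) Real.pi,
      ENNReal.ofReal p.1 * f (p.1 • eR p.2) := by
  calc ∫⁻ x, f x = ∫⁻ p : ℝ × ℝ, f (planeEquiv.symm p) := by
        rw [← measurePreserving_planeEquiv.lintegral_comp_emb planeEquiv.measurableEmbedding]
        simp only [MeasurableEquiv.symm_apply_apply]
    _ = _ := by
        rw [← lintegral_comp_polarCoord_symm, polarCoord_target]
        simp only [planeEquiv_symm_polarCoord_symm, smul_eq_mul]

lemma lintegral_disc (f : Plane → ℝ≥0∞) :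
    ∫⁻ x, f x ∂discMeasure =
      ∫⁻ p, ENNReal.ofReal p.1 * f (p.1 • eR p.2) ∂polarMeasure := by
  have hrect : MeasurableSet (Ioo (0 : ℝ) 1 ×ˢ Ioo (-Real.pi) Real.pi) :=
    measurableSet_Ioo.prod measurableSet_Ioo
  have hsub : Ioo (0 : ℝ) 1 ×ˢ Ioo (-Real.pi) Real.pi ⊆ Ioi (0 : ℝ) ×ˢ Ioo (-Real.pi) Real.pi :=
    prod_mono Ioo_subset_Ioi_self le_rfl
  rw [discMeasure, ← lintegral_indicator isOpen_disc.measurableSet,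
    lintegral_eq_lintegral_smul_eR, polarMeasure_eq_restrict,
    ← Measure.restrict_restrict_of_subset hsub, ← lintegral_indicator hrect]
  refine setLIntegral_congr_fun (measurableSet_Ioi.prod measurableSet_Ioo) fun p hp => ?_
  have hmem : p.1 • eR p.2 ∈ disc ↔ p ∈ Ioo (0 : ℝ) 1 ×ˢ Ioo (-Real.pi) Real.pi := by
    rw [disc, mem_ball_zero_iff, norm_smul_eR (le_of_lt hp.1)]
    exact ⟨fun h => ⟨⟨hp.1, h⟩, hp.2⟩, fun h => h.1.2⟩
  by_cases h : p ∈ Ioo (0 : ℝ) 1 ×ˢ Ioo (-Real.pi) Real.pi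
  · simp only [indicator_of_mem h, indicator_of_mem (hmem.2 h)]
  · simp only [indicator_of_notMem h, indicator_of_notMem (mt hmem.1 h), mul_zero]

lemma discMeasure_eq_map : discMeasure =
    (polarMeasure.withDensity fun p => ENNReal.ofReal p.1).map fun p => p.1 • eR p.2 := by
  ext s hs
  have hpre : MeasurableSet ((fun p : ℝ × ℝ => p.1 • eR p.2) ⁻¹' s) :=
    continuous_smul_eR.measurable hs
  rw [Measure.map_apply continuous_smul_eR.measurable hs, withDensity_apply _ hpre,
    ← lintegral_indicator_one hs, lintegral_disc, ← lintegral_indicator hpre]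
  congr 1 with p
  by_cases h : p.1 • eR p.2 ∈ s <;> simp [h]

lemma integral_disc {f : Plane → ℝ} (hf : AEStronglyMeasurable f discMeasure) :
    ∫ x, f x ∂discMeasure = ∫ p, p.1 * f (p.1 • eR p.2) ∂polarMeasure := by
  rw [discMeasure_eq_map] at hf ⊢
  rw [integral_map continuous_smul_eR.aemeasurable hf,
    integral_withDensity_eq_integral_toReal_smul (by fun_prop) (by simp)]
  refine integral_congr_ae ?_
  filter_upwards [ae_polarMeasure_mem] with p hp
  rw [ENNReal.toReal_ofReal hp.1.1.le, smul_eq_mul]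

lemma integrable_disc_iff {f : Plane → ℝ} (hf : AEStronglyMeasurable f discMeasure) :
    Integrable f discMeasure ↔
      Integrable (fun p : ℝ × ℝ => p.1 * f (p.1 • eR p.2)) polarMeasure := by
  rw [discMeasure_eq_map] at hf ⊢
  rw [integrable_map_measure hf continuous_smul_eR.aemeasurable,
    integrable_withDensity_iff_integrable_smul' (by fun_prop) (by simp)]
  refine integrable_congr ?_
  filter_upwards [ae_polarMeasure_mem] with p hp
  rw [ENNReal.toReal_ofReal hp.1.1.le, smul_eq_mul, Function.comp_apply]

lemma discMeasure_univ : discMeasure.real univ = Real.pi := by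
  rw [discMeasure, measureReal_def, Measure.restrict_apply_univ, disc,
    EuclideanSpace.volume_ball_fin_two]
  simp [Real.pi_pos.le]

lemma integral_polarMeasure {F : ℝ × ℝ → ℝ} (hF : Integrable F polarMeasure) :
    ∫ p, F p ∂polarMeasure = ∫ r in (0 : ℝ)..1, ∫ θ in -Real.pi..Real.pi, F (r, θ) := by
  simp only [intervalIntegral.integral_of_le zero_le_one,
    intervalIntegral.integral_of_le (by linarith [pi_pos] : -Real.pi ≤ Real.pi),
    integral_Ioc_eq_integral_Ioo]
  exact integral_prod _ hF

lemma integral_polarMeasure_symm {F : ℝ × ℝ → ℝ} (hF : Integrable F polarMeasure) :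
    ∫ p, F p ∂polarMeasure = ∫ θ in -Real.pi..Real.pi, ∫ r in (0 : ℝ)..1, F (r, θ) := by
  simp only [intervalIntegral.integral_of_le zero_le_one,
    intervalIntegral.integral_of_le (by linarith [pi_pos] : -Real.pi ≤ Real.pi),
    integral_Ioc_eq_integral_Ioo]
  exact integral_prod_symm _ hF

lemma integrable_radial_mul_continuous {k : ℝ → ℝ} (hk : IntegrableOn k (Ioo 0 1))
    {F : ℝ × ℝ → ℝ} (hF : Continuous F) : Integrable (fun p => k p.1 * F p) polarMeasure := by
  have hk' : Integrable (fun p : ℝ × ℝ => k p.1) polarMeasure := Integrable.comp_fst hk _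
  obtain ⟨C, hC⟩ := (isCompact_Icc.prod isCompact_Icc :
    IsCompact (Icc (0 : ℝ) 1 ×ˢ Icc (-Real.pi) Real.pi)).exists_bound_of_continuousOn
      hF.continuousOn
  refine hk'.mul_bdd (c := C) hF.aestronglyMeasurable ?_
  filter_upwards [ae_polarMeasure_mem] with p hp
  exact hC p ⟨Ioo_subset_Icc_self hp.1, Ioo_subset_Icc_self hp.2⟩

lemma integrable_polarMeasure_of_continuous {F : ℝ × ℝ → ℝ} (hF : Continuous F) :
    Integrable F polarMeasure := by
  simpa only [one_mul] using
    integrable_radial_mul_continuous (k := fun _ => 1) (integrable_const 1) hF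

lemma memLp_norm_rpow_neg {s : ℝ} {q : ℝ≥0∞} (hq0 : q ≠ 0) (hq : q ≠ ⊤)
    (hsq : s * q.toReal < 2) : MemLp (fun x : Plane => ‖x‖ ^ (-s)) q discMeasure := by
  have hm : Measurable fun x : Plane => ‖x‖ ^ (-s) := by fun_prop
  have hm' : Measurable fun x : Plane => ‖‖x‖ ^ (-s)‖ ^ q.toReal := by fun_prop
  rw [← integrable_norm_rpow_iff hm.aestronglyMeasurable hq0 hq,
    integrable_disc_iff hm'.aestronglyMeasurable]
  have hradial : IntegrableOn (fun r : ℝ => r ^ (1 - s * q.toReal)) (Ioo 0 1) := by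
    rw [intervalIntegral.integrableOn_Ioo_rpow_iff zero_lt_one]
    linarith
  refine (integrable_radial_mul_continuous hradial (continuous_const (y := (1 : ℝ)))).congr ?_
  filter_upwards [ae_polarMeasure_mem] with p hp
  have hr : 0 < p.1 := hp.1.1
  rw [norm_smul_eR hr.le, Real.norm_of_nonneg (by positivity), ← Real.rpow_mul hr.le,
    sub_eq_add_neg, Real.rpow_add hr, Real.rpow_one, neg_mul, mul_one]

lemma abs_log_le_inv_mul_rpow_neg {r s : ℝ} (h0 : 0 < r) (h1 : r ≤ 1) (hs : 0 < s) :
    |Real.log r| ≤ s⁻¹ * r ^ (-s) := by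
  have h := Real.abs_log_mul_self_rpow_lt r s h0 h1 hs
  have hp : 0 < r ^ s := by positivity
  rw [abs_mul, abs_of_pos hp] at h
  rw [Real.rpow_neg h0.le, ← div_eq_mul_inv, le_div_iff₀ hp, inv_eq_one_div]
  exact h.le

lemma memLp_log_norm {q : ℝ≥0∞} (hq0 : q ≠ 0) (hq : q ≠ ⊤) :
    MemLp (fun x : Plane => Real.log ‖x‖) q discMeasure := by
  have hm : Measurable fun x : Plane => Real.log ‖x‖ := by fun_prop
  have hq' : 0 < q.toReal := ENNReal.toReal_pos hq0 hq
  have hsq : 1 / q.toReal * q.toReal < 2 := by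
    rw [one_div_mul_cancel hq'.ne']
    exact one_lt_two
  refine ((memLp_norm_rpow_neg hq0 hq hsq).const_mul (1 / q.toReal)⁻¹).mono
    hm.aestronglyMeasurable ?_
  filter_upwards [ae_discMeasure_mem] with x hx
  obtain ⟨h0, h1⟩ := norm_mem_Ioo hx
  rw [Real.norm_eq_abs, Real.norm_of_nonneg (by positivity)]
  exact abs_log_le_inv_mul_rpow_neg h0 h1.le (by positivity)

/-! ### Limits in `Lᵖ` -/

section LpLimits

variable {α E : Type*} [MeasurableSpace α] {μ : Measure α} [NormedAddCommGroup E]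

lemma tendsto_eLpNorm_of_dominated {p : ℝ≥0∞} (hp0 : p ≠ 0) (hp : p ≠ ⊤) {f : ℕ → α → E}
    {F : α → ℝ} (hm : ∀ n, AEStronglyMeasurable (f n) μ) (hF : MemLp F p μ)
    (hb : ∀ n, ∀ᵐ x ∂μ, ‖f n x‖ ≤ F x)
    (hlim : ∀ᵐ x ∂μ, Tendsto (fun n => f n x) atTop (𝓝 0)) :
    Tendsto (fun n => eLpNorm (f n) p μ) atTop (𝓝 0) := by
  have hpos : 0 < p.toReal := ENNReal.toReal_pos hp0 hp
  have hpow {l : Filter ℕ} {u : ℕ → ℝ≥0∞} {s : ℝ} (hs : 0 < s) (hu : Tendsto u l (𝓝 0)) :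
      Tendsto (fun n => u n ^ s) l (𝓝 0) := by
    simpa only [ENNReal.zero_rpow_of_pos hs] using hu.ennrpow_const s
  have hint : Tendsto (fun n => ∫⁻ x, ‖f n x‖ₑ ^ p.toReal ∂μ) atTop (𝓝 (∫⁻ _, 0 ∂μ)) := by
    refine tendsto_lintegral_of_dominated_convergence' (fun x => ‖F x‖ₑ ^ p.toReal)
      (fun n => (hm n).enorm.pow_const _) (fun n => ?_)
      (lintegral_rpow_enorm_lt_top_of_eLpNorm_lt_top hp0 hp hF.2).ne ?_
    · filter_upwards [hb n] with x hx
      gcongr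
      exact enorm_le_iff_norm_le.2 (hx.trans (le_abs_self _))
    · filter_upwards [hlim] with x hx
      refine hpow hpos ?_
      simpa only [enorm_zero] using hx.enorm
  rw [lintegral_zero] at hint
  simp only [eLpNorm_eq_lintegral_rpow_enorm_toReal hp0 hp]
  exact hpow (one_div_pos.2 hpos) hint

lemma inner_toLp_eq_integral {u v : α → ℝ} (hu : MemLp u 2 μ) (hv : MemLp v 2 μ) :
    inner ℝ (hu.toLp u) (hv.toLp v) = ∫ x, u x * v x ∂μ := by
  rw [L2.inner_def]
  refine integral_congr_ae ?_
  filter_upwards [hu.coeFn_toLp, hv.coeFn_toLp] with x hux hvx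
  rw [hux, hvx]
  exact mul_comm _ _

lemma tendsto_integral_mul_of_eLpNorm_two {ι : Type*} {l : Filter ι} {f g : ι → α → ℝ}
    {F G : α → ℝ} (hf : ∀ n, MemLp (f n) 2 μ) (hg : ∀ n, MemLp (g n) 2 μ)
    (hF : MemLp F 2 μ) (hG : MemLp G 2 μ)
    (hfF : Tendsto (fun n => eLpNorm (fun x => f n x - F x) 2 μ) l (𝓝 0))
    (hgG : Tendsto (fun n => eLpNorm (fun x => g n x - G x) 2 μ) l (𝓝 0)) :
    Tendsto (fun n => ∫ x, f n x * g n x ∂μ) l (𝓝 (∫ x, F x * G x ∂μ)) := by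
  have hf' := (Lp.tendsto_Lp_iff_tendsto_eLpNorm'' f hf F hF).2 hfF
  have hg' := (Lp.tendsto_Lp_iff_tendsto_eLpNorm'' g hg G hG).2 hgG
  simpa only [inner_toLp_eq_integral] using hf'.inner (𝕜 := ℝ) hg'

lemma tendsto_eLpNorm_mul_bdd {ι : Type*} {l : Filter ι} {p : ℝ≥0∞} {f : ι → α → ℝ}
    {F w : α → ℝ} {C : ℝ} (hw : ∀ᵐ x ∂μ, |w x| ≤ C)
    (hf : Tendsto (fun n => eLpNorm (fun x => f n x - F x) p μ) l (𝓝 0)) :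
    Tendsto (fun n => eLpNorm (fun x => w x * f n x - w x * F x) p μ) l (𝓝 0) := by
  have hC : Tendsto (fun n => ENNReal.ofReal C * eLpNorm (fun x => f n x - F x) p μ) l (𝓝 0) := by
    simpa only [mul_zero] using ENNReal.Tendsto.const_mul hf (Or.inr ENNReal.ofReal_ne_top)
  refine tendsto_of_tendsto_of_tendsto_of_le_of_le tendsto_const_nhds hC (fun n => zero_le)
    (fun n => eLpNorm_le_mul_eLpNorm_of_ae_le_mul ?_ p)
  filter_upwards [hw] with x hx
  rw [← mul_sub, norm_mul]
  gcongr
  exact hx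

lemma tendsto_integral_bdd_mul {ι : Type*} {l : Filter ι} {f : ι → α → ℝ} {F w : α → ℝ} {C : ℝ}
    (hwm : AEStronglyMeasurable w μ) (hw : ∀ᵐ x ∂μ, |w x| ≤ C) (hfi : ∀ n, Integrable (f n) μ)
    (hFi : Integrable F μ) (hf : Tendsto (fun n => eLpNorm (fun x => f n x - F x) 1 μ) l (𝓝 0)) :
    Tendsto (fun n => ∫ x, w x * f n x ∂μ) l (𝓝 (∫ x, w x * F x ∂μ)) :=
  tendsto_integral_of_L1' _ (hFi.bdd_mul hwm hw).1
    (Eventually.of_forall fun n => (hfi n).bdd_mul hwm hw) (tendsto_eLpNorm_mul_bdd hw hf)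

end LpLimits

/-! ### Weak derivatives on the disc -/

lemma continuous_partialDeriv {f : Plane → ℝ} (hf : ContDiff ℝ ∞ f) (j : Fin 2) :
    Continuous (partialDeriv j f) :=
  (hf.continuous_fderiv (by simp)).clm_apply continuous_const

lemma IsTest.partialDeriv {φ : Plane → ℝ} (hφ : IsTest φ) (j : Fin 2) :
    IsTest (partialDeriv j φ) :=
  ⟨(hφ.1.fderiv_right (by simp)).clm_apply contDiff_const, hφ.2.1.fderiv_apply ℝ _,
    (tsupport_fderiv_apply_subset ℝ _).trans hφ.2.2⟩

lemma IsTest.eq_zero {F : Type*} [NormedAddCommGroup F] [NormedSpace ℝ F] {φ : Plane → F}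
    (hφ : IsTest φ) {x : Plane} (hx : x ∉ disc) : φ x = 0 :=
  image_eq_zero_of_notMem_tsupport fun h => hx (hφ.2.2 h)

lemma IsTest.integrable_mul {f φ : Plane → ℝ} (hφ : IsTest φ)
    (hf : LocallyIntegrableOn f disc volume) : Integrable (fun x => f x * φ x) discMeasure := by
  have hfφ : IntegrableOn f (tsupport φ) volume :=
    hf.integrableOn_compact_subset hφ.2.2 hφ.2.1.isCompact
  obtain ⟨C, hC⟩ := hφ.2.1.exists_bound_of_continuous hφ.1.continuous
  have hmul : IntegrableOn (fun x => f x * φ x) (tsupport φ) volume :=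
    Integrable.mul_bdd (c := C) hfφ hφ.1.continuous.aestronglyMeasurable (ae_of_all _ hC)
  rw [integrableOn_iff_integrable_of_support_subset
    ((Function.support_mul_subset_right _ _).trans (subset_tsupport φ))] at hmul
  exact hmul.integrableOn

lemma IsTest.integral_mul_eq {φ : Plane → ℝ} (hφ : IsTest φ) (f : Plane → ℝ) :
    ∫ x, f x * φ x ∂discMeasure = ∫ x, f x * φ x :=
  setIntegral_eq_integral_of_forall_compl_eq_zero fun x hx => by rw [hφ.eq_zero hx, mul_zero]

lemma memLp_disc_of_continuous {f : Plane → ℝ} (hf : Continuous f) (q : ℝ≥0∞) :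
    MemLp f q discMeasure := by
  obtain ⟨C, hC⟩ := (isCompact_closedBall (0 : Plane) 1).exists_bound_of_continuousOn
    hf.continuousOn
  refine MemLp.of_bound hf.aestronglyMeasurable C ?_
  filter_upwards [ae_discMeasure_mem] with x hx
  exact hC x (Metric.ball_subset_closedBall hx.1)

lemma integrable_disc_of_continuous {f : Plane → ℝ} (hf : Continuous f) :
    Integrable f discMeasure :=
  memLp_one_iff_integrable.1 (memLp_disc_of_continuous hf 1)

lemma hasWeakPartial_of_contDiff {f : Plane → ℝ} (hf : ContDiff ℝ ∞ f) (j : Fin 2) :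
    HasWeakPartial j f (partialDeriv j f) := by
  have hf' := continuous_partialDeriv hf j
  refine ⟨hf.continuous.locallyIntegrable.locallyIntegrableOn _,
    hf'.locallyIntegrable.locallyIntegrableOn _, fun φ hφ => ?_⟩
  rw [(hφ.partialDeriv j).integral_mul_eq, hφ.integral_mul_eq]
  exact integral_mul_fderiv_eq_neg_fderiv_mul_of_integrable
    ((hf'.mul hφ.1.continuous).integrable_of_hasCompactSupport hφ.2.1.mul_left)
    ((hf.continuous.mul (hφ.partialDeriv j).1.continuous).integrable_of_hasCompactSupport
      (hφ.partialDeriv j).2.1.mul_left)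
    ((hf.continuous.mul hφ.1.continuous).integrable_of_hasCompactSupport hφ.2.1.mul_left)
    (fun x _ => hf.differentiable (by simp) x) (fun x _ => hφ.1.differentiable (by simp) x)

lemma HasWeakPartial.ae_eq {j : Fin 2} {f g g' : Plane → ℝ} (h : HasWeakPartial j f g)
    (h' : HasWeakPartial j f g') : g =ᵐ[discMeasure] g' := by
  have hzero : ∀ᵐ x, x ∈ disc → g x - g' x = 0 := by
    refine isOpen_disc.ae_eq_zero_of_integral_contDiff_smul_eq_zero (h.2.1.sub h'.2.1) ?_
    intro φ hsmooth hcompact hsupp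
    have hφ : IsTest φ := ⟨hsmooth, hcompact, hsupp⟩
    calc ∫ x, φ x • (g x - g' x) = ∫ x, (g x - g' x) * φ x ∂discMeasure := by
          rw [hφ.integral_mul_eq]
          simp only [smul_eq_mul, mul_comm]
      _ = ∫ x, g x * φ x ∂discMeasure - ∫ x, g' x * φ x ∂discMeasure := by
          simp only [sub_mul]
          exact integral_sub (hφ.integrable_mul h.2.1) (hφ.integrable_mul h'.2.1)
      _ = 0 := by rw [sub_eq_zero, ← neg_inj, ← h.2.2 φ hφ, h'.2.2 φ hφ]
  filter_upwards [(ae_restrict_iff' isOpen_disc.measurableSet).2 hzero] with x hx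
  exact sub_eq_zero.1 hx

lemma HasWeakPartial.add_const_mul {j : Fin 2} {f g f' g' : Plane → ℝ}
    (h : HasWeakPartial j f g) (h' : HasWeakPartial j f' g') (t : ℝ) :
    HasWeakPartial j (fun x => f x + t * f' x) (fun x => g x + t * g' x) := by
  refine ⟨h.1.add (h'.1.smul t), h.2.1.add (h'.2.1.smul t), fun φ hφ => ?_⟩
  have hφ' := hφ.partialDeriv j
  simp only [add_mul, mul_assoc]
  rw [integral_add (hφ'.integrable_mul h.1) ((hφ'.integrable_mul h'.1).const_mul t),
    integral_add (hφ.integrable_mul h.2.1) ((hφ.integrable_mul h'.2.1).const_mul t),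
    integral_const_mul, integral_const_mul, h.2.2 φ hφ, h'.2.2 φ hφ]
  ring

lemma locallyIntegrableOn_disc {f : Plane → ℝ} (hf : Integrable f discMeasure) :
    LocallyIntegrableOn f disc volume :=
  IntegrableOn.locallyIntegrableOn hf

lemma hasWeakPartial_of_tendsto {j : Fin 2} {f g : Plane → ℝ} {F : ℕ → Plane → ℝ}
    (hF : ∀ n, ContDiff ℝ ∞ (F n)) (hf : Integrable f discMeasure) (hg : Integrable g discMeasure)
    (hFf : Tendsto (fun n => eLpNorm (fun x => F n x - f x) 1 discMeasure) atTop (𝓝 0))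
    (hFg : Tendsto (fun n => eLpNorm (fun x => partialDeriv j (F n) x - g x) 1 discMeasure)
      atTop (𝓝 0)) : HasWeakPartial j f g := by
  refine ⟨locallyIntegrableOn_disc hf, locallyIntegrableOn_disc hg, fun φ hφ => ?_⟩
  have htest {ψ : Plane → ℝ} (hψ : IsTest ψ) {u : Plane → ℝ} {U : ℕ → Plane → ℝ}
      (hU : ∀ n, Continuous (U n)) (hu : Integrable u discMeasure)
      (hUu : Tendsto (fun n => eLpNorm (fun x => U n x - u x) 1 discMeasure) atTop (𝓝 0)) :
      Tendsto (fun n => ∫ x, U n x * ψ x ∂discMeasure) atTop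
        (𝓝 (∫ x, u x * ψ x ∂discMeasure)) := by
    obtain ⟨C, hC⟩ := hψ.2.1.exists_bound_of_continuous hψ.1.continuous
    simpa only [mul_comm] using
      tendsto_integral_bdd_mul hψ.1.continuous.aestronglyMeasurable (ae_of_all _ hC)
        (fun n => integrable_disc_of_continuous (hU n)) hu hUu
  have hleft := htest (hφ.partialDeriv j) (fun n => (hF n).continuous) hf hFf
  simp only [fun n => (hasWeakPartial_of_contDiff (hF n) j).2.2 φ hφ] at hleft
  exact tendsto_nhds_unique hleft
    (htest hφ (fun n => continuous_partialDeriv (hF n) j) hg hFg).neg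

/-! ### Functions that are smooth away from the origin -/

section Cutoff

variable {E : Type*} [NormedAddCommGroup E]

/-- The smooth radial cutoff that vanishes for `(n + 1) ‖x‖ ≤ 1` and equals `1` for
`(n + 1) ‖x‖ ≥ √2`. It removes a point singularity at the origin. -/
def cutoff (n : ℕ) (x : E) : ℝ := Real.smoothTransition (((n : ℝ) + 1) ^ 2 * ‖x‖ ^ 2 - 1)

lemma abs_cutoff_le_one (n : ℕ) (x : E) : |cutoff n x| ≤ 1 := by
  rw [cutoff, abs_of_nonneg (Real.smoothTransition.nonneg _)]
  exact Real.smoothTransition.le_one _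

lemma eventually_cutoff_eventuallyEq_one {x : E} (hx : x ≠ 0) :
    ∀ᶠ n : ℕ in atTop, cutoff n =ᶠ[𝓝 x] 1 := by
  have hpos : 0 < ‖x‖ ^ 2 := by positivity
  have hlim : Tendsto (fun n : ℕ => ((n : ℝ) + 1) ^ 2 * ‖x‖ ^ 2 - 1) atTop atTop :=
    tendsto_atTop_add_const_right _ _ (((tendsto_pow_atTop two_ne_zero).comp
      (tendsto_atTop_add_const_right _ _ tendsto_natCast_atTop_atTop)).atTop_mul_const hpos)
  filter_upwards [hlim.eventually_gt_atTop 1] with n hn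
  have hc : Continuous fun y : E => ((n : ℝ) + 1) ^ 2 * ‖y‖ ^ 2 - 1 := by fun_prop
  filter_upwards [(hc.tendsto x).eventually (lt_mem_nhds hn)] with y hy
  exact Real.smoothTransition.one_of_one_le hy.le

lemma cutoff_eventuallyEq_zero (n : ℕ) : (cutoff n : E → ℝ) =ᶠ[𝓝 0] 0 := by
  have hc : Continuous fun y : E => ((n : ℝ) + 1) ^ 2 * ‖y‖ ^ 2 - 1 := by fun_prop
  have hneg : ((n : ℝ) + 1) ^ 2 * ‖(0 : E)‖ ^ 2 - 1 < 0 := by simp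
  filter_upwards [(hc.tendsto 0).eventually (gt_mem_nhds hneg)] with y hy
  exact Real.smoothTransition.zero_of_nonpos hy.le

lemma deriv_smoothTransition_eq_zero {t : ℝ} (ht : t ∉ Icc (0 : ℝ) 1) :
    deriv Real.smoothTransition t = 0 := by
  rw [mem_Icc, not_and_or, not_le, not_le] at ht
  rcases ht with ht | ht
  · have hzero : Real.smoothTransition =ᶠ[𝓝 t] fun _ => 0 := by
      filter_upwards [gt_mem_nhds ht] with s hs
      exact Real.smoothTransition.zero_of_nonpos hs.le
    rw [hzero.deriv_eq, deriv_const]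
  · have hone : Real.smoothTransition =ᶠ[𝓝 t] fun _ => 1 := by
      filter_upwards [lt_mem_nhds ht] with s hs
      exact Real.smoothTransition.one_of_one_le hs.le
    rw [hone.deriv_eq, deriv_const]

lemma exists_abs_deriv_smoothTransition_mul_le :
    ∃ C, ∀ t : ℝ, |deriv Real.smoothTransition t| * |t + 1| ≤ C := by
  have hc : Continuous (deriv Real.smoothTransition) :=
    (Real.smoothTransition.contDiff (n := 1)).continuous_deriv le_rfl
  obtain ⟨C, hC⟩ := (isCompact_Icc (a := (0 : ℝ)) (b := 1)).exists_bound_of_continuousOn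
    ((hc.abs.mul (continuous_id.add continuous_const).abs).continuousOn (s := Icc 0 1))
  have hC0 : 0 ≤ C := (norm_nonneg _).trans (hC 0 (by simp))
  refine ⟨C, fun t => ?_⟩
  by_cases ht : t ∈ Icc (0 : ℝ) 1
  · exact (le_abs_self _).trans (hC t ht)
  · rwa [deriv_smoothTransition_eq_zero ht, abs_zero, zero_mul]

variable [InnerProductSpace ℝ E]

lemma contDiff_cutoff (n : ℕ) : ContDiff ℝ ∞ (cutoff n : E → ℝ) :=
  Real.smoothTransition.contDiff.comp
    ((contDiff_const.mul (contDiff_norm_sq ℝ)).sub contDiff_const)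

lemma exists_norm_fderiv_cutoff_le :
    ∃ C, ∀ (n : ℕ) (x : E), x ≠ 0 → ‖fderiv ℝ (cutoff n) x‖ ≤ C / ‖x‖ := by
  obtain ⟨C, hC⟩ := exists_abs_deriv_smoothTransition_mul_le
  refine ⟨2 * C, fun n x hx => ?_⟩
  have hin : HasFDerivAt (fun y : E => ((n : ℝ) + 1) ^ 2 * ‖y‖ ^ 2 - 1)
      (((n : ℝ) + 1) ^ 2 • (2 • innerSL ℝ x)) x :=
    ((hasStrictFDerivAt_norm_sq x).hasFDerivAt.const_mul _).sub_const _
  have hout : DifferentiableAt ℝ Real.smoothTransition (((n : ℝ) + 1) ^ 2 * ‖x‖ ^ 2 - 1) :=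
    (Real.smoothTransition.contDiff (n := 1)).differentiable one_ne_zero _
  have hfderiv := (hout.hasDerivAt.comp_hasFDerivAt x hin).fderiv
  have hnorm : ‖(2 : ℕ) • innerSL ℝ x‖ = 2 * ‖x‖ := by
    rw [← Nat.cast_smul_eq_nsmul ℝ, norm_smul, innerSL_apply_norm, Nat.cast_ofNat, Real.norm_two]
  have hbound := hC (((n : ℝ) + 1) ^ 2 * ‖x‖ ^ 2 - 1)
  rw [sub_add_cancel, abs_of_nonneg (by positivity : 0 ≤ ((n : ℝ) + 1) ^ 2 * ‖x‖ ^ 2)] at hbound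
  rw [le_div_iff₀ (norm_pos_iff.2 hx)]
  calc ‖fderiv ℝ (cutoff n) x‖ * ‖x‖
      = 2 * (|deriv Real.smoothTransition (((n : ℝ) + 1) ^ 2 * ‖x‖ ^ 2 - 1)| *
          (((n : ℝ) + 1) ^ 2 * ‖x‖ ^ 2)) := by
        change ‖fderiv ℝ (Real.smoothTransition ∘ _) x‖ * ‖x‖ = _
        rw [hfderiv, norm_smul, norm_smul, hnorm, Real.norm_eq_abs, Real.norm_eq_abs,
          abs_of_nonneg (by positivity : 0 ≤ ((n : ℝ) + 1) ^ 2)]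
        ring
    _ ≤ 2 * C := by gcongr

lemma contDiff_cutoff_mul {f : E → ℝ} (hf : ContDiffOn ℝ ∞ f {0}ᶜ) (n : ℕ) :
    ContDiff ℝ ∞ fun x => cutoff n x * f x := by
  refine contDiff_iff_contDiffAt.2 fun x => ?_
  rcases eq_or_ne x 0 with rfl | hx
  · have hzero : (fun x => cutoff n x * f x) =ᶠ[𝓝 0] fun _ => 0 := by
      filter_upwards [cutoff_eventuallyEq_zero n] with y hy
      rw [hy, Pi.zero_apply, zero_mul]
    exact contDiffAt_const.congr_of_eventuallyEq hzero
  · exact (contDiff_cutoff n).contDiffAt.mul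
      (hf.contDiffAt (isOpen_compl_singleton.mem_nhds hx))

end Cutoff

lemma abs_partialDeriv_le_norm_fderiv (j : Fin 2) (f : Plane → ℝ) (x : Plane) :
    |partialDeriv j f x| ≤ ‖fderiv ℝ f x‖ := by
  have h := (fderiv ℝ f x).le_opNorm (EuclideanSpace.single j 1)
  rwa [PiLp.norm_single, norm_one, mul_one, Real.norm_eq_abs] at h

lemma partialDeriv_cutoff_mul {f : Plane → ℝ} (n : ℕ) {x : Plane} (hf : DifferentiableAt ℝ f x)
    (j : Fin 2) : partialDeriv j (fun y => cutoff n y * f y) x =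
      cutoff n x * partialDeriv j f x + f x * partialDeriv j (cutoff n) x := by
  rw [partialDeriv, fderiv_fun_mul ((contDiff_cutoff n).differentiable (by simp) x) hf]
  rfl

lemma aestronglyMeasurable_of_continuousOn_compl_zero {f : Plane → ℝ}
    (hf : ContinuousOn f {0}ᶜ) : AEStronglyMeasurable f discMeasure := by
  have h := hf.aestronglyMeasurable (μ := discMeasure) (measurableSet_singleton 0).compl
  have hmem : ∀ᵐ x ∂discMeasure, x ∈ ({0}ᶜ : Set Plane) := by
    filter_upwards [ae_discMeasure_mem] with x hx using hx.2
  rwa [Measure.restrict_eq_self_of_ae_mem hmem] at h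

lemma continuousOn_partialDeriv {f : Plane → ℝ} (hf : ContDiffOn ℝ ∞ f {0}ᶜ) (j : Fin 2) :
    ContinuousOn (partialDeriv j f) {0}ᶜ :=
  (hf.continuousOn_fderiv_of_isOpen isOpen_compl_singleton (by simp)).clm_apply continuousOn_const

lemma memLp_of_memLp_div_norm {f : Plane → ℝ} {q : ℝ≥0∞} (hf : ContinuousOn f {0}ᶜ)
    (h : MemLp (fun x => f x / ‖x‖) q discMeasure) : MemLp f q discMeasure := by
  refine h.mono (aestronglyMeasurable_of_continuousOn_compl_zero hf) ?_
  filter_upwards [ae_discMeasure_mem] with x hx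
  obtain ⟨h0, h1⟩ := norm_mem_Ioo hx
  rw [norm_div, norm_norm, le_div_iff₀ h0]
  exact mul_le_of_le_one_right (norm_nonneg _) h1.le

lemma tendsto_cutoff_mul {f : Plane → ℝ} {q : ℝ≥0∞} (hq0 : q ≠ 0) (hq : q ≠ ⊤)
    (hf : ContDiffOn ℝ ∞ f {0}ᶜ) (h : MemLp f q discMeasure) :
    Tendsto (fun n => eLpNorm (fun x => cutoff n x * f x - f x) q discMeasure) atTop (𝓝 0) := by
  refine tendsto_eLpNorm_of_dominated hq0 hq
    (fun n => (contDiff_cutoff_mul hf n).continuous.aestronglyMeasurable.sub h.1)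
    (h.norm.const_mul 2) (fun n => ae_of_all _ fun x => ?_) ?_
  · calc ‖cutoff n x * f x - f x‖ ≤ |cutoff n x| * ‖f x‖ + ‖f x‖ := by
          rw [← Real.norm_eq_abs, ← norm_mul]
          exact norm_sub_le _ _
      _ ≤ 1 * ‖f x‖ + ‖f x‖ := by gcongr; exact abs_cutoff_le_one n x
      _ = 2 * ‖f x‖ := by ring
  · filter_upwards [ae_discMeasure_mem] with x hx
    refine tendsto_const_nhds.congr' ?_
    filter_upwards [eventually_cutoff_eventuallyEq_one hx.2] with n hn
    rw [hn.self_of_nhds, Pi.one_apply, one_mul, sub_self]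

lemma tendsto_partialDeriv_cutoff_mul {f : Plane → ℝ} {q : ℝ≥0∞} (hq0 : q ≠ 0) (hq : q ≠ ⊤)
    (hf : ContDiffOn ℝ ∞ f {0}ᶜ) (h : MemLp (fun x => f x / ‖x‖) q discMeasure) {j : Fin 2}
    (hj : MemLp (partialDeriv j f) q discMeasure) :
    Tendsto (fun n => eLpNorm (fun x => partialDeriv j (fun y => cutoff n y * f y) x -
      partialDeriv j f x) q discMeasure) atTop (𝓝 0) := by
  obtain ⟨C, hC⟩ := exists_norm_fderiv_cutoff_le (E := Plane)
  refine tendsto_eLpNorm_of_dominated hq0 hq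
    (fun n => (continuous_partialDeriv (contDiff_cutoff_mul hf n) j).aestronglyMeasurable.sub hj.1)
    ((hj.norm.const_mul 2).add (h.norm.const_mul C)) (fun n => ?_) ?_
  · filter_upwards [ae_discMeasure_mem] with x hx
    have hfx : DifferentiableAt ℝ f x :=
      (hf.contDiffAt (isOpen_compl_singleton.mem_nhds hx.2)).differentiableAt (by simp)
    have hcut := abs_cutoff_le_one n x
    have hcut' := (abs_partialDeriv_le_norm_fderiv j (cutoff n) x).trans (hC n x hx.2)
    rw [partialDeriv_cutoff_mul n hfx]
    calc _ ≤ |cutoff n x| * ‖partialDeriv j f x‖ + ‖f x‖ * |partialDeriv j (cutoff n) x|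
          + ‖partialDeriv j f x‖ := by
          rw [← Real.norm_eq_abs, ← Real.norm_eq_abs, ← norm_mul, ← norm_mul]
          exact (norm_sub_le _ _).trans (by gcongr; exact norm_add_le _ _)
      _ ≤ 1 * ‖partialDeriv j f x‖ + ‖f x‖ * (C / ‖x‖) + ‖partialDeriv j f x‖ := by gcongr
      _ = _ := by
        simp only [Pi.add_apply, norm_div, norm_norm]
        ring
  · filter_upwards [ae_discMeasure_mem] with x hx
    refine tendsto_const_nhds.congr' ?_
    filter_upwards [eventually_cutoff_eventuallyEq_one hx.2] with n hn
    have heq : (fun y => cutoff n y * f y) =ᶠ[𝓝 x] f := by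
      filter_upwards [hn] with y hy
      rw [hy, Pi.one_apply, one_mul]
    rw [partialDeriv, heq.fderiv_eq, partialDeriv, sub_self]

lemma hasWeakPartial_of_contDiffOn {f : Plane → ℝ} (hf : ContDiffOn ℝ ∞ f {0}ᶜ)
    (h : MemLp (fun x => f x / ‖x‖) 1 discMeasure) {j : Fin 2}
    (hj : MemLp (partialDeriv j f) 1 discMeasure) :
    HasWeakPartial j f (partialDeriv j f) := by
  have hf1 : MemLp f 1 discMeasure := memLp_of_memLp_div_norm hf.continuousOn h
  exact hasWeakPartial_of_tendsto (contDiff_cutoff_mul hf)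
    (memLp_one_iff_integrable.1 hf1) (memLp_one_iff_integrable.1 hj)
    (tendsto_cutoff_mul one_ne_zero ENNReal.one_ne_top hf hf1)
    (tendsto_partialDeriv_cutoff_mul one_ne_zero ENNReal.one_ne_top hf h hj)

/-! ### Polar derivatives -/

lemma fderiv_eR (f : Plane → ℝ) (x : Plane) (θ : ℝ) :
    fderiv ℝ f x (eR θ) = partialDeriv 0 f x * cos θ + partialDeriv 1 f x * sin θ := by
  rw [eR_eq_add_single, map_add, map_smul, map_smul, partialDeriv, partialDeriv, smul_eq_mul,
    smul_eq_mul]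
  ring

lemma fderiv_eTheta (f : Plane → ℝ) (x : Plane) (θ : ℝ) :
    fderiv ℝ f x (eTheta θ) = -(partialDeriv 0 f x * sin θ) + partialDeriv 1 f x * cos θ := by
  rw [eTheta_eq_add_single, map_add, map_smul, map_smul, partialDeriv, partialDeriv, smul_eq_mul,
    smul_eq_mul]
  ring

lemma hasDerivAt_comp_smul_eR_left {F : Type*} [NormedAddCommGroup F] [NormedSpace ℝ F]
    {f : Plane → F} {r θ : ℝ} (hf : DifferentiableAt ℝ f (r • eR θ)) :
    HasDerivAt (fun s : ℝ => f (s • eR θ)) (fderiv ℝ f (r • eR θ) (eR θ)) r := by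
  have h : HasDerivAt (fun s : ℝ => s • eR θ) (eR θ) r := by
    simpa only [one_smul] using (hasDerivAt_id' r).smul_const (eR θ)
  exact hf.hasFDerivAt.comp_hasDerivAt r h

lemma hasDerivAt_comp_smul_eR_right {F : Type*} [NormedAddCommGroup F] [NormedSpace ℝ F]
    {f : Plane → F} {r θ : ℝ} (hf : DifferentiableAt ℝ f (r • eR θ)) :
    HasDerivAt (fun t : ℝ => f (r • eR t)) (r • fderiv ℝ f (r • eR θ) (eTheta θ)) θ := by
  rw [← map_smul]
  exact hf.hasFDerivAt.comp_hasDerivAt θ ((hasDerivAt_eR θ).const_smul r)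

/-! ### Positively homogeneous functions -/

section PosHomogeneous

variable {E F : Type*} [NormedAddCommGroup E] [NormedSpace ℝ E] [NormedAddCommGroup F]
  [NormedSpace ℝ F]

/-- Positive homogeneity of degree `s`. The coefficients of the functional have degree `0`, the
covering map (up to a translation) has degree `1`, and their derivatives one degree less, which
decides the integrability of all of them near the origin. -/
def PosHomogeneous (s : ℝ) (f : E → F) : Prop :=
  ∀ r : ℝ, 0 < r → ∀ x, f (r • x) = r ^ s • f x

lemma posHomogeneous_zero_iff {f : E → F} :
    PosHomogeneous 0 f ↔ ∀ r : ℝ, 0 < r → ∀ x, f (r • x) = f x := by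
  simp only [PosHomogeneous, Real.rpow_zero, one_smul]

lemma PosHomogeneous.fderiv {s : ℝ} {f : E → F} (hf : PosHomogeneous s f) :
    PosHomogeneous (s - 1) (fderiv ℝ f) := by
  intro r hr x
  have h : r • _root_.fderiv ℝ f (r • x) = r ^ s • _root_.fderiv ℝ f x := by
    rw [← fderiv_comp_smul, show (fun y => f (r • y)) = r ^ s • f from funext (hf r hr),
      fderiv_const_smul_field]
    rfl
  rw [Real.rpow_sub_one hr.ne', div_eq_inv_mul, mul_smul, ← h, inv_smul_smul₀ hr.ne']

lemma PosHomogeneous.eq_of_tendsto {f : E → F} {l : F} (hf : PosHomogeneous 0 f)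
    (h : Tendsto f (𝓝[≠] 0) (𝓝 l)) {x : E} (hx : x ≠ 0) : f x = l := by
  have hray : Tendsto (fun r : ℝ => r • x) (𝓝[>] 0) (𝓝[≠] 0) := by
    refine tendsto_nhdsWithin_iff.2 ⟨?_, ?_⟩
    · have hc : Continuous fun r : ℝ => r • x := by fun_prop
      simpa only [zero_smul] using (hc.tendsto 0).mono_left nhdsWithin_le_nhds
    · filter_upwards [self_mem_nhdsWithin] with r hr using smul_ne_zero (ne_of_gt hr) hx
  refine tendsto_nhds_unique (tendsto_const_nhds.congr' ?_) (h.comp hray)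
  filter_upwards [self_mem_nhdsWithin] with r hr
  exact (posHomogeneous_zero_iff.1 hf r hr x).symm

lemma PosHomogeneous.exists_norm_le [ProperSpace E] {s : ℝ} {f : E → F}
    (hf : PosHomogeneous s f) (hc : ContinuousOn f {0}ᶜ) :
    ∃ C, ∀ x, x ≠ 0 → ‖f x‖ ≤ C * ‖x‖ ^ s := by
  obtain ⟨C, hC⟩ := (isCompact_sphere (0 : E) 1).exists_bound_of_continuousOn
    (hc.mono fun x hx => ne_zero_of_mem_unit_sphere ⟨x, hx⟩)
  refine ⟨C, fun x hx => ?_⟩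
  have hpos : 0 < ‖x‖ := norm_pos_iff.2 hx
  have hunit : ‖x‖⁻¹ • x ∈ Metric.sphere (0 : E) 1 := by
    rw [mem_sphere_zero_iff_norm, norm_smul, norm_inv, norm_norm, inv_mul_cancel₀ hpos.ne']
  calc ‖f x‖ = ‖f (‖x‖ • ‖x‖⁻¹ • x)‖ := by rw [smul_inv_smul₀ hpos.ne']
    _ = ‖x‖ ^ s * ‖f (‖x‖⁻¹ • x)‖ := by
        rw [hf ‖x‖ hpos, norm_smul, Real.norm_of_nonneg (by positivity)]
    _ ≤ ‖x‖ ^ s * C := by gcongr; exact hC _ hunit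
    _ = C * ‖x‖ ^ s := mul_comm _ _

end PosHomogeneous

lemma PosHomogeneous.partialDeriv_apply {s : ℝ} {f : Plane → ℝ} (hf : PosHomogeneous s f)
    (j : Fin 2) : PosHomogeneous (s - 1) (partialDeriv j f) := fun r hr x => by
  rw [partialDeriv, hf.fderiv r hr x]
  rfl

lemma PosHomogeneous.div_norm {s : ℝ} {f : Plane → ℝ} (hf : PosHomogeneous s f) :
    PosHomogeneous (s - 1) fun x => f x / ‖x‖ := fun r hr x => by
  simp only [hf r hr, norm_smul, Real.norm_of_nonneg hr.le, Real.rpow_sub_one hr.ne', smul_eq_mul,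
    mul_div_mul_comm]

lemma continuousOn_div_norm {f : Plane → ℝ} (hf : ContinuousOn f {0}ᶜ) :
    ContinuousOn (fun x => f x / ‖x‖) {0}ᶜ :=
  hf.div continuous_norm.continuousOn fun _ hx => norm_ne_zero_iff.2 hx

lemma memLp_of_norm_le_rpow {f : Plane → ℝ} {q : ℝ≥0∞} (hq0 : q ≠ 0) (hq : q ≠ ⊤) {C s : ℝ}
    (hs : -s * q.toReal < 2) (hf : AEStronglyMeasurable f discMeasure)
    (hC : ∀ x, x ≠ 0 → ‖f x‖ ≤ C * ‖x‖ ^ s) : MemLp f q discMeasure := by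
  have hpow := memLp_norm_rpow_neg hq0 hq hs
  rw [neg_neg] at hpow
  refine (hpow.const_mul C).mono' hf ?_
  filter_upwards [ae_discMeasure_mem] with x hx using hC x hx.2

lemma PosHomogeneous.memLp {s : ℝ} {f : Plane → ℝ} (hf : PosHomogeneous s f)
    (hc : ContinuousOn f {0}ᶜ) {q : ℝ≥0∞} (hq0 : q ≠ 0) (hq : q ≠ ⊤) (hs : -s * q.toReal < 2) :
    MemLp f q discMeasure := by
  obtain ⟨C, hC⟩ := hf.exists_norm_le hc
  exact memLp_of_norm_le_rpow hq0 hq hs (aestronglyMeasurable_of_continuousOn_compl_zero hc) hC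

lemma PosHomogeneous.memLp_top {f : Plane → ℝ} (hf : PosHomogeneous 0 f)
    (hc : ContinuousOn f {0}ᶜ) : MemLp f ⊤ discMeasure := by
  obtain ⟨C, hC⟩ := hf.exists_norm_le hc
  refine MemLp.of_bound (aestronglyMeasurable_of_continuousOn_compl_zero hc) C ?_
  filter_upwards [ae_discMeasure_mem] with x hx
  simpa only [Real.rpow_zero, mul_one] using hC x hx.2

lemma PosHomogeneous.hasWeakPartial {s : ℝ} (hs : -1 < s) {f : Plane → ℝ}
    (hf : PosHomogeneous s f) (hsmooth : ContDiffOn ℝ ∞ f {0}ᶜ) (j : Fin 2) :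
    HasWeakPartial j f (partialDeriv j f) := by
  have hlt : -(s - 1) * (1 : ℝ≥0∞).toReal < 2 := by rw [ENNReal.toReal_one]; linarith
  exact hasWeakPartial_of_contDiffOn hsmooth
    (hf.div_norm.memLp (continuousOn_div_norm hsmooth.continuousOn) one_ne_zero
      ENNReal.one_ne_top hlt)
    ((hf.partialDeriv_apply j).memLp (continuousOn_partialDeriv hsmooth j) one_ne_zero
      ENNReal.one_ne_top hlt)

lemma PosHomogeneous.memW1 {s : ℝ} (hs : -1 < s) {f : Plane → ℝ} (hf : PosHomogeneous s f)
    (hsmooth : ContDiffOn ℝ ∞ f {0}ᶜ) {q : ℝ≥0∞} (hq0 : q ≠ 0) (hq : q ≠ ⊤)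
    (hsq : (1 - s) * q.toReal < 2) : MemW1 q f := by
  have hsq' : -(s - 1) * q.toReal < 2 := by rwa [neg_sub]
  exact ⟨memLp_of_memLp_div_norm hsmooth.continuousOn
      (hf.div_norm.memLp (continuousOn_div_norm hsmooth.continuousOn) hq0 hq hsq'),
    fun j => ⟨_, hf.hasWeakPartial hs hsmooth j,
      (hf.partialDeriv_apply j).memLp (continuousOn_partialDeriv hsmooth j) hq0 hq hsq'⟩⟩

lemma PosHomogeneous.memW1_of_lt_two {f : Plane → ℝ} (hf : PosHomogeneous 0 f)
    (hsmooth : ContDiffOn ℝ ∞ f {0}ᶜ) {q : ℝ≥0∞} (hq1 : 1 ≤ q) (hq : q < 2) : MemW1 q f := by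
  refine hf.memW1 neg_one_lt_zero hsmooth (zero_lt_one.trans_le hq1).ne' hq.ne_top ?_
  rw [sub_zero, one_mul]
  exact (ENNReal.toReal_lt_toReal hq.ne_top ENNReal.ofNat_ne_top).2 hq

lemma not_integrableOn_inv_Ioo : ¬ IntegrableOn (fun r : ℝ => r⁻¹) (Ioo 0 1) := fun h => by
  rw [← intervalIntegrable_iff_integrableOn_Ioo_of_le zero_le_one, intervalIntegrable_inv_iff] at h
  simp at h

-- In polar coordinates `∫ g² = ∫ r⁻¹ dr · ∫ g(e_R(θ))² dθ`, and the first factor diverges.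
lemma PosHomogeneous.eq_zero_of_memLp_two {g : Plane → ℝ} (hg : PosHomogeneous (-1) g)
    (hc : ContinuousOn g {0}ᶜ) (h : MemLp g 2 discMeasure) {x : Plane} (hx : x ≠ 0) : g x = 0 := by
  have hpolar : Integrable (fun p : ℝ × ℝ => g (eR p.2) ^ 2 * p.1⁻¹) polarMeasure := by
    refine ((integrable_disc_iff h.integrable_sq.1).1 h.integrable_sq).congr ?_
    filter_upwards [ae_polarMeasure_mem] with p hp
    have hr : 0 < p.1 := hp.1.1
    rw [hg p.1 hr, Real.rpow_neg_one, smul_eq_mul]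
    field_simp
  have hae : ∀ᵐ θ ∂volume.restrict (Ioc (-Real.pi) Real.pi), g (eR θ) = 0 := by
    rw [← restrict_Ioo_eq_restrict_Ioc]
    filter_upwards [hpolar.prod_left_ae] with θ hθ
    by_contra hne
    refine not_integrableOn_inv_Ioo
      ((hθ.const_mul (g (eR θ) ^ 2)⁻¹).congr (ae_of_all _ fun r => ?_))
    exact inv_mul_cancel_left₀ (pow_ne_zero 2 hne) _
  have hcont : Continuous fun θ => g (eR θ) := hc.comp_continuous continuous_eR fun θ => by
    rw [mem_compl_singleton_iff, ← norm_ne_zero_iff, norm_eR]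
    exact one_ne_zero
  have hcircle := Measure.eqOn_Ioc_of_ae_eq volume hae hcont.continuousOn continuousOn_const
    (Complex.arg_mem_Ioc (⟨x 0, x 1⟩ : ℂ))
  rw [← norm_smul_eR_angle x, hg _ (norm_pos_iff.2 hx)]
  exact smul_eq_zero_of_right _ hcircle

lemma PosHomogeneous.exists_eq_of_memW1_two {f : Plane → ℝ} (hf : PosHomogeneous 0 f)
    (hsmooth : ContDiffOn ℝ ∞ f {0}ᶜ) (h : MemW1 2 f) : ∃ c, ∀ x, x ≠ 0 → f x = c := by
  have hpartial (j : Fin 2) {x : Plane} (hx : x ≠ 0) : partialDeriv j f x = 0 := by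
    obtain ⟨g, hg, hg2⟩ := h.2 j
    have hhom := hf.partialDeriv_apply j
    rw [zero_sub] at hhom
    exact hhom.eq_zero_of_memLp_two (continuousOn_partialDeriv hsmooth j)
      (hg2.ae_eq (hg.ae_eq (hf.hasWeakPartial neg_one_lt_zero hsmooth j))) hx
  refine isOpen_compl_singleton.exists_is_const_of_fderiv_eq_zero (𝕜 := ℝ)
    (isConnected_compl_singleton_of_one_lt_rank ?_ 0).isPreconnected
    (hsmooth.differentiableOn (by simp)) fun x hx => ?_
  · rw [← Module.finrank_eq_rank ℝ Plane, finrank_euclideanSpace_fin]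
    exact_mod_cast one_lt_two
  · refine ContinuousLinearMap.coe_injective
      ((EuclideanSpace.basisFun (Fin 2) ℝ).toBasis.ext fun j => ?_)
    simpa [partialDeriv] using hpartial j hx

/-! ### Regularity of the coefficients and of the integrand -/

lemma angle_smul {r : ℝ} (hr : 0 < r) (x : Plane) : angle (r • x) = angle x := by
  rw [angle, angle, ← Complex.arg_real_mul ⟨x 0, x 1⟩ hr]
  congr 1
  apply Complex.ext <;> simp

lemma contDiffOn_cos_angle : ContDiffOn ℝ ∞ (fun x => cos (angle x)) {0}ᶜ := by
  have h : ContDiffOn ℝ ∞ (fun x : Plane => x 0 / ‖x‖) {0}ᶜ := fun x hx =>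
    ((by fun_prop : ContDiffAt ℝ ∞ (fun x : Plane => x 0) x).div (contDiffAt_norm ℝ hx)
      (norm_ne_zero_iff.2 hx)).contDiffWithinAt
  exact h.congr fun x hx => cos_angle hx

lemma contDiffOn_sin_angle : ContDiffOn ℝ ∞ (fun x => sin (angle x)) {0}ᶜ := by
  have h : ContDiffOn ℝ ∞ (fun x : Plane => x 1 / ‖x‖) {0}ᶜ := fun x hx =>
    ((by fun_prop : ContDiffAt ℝ ∞ (fun x : Plane => x 1) x).div (contDiffAt_norm ℝ hx)
      (norm_ne_zero_iff.2 hx)).contDiffWithinAt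
  exact h.congr fun x hx => sin_angle hx

lemma contDiffOn_eR_angle (i : Fin 2) : ContDiffOn ℝ ∞ (fun x => eR (angle x) i) {0}ᶜ := by
  fin_cases i
  · exact contDiffOn_cos_angle
  · exact contDiffOn_sin_angle

lemma contDiffOn_eTheta_angle (i : Fin 2) :
    ContDiffOn ℝ ∞ (fun x => eTheta (angle x) i) {0}ᶜ := by
  fin_cases i
  · exact contDiffOn_sin_angle.neg
  · exact contDiffOn_cos_angle

lemma posHomogeneous_coeff (a : ℝ) (i j k l : Fin 2) :
    PosHomogeneous 0 fun x => coeff a x i j k l :=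
  posHomogeneous_zero_iff.2 fun r hr x => by simp only [coeff, angle_smul hr]

lemma contDiffOn_coeff (a : ℝ) (i j k l : Fin 2) :
    ContDiffOn ℝ ∞ (fun x => coeff a x i j k l) {0}ᶜ := by
  have hR := contDiffOn_eR_angle
  have hT := contDiffOn_eTheta_angle
  exact (((contDiffOn_const.mul (((hR i).mul (hR j)).mul ((hR k).mul (hR l)))).add
    (((hR i).mul (hT j)).mul ((hR k).mul (hT l)))).add
    (contDiffOn_const.mul (((hT i).mul (hR j)).mul ((hT k).mul (hR l))))).add
    (((hT i).mul (hT j)).mul ((hT k).mul (hT l)))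

lemma coeff_smul_eR_zero_zero_zero_one (a : ℝ) {r : ℝ} (hr : 0 < r) (θ : ℝ) :
    coeff a (r • eR θ) 0 0 0 1 = (a - 1) * (cos θ * sin θ) := by
  simp only [coeff, eR_angle_smul_eR hr, eTheta_angle_smul_eR hr, Pi.add_apply, Pi.smul_apply,
    tensorMul, outer, Matrix.of_apply, eR_zero, eR_one, eTheta_zero, eTheta_one, smul_eq_mul]
  linear_combination (a - 1) * cos θ * sin θ * Real.sin_sq_add_cos_sq θ

lemma eq_one_of_coeff_eq {a c : ℝ} (h : ∀ x, x ≠ 0 → coeff a x 0 0 0 1 = c) : a = 1 := by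
  have hθ (θ : ℝ) : (a - 1) * (cos θ * sin θ) = c := by
    rw [← coeff_smul_eR_zero_zero_zero_one a one_pos, h _ (smul_eR_ne_zero one_ne_zero θ)]
  have h0 := hθ 0
  have h1 := hθ (Real.pi / 4)
  rw [Real.sin_zero, mul_zero, mul_zero] at h0
  rw [Real.cos_pi_div_four, Real.sin_pi_div_four, ← h0] at h1
  simpa [sub_eq_zero] using h1

lemma coeff_memLp_top (a : ℝ) (i j k l : Fin 2) :
    MemLp (fun x => coeff a x i j k l) ⊤ discMeasure :=
  (posHomogeneous_coeff a i j k l).memLp_top (contDiffOn_coeff a i j k l).continuousOn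

lemma coeff_not_tendsto {a : ℝ} (ha : a ≠ 1) :
    ¬ ∃ L : Tensor, Tendsto (coeff a) (𝓝[≠] 0) (𝓝 L) := by
  rintro ⟨L, hL⟩
  have hentry : Tendsto (fun x => coeff a x 0 0 0 1) (𝓝[≠] 0) (𝓝 (L 0 0 0 1)) := by
    simp only [tendsto_pi_nhds] at hL
    exact hL 0 0 0 1
  exact ha (eq_one_of_coeff_eq fun x hx => (posHomogeneous_coeff a 0 0 0 1).eq_of_tendsto hentry hx)

lemma coeff_memW1 (a : ℝ) {q : ℝ≥0∞} (hq1 : 1 ≤ q) (hq : q < 2) : TensorMemW1 q (coeff a) :=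
  fun i j k l =>
    (posHomogeneous_coeff a i j k l).memW1_of_lt_two (contDiffOn_coeff a i j k l) hq1 hq

lemma coeff_not_memW1 {a : ℝ} (ha : a ≠ 1) : ¬ TensorMemW1 2 (coeff a) := fun h => by
  obtain ⟨c, hc⟩ := (posHomogeneous_coeff a 0 0 0 1).exists_eq_of_memW1_two
    (contDiffOn_coeff a 0 0 0 1) (h 0 0 0 1)
  exact ha (eq_one_of_coeff_eq hc)

lemma posHomogeneous_integrand (ν a : ℝ) (ξ : Mat) :
    PosHomogeneous 0 fun x => integrand ν a x ξ :=
  posHomogeneous_zero_iff.2 fun r hr x => by simp only [integrand, angle_smul hr]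

lemma contDiffOn_integrand (ν a : ℝ) (ξ : Mat) :
    ContDiffOn ℝ ∞ (fun x => integrand ν a x ξ) {0}ᶜ := by
  have hc := contDiffOn_cos_angle
  have hs := contDiffOn_sin_angle
  simp only [integrand_eq_polarForm, polarForm]
  have hR (i : Fin 2) : ContDiffOn ℝ ∞ (fun x => radPart ξ (angle x) i) {0}ᶜ :=
    (contDiffOn_const.mul hc).add (contDiffOn_const.mul hs)
  have hT (i : Fin 2) : ContDiffOn ℝ ∞ (fun x => tanPart ξ (angle x) i) {0}ᶜ :=
    (contDiffOn_const.mul hs).neg.add (contDiffOn_const.mul hc)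
  exact contDiffOn_const.mul (ContDiffOn.sum fun i _ =>
    ((contDiffOn_const.mul (hR i)).mul (hR i)).add ((hT i).mul (hT i)))

lemma isConformalMat_of_polarForm_eq {a c : ℝ} (ha : a ≠ 1) {ξ : Mat}
    (h : ∀ θ, polarForm a θ ξ ξ = c) : IsConformalMat ξ := by
  have ha' : a - 1 ≠ 0 := sub_ne_zero.2 ha
  have h0 := h 0
  have h1 := h (Real.pi / 2)
  have h2 := h (Real.pi / 4)
  have hsqrt : √2 * √2 = 2 := Real.mul_self_sqrt zero_le_two
  simp only [polarForm, radPart, tanPart, Fin.sum_univ_two, Real.cos_zero, Real.sin_zero,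
    Real.cos_pi_div_two, Real.sin_pi_div_two, Real.cos_pi_div_four, Real.sin_pi_div_four]
    at h0 h1 h2
  have hnorm : ξ 0 0 ^ 2 + ξ 1 0 ^ 2 = ξ 0 1 ^ 2 + ξ 1 1 ^ 2 :=
    mul_left_cancel₀ ha' (by linear_combination h0 - h1)
  have horth : ξ 0 0 * ξ 0 1 + ξ 1 0 * ξ 1 1 = 0 := by
    refine (mul_eq_zero.1 ?_).resolve_left ha'
    linear_combination h2 - (h0 + h1) / 2 - (a * ((ξ 0 0 + ξ 0 1) ^ 2 + (ξ 1 0 + ξ 1 1) ^ 2) +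
      ((ξ 0 1 - ξ 0 0) ^ 2 + (ξ 1 1 - ξ 1 0) ^ 2)) / 4 * hsqrt
  refine ⟨ξ 0 0 ^ 2 + ξ 1 0 ^ 2, ?_⟩
  ext i j
  fin_cases i <;> fin_cases j <;> simp [Matrix.mul_apply, Fin.sum_univ_two] <;> linarith

lemma isConformalMat_of_integrand_eq {ν a c : ℝ} (hν : ν ≠ 0) (ha : a ≠ 1) {ξ : Mat}
    (h : ∀ x, x ≠ 0 → integrand ν a x ξ = c) : IsConformalMat ξ := by
  refine isConformalMat_of_polarForm_eq ha (c := c / ν) fun θ => ?_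
  rw [eq_div_iff hν, mul_comm, ← h _ (smul_eR_ne_zero one_ne_zero θ), integrand_eq_polarForm]
  simp only [polarForm, radPart, tanPart, cos_angle_smul_eR one_pos, sin_angle_smul_eR one_pos]

lemma integrand_not_tendsto {ν a : ℝ} (hν : ν ≠ 0) (ha : a ≠ 1) {ξ : Mat}
    (hξ : ¬ IsConformalMat ξ) :
    ¬ ∃ l : ℝ, Tendsto (fun x => integrand ν a x ξ) (𝓝[≠] 0) (𝓝 l) := fun ⟨_, hl⟩ =>
  hξ (isConformalMat_of_integrand_eq hν ha fun _ hx =>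
    (posHomogeneous_integrand ν a ξ).eq_of_tendsto hl hx)

lemma integrand_memW1 (ν a : ℝ) (ξ : Mat) {q : ℝ≥0∞} (hq1 : 1 ≤ q) (hq : q < 2) :
    MemW1 q fun x => integrand ν a x ξ :=
  (posHomogeneous_integrand ν a ξ).memW1_of_lt_two (contDiffOn_integrand ν a ξ) hq1 hq

lemma integrand_not_memW1 {ν a : ℝ} (hν : ν ≠ 0) (ha : a ≠ 1) {ξ : Mat}
    (hξ : ¬ IsConformalMat ξ) : ¬ MemW1 2 fun x => integrand ν a x ξ := fun h => by
  obtain ⟨c, hc⟩ := (posHomogeneous_integrand ν a ξ).exists_eq_of_memW1_two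
    (contDiffOn_integrand ν a ξ) h
  exact hξ (isConformalMat_of_integrand_eq hν ha hc)

/-! ### Wirtinger's inequality -/

lemma memLp_restrict_Ioc_of_continuous {E : Type*} [NormedAddCommGroup E] {F : ℝ → E}
    (hF : Continuous F) (a b : ℝ) (q : ℝ≥0∞) : MemLp F q (volume.restrict (Ioc a b)) := by
  obtain ⟨C, hC⟩ := isCompact_Icc.exists_bound_of_continuousOn (hF.continuousOn (s := Icc a b))
  refine MemLp.of_bound hF.aestronglyMeasurable C ?_
  filter_upwards [ae_restrict_mem measurableSet_Ioc] with x hx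
  exact hC x (Ioc_subset_Icc_self hx)

lemma norm_fourierCoeffOn_le {a b : ℝ} (hab : a < b) {f f' : ℝ → ℂ}
    (hf : ∀ x ∈ uIcc a b, HasDerivAt f (f' x) x) (hf' : IntervalIntegrable f' volume a b)
    (hper : f a = f b) {n : ℤ} (hn : n ≠ 0) :
    ‖fourierCoeffOn hab f n‖ ≤ (b - a) / (2 * Real.pi) * ‖fourierCoeffOn hab f' n‖ := by
  have hn1 : (1 : ℝ) ≤ |(n : ℝ)| := by
    rw [← Int.cast_abs]
    exact_mod_cast Int.one_le_abs hn
  have hlen : ‖(b : ℂ) - a‖ = b - a := by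
    rw [← Complex.ofReal_sub, Complex.norm_real, Real.norm_of_nonneg (sub_nonneg.2 hab.le)]
  have hfactor : ‖(1 : ℂ) / (-2 * Real.pi * Complex.I * n)‖ = 1 / (2 * Real.pi * |(n : ℝ)|) := by
    simp [abs_of_pos pi_pos]
  rw [fourierCoeffOn_of_hasDerivAt hab hn hf hf', hper, sub_self, mul_zero, zero_sub, norm_mul,
    norm_neg, norm_mul, hlen, hfactor, ← mul_assoc, one_div_mul_eq_div]
  refine mul_le_mul_of_nonneg_right ?_ (norm_nonneg _)
  exact div_le_div_of_nonneg_left (sub_pos.2 hab).le (by positivity)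
    (le_mul_of_one_le_right (by positivity) hn1)

theorem wirtinger_inequality {a b : ℝ} (hab : a < b) {f f' : ℝ → ℝ}
    (hf : ∀ x, HasDerivAt f (f' x) x) (hf' : Continuous f') (hper : f a = f b)
    (hmean : ∫ x in a..b, f x = 0) :
    ∫ x in a..b, f x ^ 2 ≤ ((b - a) / (2 * Real.pi)) ^ 2 * ∫ x in a..b, f' x ^ 2 := by
  have hfc : Continuous f := continuous_iff_continuousAt.2 fun x => (hf x).continuousAt
  have hcoeff (n : ℤ) : ‖fourierCoeffOn hab (fun x => (f x : ℂ)) n‖ ^ 2 ≤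
      ((b - a) / (2 * Real.pi)) ^ 2 * ‖fourierCoeffOn hab (fun x => (f' x : ℂ)) n‖ ^ 2 := by
    rcases eq_or_ne n 0 with rfl | hn
    · have hzero : fourierCoeffOn hab (fun x => (f x : ℂ)) 0 = 0 := by
        simp [fourierCoeffOn_eq_integral, intervalIntegral.integral_ofReal, hmean]
      rw [hzero, norm_zero, zero_pow two_ne_zero]
      positivity
    · rw [← mul_pow]
      gcongr
      exact norm_fourierCoeffOn_le hab (fun x _ => (hf x).ofReal_comp)
        ((Complex.continuous_ofReal.comp hf').intervalIntegrable _ _) (by rw [hper]) hn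
  have hmemLp {g : ℝ → ℝ} (hg : Continuous g) :
      MemLp (fun x => (g x : ℂ)) 2 (volume.restrict (Ioc a b)) :=
    memLp_restrict_Ioc_of_continuous (by fun_prop) a b 2
  have hcoeff_sq := hasSum_le hcoeff (hasSum_sq_fourierCoeffOn hab (hmemLp hfc))
    ((hasSum_sq_fourierCoeffOn hab (hmemLp hf')).mul_left _)
  simp only [Complex.norm_real, Real.norm_eq_abs, sq_abs, smul_eq_mul] at hcoeff_sq
  rw [mul_left_comm] at hcoeff_sq
  exact le_of_mul_le_mul_left hcoeff_sq (inv_pos.2 (sub_pos.2 hab))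

lemma neg_pi_lt_pi : -Real.pi < Real.pi := neg_lt_self pi_pos

lemma abs_two_mul_integral_mul_le {a b : ℝ} (hab : a ≤ b) {f g : ℝ → ℝ} (hf : Continuous f)
    (hg : Continuous g) :
    |2 * ∫ x in a..b, f x * g x| ≤ (∫ x in a..b, f x ^ 2) + ∫ x in a..b, g x ^ 2 := by
  have hint {h : ℝ → ℝ} (hh : Continuous h) : IntervalIntegrable h volume a b :=
    hh.intervalIntegrable _ _
  rw [← intervalIntegral.integral_const_mul,
    ← intervalIntegral.integral_add (hint (by fun_prop)) (hint (by fun_prop))]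
  refine (intervalIntegral.abs_integral_le_integral_abs hab).trans
    (intervalIntegral.integral_mono_on hab (hint (by fun_prop)) (hint (by fun_prop)) fun x _ => ?_)
  rw [← mul_assoc, abs_mul, abs_mul, abs_two, ← sq_abs (f x), ← sq_abs (g x)]
  exact two_mul_le_add_sq _ _

lemma abs_two_mul_integral_mul_deriv_le {f f' g g' : ℝ → ℝ} (hf : ∀ θ, HasDerivAt f (f' θ) θ)
    (hf' : Continuous f') (hg : ∀ θ, HasDerivAt g (g' θ) θ) (hg' : Continuous g')
    (hfper : f (-Real.pi) = f Real.pi) (hgper : g (-Real.pi) = g Real.pi) :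
    |2 * ∫ θ in -Real.pi..Real.pi, f θ * g' θ| ≤
      ∫ θ in -Real.pi..Real.pi, (f' θ ^ 2 + g' θ ^ 2) := by
  have hfc : Continuous f := continuous_iff_continuousAt.2 fun θ => (hf θ).continuousAt
  have hint {h : ℝ → ℝ} (hh : Continuous h) :
      IntervalIntegrable h volume (-Real.pi) Real.pi := hh.intervalIntegrable _ _
  obtain ⟨m, hm⟩ : ∃ m, ∫ θ in -Real.pi..Real.pi, (f θ - m) = 0 := by
    refine ⟨(2 * Real.pi)⁻¹ * ∫ θ in -Real.pi..Real.pi, f θ, ?_⟩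
    rw [intervalIntegral.integral_sub (hint hfc) (hint continuous_const),
      intervalIntegral.integral_const, smul_eq_mul]
    field_simp
    ring
  have hwirtinger : ∫ θ in -Real.pi..Real.pi, (f θ - m) ^ 2 ≤
      ∫ θ in -Real.pi..Real.pi, f' θ ^ 2 := by
    have h := wirtinger_inequality neg_pi_lt_pi (fun θ => (hf θ).sub_const m) hf'
      (by rw [hfper]) hm
    rwa [sub_neg_eq_add, ← two_mul, div_self (by positivity), one_pow, one_mul] at h
  have hmean : ∫ θ in -Real.pi..Real.pi, g' θ = 0 := by
    rw [intervalIntegral.integral_eq_sub_of_hasDerivAt (fun x _ => hg x) (hint hg'), hgper,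
      sub_self]
  have hcenter : ∫ θ in -Real.pi..Real.pi, (f θ - m) * g' θ =
      ∫ θ in -Real.pi..Real.pi, f θ * g' θ := by
    simp only [sub_mul]
    rw [intervalIntegral.integral_sub (hint (by fun_prop)) (hint (by fun_prop)),
      intervalIntegral.integral_const_mul, hmean, mul_zero, sub_zero]
  calc |2 * ∫ θ in -Real.pi..Real.pi, f θ * g' θ|
      = |2 * ∫ θ in -Real.pi..Real.pi, (f θ - m) * g' θ| := by rw [hcenter]
    _ ≤ (∫ θ in -Real.pi..Real.pi, (f θ - m) ^ 2) + ∫ θ in -Real.pi..Real.pi, g' θ ^ 2 :=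
        abs_two_mul_integral_mul_le neg_pi_lt_pi.le (by fun_prop) hg'
    _ ≤ (∫ θ in -Real.pi..Real.pi, f' θ ^ 2) + ∫ θ in -Real.pi..Real.pi, g' θ ^ 2 := by gcongr
    _ = ∫ θ in -Real.pi..Real.pi, (f' θ ^ 2 + g' θ ^ 2) :=
        (intervalIntegral.integral_add (hint (by fun_prop)) (hint (by fun_prop))).symm

/-! ### Integration by parts in polar coordinates -/

/-- The radial derivative of a scalar function. -/
def radDeriv (f : Plane → ℝ) (x : Plane) : ℝ := fderiv ℝ f x (eR (angle x))

/-- The derivative of a scalar function with respect to arc length along the circles around the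
origin. -/
def angDeriv (f : Plane → ℝ) (x : Plane) : ℝ := fderiv ℝ f x (eTheta (angle x))

lemma radDeriv_smul_eR (f : Plane → ℝ) {r : ℝ} (hr : 0 < r) (θ : ℝ) :
    radDeriv f (r • eR θ) = fderiv ℝ f (r • eR θ) (eR θ) := by
  rw [radDeriv, eR_angle_smul_eR hr]

lemma angDeriv_smul_eR (f : Plane → ℝ) {r : ℝ} (hr : 0 < r) (θ : ℝ) :
    angDeriv f (r • eR θ) = fderiv ℝ f (r • eR θ) (eTheta θ) := by
  rw [angDeriv, eTheta_angle_smul_eR hr]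

lemma measurable_cos_angle : Measurable fun x => cos (angle x) :=
  Real.measurable_cos.comp measurable_angle

lemma measurable_sin_angle : Measurable fun x => sin (angle x) :=
  Real.measurable_sin.comp measurable_angle

lemma measurable_radDeriv (f : Plane → ℝ) : Measurable (radDeriv f) := by
  unfold radDeriv
  simp only [fderiv_eR]
  exact ((measurable_fderiv_apply_const ℝ f _).mul measurable_cos_angle).add
    ((measurable_fderiv_apply_const ℝ f _).mul measurable_sin_angle)

lemma measurable_angDeriv (f : Plane → ℝ) : Measurable (angDeriv f) := by
  unfold angDeriv
  simp only [fderiv_eTheta]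
  exact ((measurable_fderiv_apply_const ℝ f _).mul measurable_sin_angle).neg.add
    ((measurable_fderiv_apply_const ℝ f _).mul measurable_cos_angle)

lemma continuous_fderiv_smul_eR_eR {f : Plane → ℝ} (hf : ContDiff ℝ ∞ f) :
    Continuous fun p : ℝ × ℝ => fderiv ℝ f (p.1 • eR p.2) (eR p.2) :=
  ((hf.continuous_fderiv (by simp)).comp continuous_smul_eR).clm_apply
    (continuous_eR.comp continuous_snd)

lemma continuous_fderiv_smul_eR_eTheta {f : Plane → ℝ} (hf : ContDiff ℝ ∞ f) :
    Continuous fun p : ℝ × ℝ => fderiv ℝ f (p.1 • eR p.2) (eTheta p.2) :=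
  ((hf.continuous_fderiv (by simp)).comp continuous_smul_eR).clm_apply
    (continuous_eTheta.comp continuous_snd)

lemma integral_disc_eq_integral_polarMeasure {f : Plane → ℝ} {F : ℝ × ℝ → ℝ}
    (hf : AEStronglyMeasurable f discMeasure)
    (hF : ∀ r ∈ Ioo (0 : ℝ) 1, ∀ θ, r * f (r • eR θ) = F (r, θ)) :
    ∫ x, f x ∂discMeasure = ∫ p, F p ∂polarMeasure := by
  rw [integral_disc hf]
  refine integral_congr_ae ?_
  filter_upwards [ae_polarMeasure_mem] with p hp using hF p.1 hp.1 p.2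

lemma integral_polarMeasure_of_hasDerivAt_radial {F F' : ℝ × ℝ → ℝ} (hF : Continuous F)
    (hF' : Integrable F' polarMeasure)
    (hderiv : ∀ θ, ∀ r ∈ Ioo (0 : ℝ) 1, HasDerivAt (fun s => F (s, θ)) (F' (r, θ)) r) :
    ∫ p, F' p ∂polarMeasure = ∫ θ in -Real.pi..Real.pi, (F (1, θ) - F (0, θ)) := by
  rw [integral_polarMeasure_symm hF', intervalIntegral.integral_of_le neg_pi_lt_pi.le,
    intervalIntegral.integral_of_le neg_pi_lt_pi.le, integral_Ioc_eq_integral_Ioo,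
    integral_Ioc_eq_integral_Ioo]
  refine integral_congr_ae ?_
  filter_upwards [hF'.prod_left_ae] with θ hθ
  exact intervalIntegral.integral_eq_sub_of_hasDerivAt_of_le zero_le_one
    (by fun_prop) (hderiv θ) ((intervalIntegrable_iff_integrableOn_Ioo_of_le zero_le_one).2 hθ)

lemma integral_polarMeasure_of_hasDerivAt_angular {F F' : ℝ × ℝ → ℝ}
    (hF' : Integrable F' polarMeasure)
    (hderiv : ∀ r θ, HasDerivAt (fun t => F (r, t)) (F' (r, θ)) θ)
    (hper : ∀ r, F (r, -Real.pi) = F (r, Real.pi)) : ∫ p, F' p ∂polarMeasure = 0 := by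
  rw [integral_polarMeasure hF', intervalIntegral.integral_of_le zero_le_one,
    integral_Ioc_eq_integral_Ioo]
  refine integral_eq_zero_of_ae ?_
  filter_upwards [hF'.prod_right_ae] with r hr
  rw [intervalIntegral.integral_eq_sub_of_hasDerivAt (fun θ _ => hderiv r θ)
    ((intervalIntegrable_iff_integrableOn_Ioo_of_le neg_pi_lt_pi.le).2 hr), hper, sub_self]
  rfl

lemma integrableOn_add_log (A B : ℝ) : IntegrableOn (fun r => A + B * Real.log r) (Ioo 0 1) :=
  (integrableOn_const (by simp)).add
    (((intervalIntegrable_iff_integrableOn_Ioo_of_le zero_le_one).1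
      intervalIntegral.intervalIntegrable_log').const_mul B)

lemma eTheta_nat_mul_angle_smul_eR (N : ℕ) {r : ℝ} (hr : 0 < r) (θ : ℝ) :
    eTheta (N * angle (r • eR θ)) = eTheta (N * θ) :=
  eTheta_nat_mul_congr N (eR_angle_smul_eR hr θ)

lemma hasDerivAt_eR_nat_mul (N : ℕ) (i : Fin 2) (θ : ℝ) :
    HasDerivAt (fun t : ℝ => eR (N * t) i) (N * eTheta (N * θ) i) θ := by
  have h := (hasDerivAt_eR (N * θ)).scomp θ ((hasDerivAt_id' θ).const_mul (N : ℝ))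
  refine ((EuclideanSpace.proj (𝕜 := ℝ) i).hasFDerivAt.comp_hasDerivAt θ h).congr_deriv ?_
  simp

lemma hasDerivAt_eTheta_nat_mul (N : ℕ) (i : Fin 2) (θ : ℝ) :
    HasDerivAt (fun t : ℝ => eTheta (N * t) i) (-(N * eR (N * θ) i)) θ := by
  have h := (hasDerivAt_eTheta (N * θ)).scomp θ ((hasDerivAt_id' θ).const_mul (N : ℝ))
  refine ((EuclideanSpace.proj (𝕜 := ℝ) i).hasFDerivAt.comp_hasDerivAt θ h).congr_deriv ?_
  simp

lemma measurable_eR_nat_mul_angle (N : ℕ) (i : Fin 2) :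
    Measurable fun x => eR (N * angle x) i :=
  (by fun_prop : Continuous fun t => eR (N * t) i).measurable.comp measurable_angle

lemma measurable_eTheta_nat_mul_angle (N : ℕ) (i : Fin 2) :
    Measurable fun x => eTheta (N * angle x) i :=
  (by fun_prop : Continuous fun t => eTheta (N * t) i).measurable.comp measurable_angle

section EulerLagrange

variable (a : ℝ) {N : ℕ} (i : Fin 2) {f : Plane → ℝ}

lemma integral_radial_part (N : ℕ) (hf : ContDiff ℝ ∞ f) :
    ∫ p, ((a + ((N : ℝ) ^ 2 - a) * Real.log p.1) *
          (p.1 * (eR (N * p.2) i * fderiv ℝ f (p.1 • eR p.2) (eR p.2))) +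
        ((N : ℝ) ^ 2 + ((N : ℝ) ^ 2 - a) * Real.log p.1) *
          (eR (N * p.2) i * f (p.1 • eR p.2))) ∂polarMeasure =
      a * ∫ θ in -Real.pi..Real.pi, eR (N * θ) i * f (eR θ) := by
  have hfc := hf.continuous
  have hfr := continuous_fderiv_smul_eR_eR hf
  rw [integral_polarMeasure_of_hasDerivAt_radial
    (F := fun p => (a * p.1 + ((N : ℝ) ^ 2 - a) * (p.1 * Real.log p.1)) *
      (eR (N * p.2) i * f (p.1 • eR p.2))) ?_ ?_ ?_]
  · simp [intervalIntegral.integral_const_mul]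
  · exact ((continuous_fst.const_mul a).add ((Real.continuous_mul_log.comp
      continuous_fst).const_mul _)).mul (by fun_prop)
  · exact (integrable_radial_mul_continuous (integrableOn_add_log _ _) (by fun_prop)).add
      (integrable_radial_mul_continuous (integrableOn_add_log _ _) (by fun_prop))
  · intro θ r hr
    have hweight := ((hasDerivAt_id' r).const_mul a).add
      ((Real.hasDerivAt_mul_log hr.1.ne').const_mul ((N : ℝ) ^ 2 - a))
    have hfr := hasDerivAt_comp_smul_eR_left (hf.differentiable (by simp) (r • eR θ))
    refine (hweight.mul (hfr.const_mul (eR (N * θ) i))).congr_deriv ?_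
    simp only [Pi.add_apply]
    ring

lemma integral_angular_part (hN : N ≠ 0) (hf : ContDiff ℝ ∞ f) :
    ∫ p, ((N + ((N : ℝ) ^ 2 - a) / N * Real.log p.1) *
          (p.1 * (eTheta (N * p.2) i * fderiv ℝ f (p.1 • eR p.2) (eTheta p.2))) -
        ((N : ℝ) ^ 2 + ((N : ℝ) ^ 2 - a) * Real.log p.1) *
          (eR (N * p.2) i * f (p.1 • eR p.2))) ∂polarMeasure = 0 := by
  have hfc := hf.continuous
  have hft := continuous_fderiv_smul_eR_eTheta hf
  refine integral_polarMeasure_of_hasDerivAt_angular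
    (F := fun p => (N + ((N : ℝ) ^ 2 - a) / N * Real.log p.1) *
      (eTheta (N * p.2) i * f (p.1 • eR p.2))) ?_ (fun r θ => ?_) fun r => ?_
  · exact (integrable_radial_mul_continuous (integrableOn_add_log _ _) (by fun_prop)).sub
      (integrable_radial_mul_continuous (integrableOn_add_log _ _) (by fun_prop))
  · have hf' := hasDerivAt_comp_smul_eR_right (hf.differentiable (by simp) (r • eR θ))
    have hN' : (N : ℝ) ≠ 0 := Nat.cast_ne_zero.2 hN
    have h := ((hasDerivAt_eTheta_nat_mul N i θ).mul hf').const_mul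
      (N + ((N : ℝ) ^ 2 - a) / N * Real.log r)
    refine HasDerivAt.congr_deriv h ?_
    simp only [smul_eq_mul]
    field_simp
    ring
  · simp only [eR_neg_pi, eTheta_nat_mul_congr N eR_neg_pi]

theorem integral_radDeriv_add_angDeriv (hN : N ≠ 0) (hf : ContDiff ℝ ∞ f) :
    ∫ x, ((a + ((N : ℝ) ^ 2 - a) * Real.log ‖x‖) * eR (N * angle x) i * radDeriv f x +
        (N + ((N : ℝ) ^ 2 - a) / N * Real.log ‖x‖) * eTheta (N * angle x) i * angDeriv f x)
        ∂discMeasure =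
      a * ∫ θ in -Real.pi..Real.pi, eR (N * θ) i * f (eR θ) := by
  have hfc := hf.continuous
  have hfr := continuous_fderiv_smul_eR_eR hf
  have hft := continuous_fderiv_smul_eR_eTheta hf
  rw [← integral_radial_part a i N hf, ← add_zero (∫ p, _ ∂polarMeasure),
    ← integral_angular_part a i hN hf, ← integral_add]
  · refine integral_disc_eq_integral_polarMeasure (Measurable.aestronglyMeasurable ?_) ?_
    · have hlog : Measurable fun x : Plane => Real.log ‖x‖ :=
        Real.measurable_log.comp measurable_norm
      exact (((hlog.const_mul _).const_add _).mul (measurable_eR_nat_mul_angle N i)).mul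
        (measurable_radDeriv f) |>.add <| (((hlog.const_mul _).const_add _).mul
          (measurable_eTheta_nat_mul_angle N i)).mul (measurable_angDeriv f)
    · intro r hr θ
      rw [norm_smul_eR hr.1.le, radDeriv_smul_eR f hr.1, angDeriv_smul_eR f hr.1,
        eR_nat_mul_congr N (eR_angle_smul_eR hr.1 θ), eTheta_nat_mul_angle_smul_eR N hr.1]
      ring
  · exact (integrable_radial_mul_continuous (integrableOn_add_log _ _) (by fun_prop)).add
      (integrable_radial_mul_continuous (integrableOn_add_log _ _) (by fun_prop))
  · exact (integrable_radial_mul_continuous (integrableOn_add_log _ _) (by fun_prop)).sub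
      (integrable_radial_mul_continuous (integrableOn_add_log _ _) (by fun_prop))

end EulerLagrange

section Jacobian

variable {f g : Plane → ℝ}

lemma hasDerivAt_mul_fderiv_eTheta (hg : ContDiff ℝ ∞ g) (r θ : ℝ) :
    HasDerivAt (fun s : ℝ => s * fderiv ℝ g (s • eR θ) (eTheta θ))
      (fderiv ℝ g (r • eR θ) (eTheta θ) +
        r * fderiv ℝ (fderiv ℝ g) (r • eR θ) (eR θ) (eTheta θ)) r := by
  have hg' : Differentiable ℝ (fderiv ℝ g) :=
    (hg.fderiv_right (m := ∞) (by simp)).differentiable (by simp)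
  have h := (hasDerivAt_comp_smul_eR_left (hg' (r • eR θ))).clm_apply
    (hasDerivAt_const r (eTheta θ))
  refine ((hasDerivAt_id' r).mul h).congr_deriv ?_
  rw [map_zero, add_zero, one_mul]

lemma hasDerivAt_fderiv_eR_angular (hg : ContDiff ℝ ∞ g) (r θ : ℝ) :
    HasDerivAt (fun t : ℝ => fderiv ℝ g (r • eR t) (eR t))
      (fderiv ℝ g (r • eR θ) (eTheta θ) +
        r * fderiv ℝ (fderiv ℝ g) (r • eR θ) (eR θ) (eTheta θ)) θ := by
  have hg' : Differentiable ℝ (fderiv ℝ g) :=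
    (hg.fderiv_right (m := ∞) (by simp)).differentiable (by simp)
  have hsymm := ((contDiff_infty.1 hg 2).contDiffAt (x := r • eR θ)).isSymmSndFDerivAt (by simp)
  refine ((hasDerivAt_comp_smul_eR_right (hg' (r • eR θ))).clm_apply
    (hasDerivAt_eR θ)).congr_deriv ?_
  rw [smul_apply, smul_eq_mul, hsymm.eq (eTheta θ), add_comm]

lemma continuous_mixed_deriv (hg : ContDiff ℝ ∞ g) :
    Continuous fun p : ℝ × ℝ => fderiv ℝ g (p.1 • eR p.2) (eTheta p.2) +
      p.1 * fderiv ℝ (fderiv ℝ g) (p.1 • eR p.2) (eR p.2) (eTheta p.2) := by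
  have hg' : ContDiff ℝ ∞ (fderiv ℝ g) := hg.fderiv_right (by simp)
  have h := (((hg'.continuous_fderiv (by simp)).comp continuous_smul_eR).clm_apply
      (continuous_eR.comp continuous_snd)).clm_apply (continuous_eTheta.comp continuous_snd)
  exact (continuous_fderiv_smul_eR_eTheta hg).add (continuous_fst.mul h)

variable {L L' : ℝ → ℝ}

lemma integral_radial_deriv_eq_zero (hL : ∀ r, HasDerivAt L (L' r) r) (hL' : Continuous L')
    (hL1 : L 1 = 0) (hf : ContDiff ℝ ∞ f) (hg : ContDiff ℝ ∞ g) :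
    ∫ p, (L' p.1 * (f (p.1 • eR p.2) * (p.1 * fderiv ℝ g (p.1 • eR p.2) (eTheta p.2))) +
        L p.1 * (fderiv ℝ f (p.1 • eR p.2) (eR p.2) *
            (p.1 * fderiv ℝ g (p.1 • eR p.2) (eTheta p.2)) +
          f (p.1 • eR p.2) * (fderiv ℝ g (p.1 • eR p.2) (eTheta p.2) +
            p.1 * fderiv ℝ (fderiv ℝ g) (p.1 • eR p.2) (eR p.2) (eTheta p.2)))) ∂polarMeasure =
      0 := by
  have hLc : Continuous L := continuous_iff_continuousAt.2 fun r => (hL r).continuousAt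
  have hfc := hf.continuous
  have hfr := continuous_fderiv_smul_eR_eR hf
  have hgt := continuous_fderiv_smul_eR_eTheta hg
  have hgrt := continuous_mixed_deriv hg
  rw [integral_polarMeasure_of_hasDerivAt_radial
    (F := fun p => L p.1 * (f (p.1 • eR p.2) *
      (p.1 * fderiv ℝ g (p.1 • eR p.2) (eTheta p.2))))
    (by fun_prop) (integrable_polarMeasure_of_continuous (by fun_prop)) fun θ r _ => (hL r).mul
      ((hasDerivAt_comp_smul_eR_left (hf.differentiable (by simp) (r • eR θ))).mul
        (hasDerivAt_mul_fderiv_eTheta hg r θ))]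
  simp [hL1]

lemma integral_angular_deriv_eq_zero (hL : Continuous L) (hf : ContDiff ℝ ∞ f)
    (hg : ContDiff ℝ ∞ g) :
    ∫ p, L p.1 * (p.1 * fderiv ℝ f (p.1 • eR p.2) (eTheta p.2) *
          fderiv ℝ g (p.1 • eR p.2) (eR p.2) +
        f (p.1 • eR p.2) * (fderiv ℝ g (p.1 • eR p.2) (eTheta p.2) +
          p.1 * fderiv ℝ (fderiv ℝ g) (p.1 • eR p.2) (eR p.2) (eTheta p.2))) ∂polarMeasure =
      0 := by
  have hfc := hf.continuous
  have hft := continuous_fderiv_smul_eR_eTheta hf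
  have hgr := continuous_fderiv_smul_eR_eR hg
  have hgrt := continuous_mixed_deriv hg
  exact integral_polarMeasure_of_hasDerivAt_angular
    (F := fun p => L p.1 * (f (p.1 • eR p.2) * fderiv ℝ g (p.1 • eR p.2) (eR p.2)))
    (integrable_polarMeasure_of_continuous (by fun_prop)) (fun r θ =>
      ((hasDerivAt_comp_smul_eR_right (hf.differentiable (by simp) (r • eR θ))).mul
        (hasDerivAt_fderiv_eR_angular hg r θ)).const_mul (L r))
    fun r => by simp only [eR_neg_pi]

lemma integral_mul_jacobian (hL : ∀ r, HasDerivAt L (L' r) r) (hL' : Continuous L')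
    (hL1 : L 1 = 0) (hf : ContDiff ℝ ∞ f) (hg : ContDiff ℝ ∞ g) :
    ∫ x, L ‖x‖ * (radDeriv f x * angDeriv g x - angDeriv f x * radDeriv g x) ∂discMeasure =
      -∫ p, L' p.1 * (f (p.1 • eR p.2) * (p.1 * fderiv ℝ g (p.1 • eR p.2) (eTheta p.2)))
        ∂polarMeasure := by
  have hLc : Continuous L := continuous_iff_continuousAt.2 fun r => (hL r).continuousAt
  have hfc := hf.continuous
  have hfr := continuous_fderiv_smul_eR_eR hf
  have hft := continuous_fderiv_smul_eR_eTheta hf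
  have hgr := continuous_fderiv_smul_eR_eR hg
  have hgt := continuous_fderiv_smul_eR_eTheta hg
  have hgrt := continuous_mixed_deriv hg
  have hmeas : AEStronglyMeasurable (fun x => L ‖x‖ *
      (radDeriv f x * angDeriv g x - angDeriv f x * radDeriv g x)) discMeasure :=
    ((hLc.comp continuous_norm).measurable.mul
      (((measurable_radDeriv f).mul (measurable_angDeriv g)).sub
        ((measurable_angDeriv f).mul (measurable_radDeriv g)))).aestronglyMeasurable
  rw [← zero_sub, ← sub_zero (0 : ℝ)]
  nth_rw 1 [← integral_radial_deriv_eq_zero hL hL' hL1 hf hg]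
  rw [← integral_angular_deriv_eq_zero hLc hf hg, ← integral_sub, ← integral_sub]
  · refine integral_disc_eq_integral_polarMeasure hmeas fun r hr θ => ?_
    rw [norm_smul_eR hr.1.le, radDeriv_smul_eR f hr.1, radDeriv_smul_eR g hr.1,
      angDeriv_smul_eR f hr.1, angDeriv_smul_eR g hr.1]
    ring
  all_goals exact integrable_polarMeasure_of_continuous (by fun_prop)

lemma abs_two_mul_integral_mul_angular_le (hL' : Continuous L')
    (hL0 : ∀ r ∈ Ioo (0 : ℝ) 1, 0 ≤ L' r) (hf : ContDiff ℝ ∞ f) (hg : ContDiff ℝ ∞ g) :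
    |2 * ∫ p, L' p.1 * (f (p.1 • eR p.2) * (p.1 * fderiv ℝ g (p.1 • eR p.2) (eTheta p.2)))
        ∂polarMeasure| ≤
      ∫ p, L' p.1 * ((p.1 * fderiv ℝ f (p.1 • eR p.2) (eTheta p.2)) ^ 2 +
        (p.1 * fderiv ℝ g (p.1 • eR p.2) (eTheta p.2)) ^ 2) ∂polarMeasure := by
  have hfc := hf.continuous
  have hft := continuous_fderiv_smul_eR_eTheta hf
  have hgt := continuous_fderiv_smul_eR_eTheta hg
  have hint {F : ℝ × ℝ → ℝ} (hF : Continuous F) :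
      IntervalIntegrable (fun r => ∫ θ in -Real.pi..Real.pi, F (r, θ)) volume 0 1 :=
    (intervalIntegral.continuous_parametric_intervalIntegral_of_continuous'
      (f := fun r θ => F (r, θ)) hF _ _).intervalIntegrable _ _
  have hleft : Continuous fun p : ℝ × ℝ =>
      L' p.1 * (f (p.1 • eR p.2) * (p.1 * fderiv ℝ g (p.1 • eR p.2) (eTheta p.2))) := by
    fun_prop
  have hright : Continuous fun p : ℝ × ℝ =>
      L' p.1 * ((p.1 * fderiv ℝ f (p.1 • eR p.2) (eTheta p.2)) ^ 2 +
        (p.1 * fderiv ℝ g (p.1 • eR p.2) (eTheta p.2)) ^ 2) := by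
    fun_prop
  rw [integral_polarMeasure (integrable_polarMeasure_of_continuous hleft),
    integral_polarMeasure (integrable_polarMeasure_of_continuous hright),
    ← intervalIntegral.integral_const_mul]
  refine (intervalIntegral.abs_integral_le_integral_abs zero_le_one).trans
    (intervalIntegral.integral_mono_on_of_le_Ioo zero_le_one
      ((hint hleft).const_mul 2).abs (hint hright) fun r hr => ?_)
  dsimp only
  rw [intervalIntegral.integral_const_mul, intervalIntegral.integral_const_mul,
    mul_left_comm, abs_mul, abs_of_nonneg (hL0 r hr)]
  exact mul_le_mul_of_nonneg_left (abs_two_mul_integral_mul_deriv_le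
    (fun θ => hasDerivAt_comp_smul_eR_right (hf.differentiable (by simp) (r • eR θ)))
    ((hft.comp (Continuous.prodMk_right r)).const_smul r)
    (fun θ => hasDerivAt_comp_smul_eR_right (hg.differentiable (by simp) (r • eR θ)))
    ((hgt.comp (Continuous.prodMk_right r)).const_smul r)
    (by rw [eR_neg_pi]) (by rw [eR_neg_pi])) (hL0 r hr)

theorem abs_two_mul_integral_jacobian_le (hL : ∀ r, HasDerivAt L (L' r) r) (hL' : Continuous L')
    (hL1 : L 1 = 0) (hL0 : ∀ r ∈ Ioo (0 : ℝ) 1, 0 ≤ L' r)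
    (hrL : ∀ r ∈ Ioo (0 : ℝ) 1, r * L' r ≤ 1) (hf : ContDiff ℝ ∞ f) (hg : ContDiff ℝ ∞ g) :
    |2 * ∫ x, L ‖x‖ * (radDeriv f x * angDeriv g x - angDeriv f x * radDeriv g x) ∂discMeasure| ≤
      ∫ x, (angDeriv f x ^ 2 + angDeriv g x ^ 2) ∂discMeasure := by
  have hft := continuous_fderiv_smul_eR_eTheta hf
  have hgt := continuous_fderiv_smul_eR_eTheta hg
  have hpolar : ∫ x, (angDeriv f x ^ 2 + angDeriv g x ^ 2) ∂discMeasure =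
      ∫ p, p.1 * (fderiv ℝ f (p.1 • eR p.2) (eTheta p.2) ^ 2 +
        fderiv ℝ g (p.1 • eR p.2) (eTheta p.2) ^ 2) ∂polarMeasure :=
    integral_disc_eq_integral_polarMeasure
      (((measurable_angDeriv f).pow_const 2).add
        ((measurable_angDeriv g).pow_const 2)).aestronglyMeasurable
      fun r hr θ => by
        simp only [angDeriv_smul_eR f hr.1, angDeriv_smul_eR g hr.1]
  rw [integral_mul_jacobian hL hL' hL1 hf hg, mul_neg, abs_neg, hpolar]
  refine (abs_two_mul_integral_mul_angular_le hL' hL0 hf hg).trans (integral_mono_ae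
    (integrable_polarMeasure_of_continuous (by fun_prop))
    (integrable_polarMeasure_of_continuous (by fun_prop)) ?_)
  filter_upwards [ae_polarMeasure_mem] with p hp
  have hr : 0 < p.1 := hp.1.1
  calc L' p.1 * ((p.1 * fderiv ℝ f (p.1 • eR p.2) (eTheta p.2)) ^ 2 +
        (p.1 * fderiv ℝ g (p.1 • eR p.2) (eTheta p.2)) ^ 2)
      = (p.1 * L' p.1) * (p.1 * (fderiv ℝ f (p.1 • eR p.2) (eTheta p.2) ^ 2 +
        fderiv ℝ g (p.1 • eR p.2) (eTheta p.2) ^ 2)) := by ring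
    _ ≤ p.1 * (fderiv ℝ f (p.1 • eR p.2) (eTheta p.2) ^ 2 +
        fderiv ℝ g (p.1 • eR p.2) (eTheta p.2) ^ 2) :=
      mul_le_of_le_one_left (by positivity) (hrL p.1 hp.1)

end Jacobian

lemma integral_sq_eR_eq {f : Plane → ℝ} (hf : ContDiff ℝ ∞ f) :
    ∫ θ in -Real.pi..Real.pi, f (eR θ) ^ 2 =
      ∫ p, (2 * p.1 * f (p.1 • eR p.2) ^ 2 +
        2 * p.1 ^ 2 * f (p.1 • eR p.2) * fderiv ℝ f (p.1 • eR p.2) (eR p.2)) ∂polarMeasure := by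
  have hfc := hf.continuous
  have hfr := continuous_fderiv_smul_eR_eR hf
  rw [integral_polarMeasure_of_hasDerivAt_radial (F := fun p => p.1 ^ 2 * f (p.1 • eR p.2) ^ 2)
    (by fun_prop) (integrable_polarMeasure_of_continuous (by fun_prop)) fun θ r _ => ?_]
  · simp
  · have hfr := hasDerivAt_comp_smul_eR_left (hf.differentiable (by simp) (r • eR θ))
    refine ((hasDerivAt_pow 2 r).mul (hfr.pow 2)).congr_deriv ?_
    simp only [Pi.pow_apply, Nat.cast_ofNat]
    ring

theorem integral_sq_le {f : Plane → ℝ} (hf : ContDiff ℝ ∞ f) :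
    ∫ x, f x ^ 2 ∂discMeasure ≤
      (∫ θ in -Real.pi..Real.pi, f (eR θ) ^ 2) + ∫ x, radDeriv f x ^ 2 ∂discMeasure := by
  have hfc := hf.continuous
  have hfr := continuous_fderiv_smul_eR_eR hf
  rw [integral_sq_eR_eq hf,
    integral_disc_eq_integral_polarMeasure (F := fun p => p.1 * f (p.1 • eR p.2) ^ 2)
      (by fun_prop : Continuous fun x => f x ^ 2).aestronglyMeasurable fun _ _ _ => rfl,
    integral_disc_eq_integral_polarMeasure
      (F := fun p => p.1 * fderiv ℝ f (p.1 • eR p.2) (eR p.2) ^ 2)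
      ((measurable_radDeriv f).pow_const 2).aestronglyMeasurable
      fun r hr θ => by rw [radDeriv_smul_eR f hr.1],
    ← integral_add (integrable_polarMeasure_of_continuous (by fun_prop))
      (integrable_polarMeasure_of_continuous (by fun_prop))]
  refine integral_mono_ae (integrable_polarMeasure_of_continuous (by fun_prop))
    (integrable_polarMeasure_of_continuous (by fun_prop)) ?_
  filter_upwards [ae_polarMeasure_mem] with p hp
  have hr : 0 < p.1 := hp.1.1
  have hsq : p.1 ^ 2 ≤ 1 := pow_le_one₀ hr.le hp.1.2.le
  generalize f (p.1 • eR p.2) = s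
  generalize fderiv ℝ f (p.1 • eR p.2) (eR p.2) = t
  nlinarith [mul_nonneg hr.le (sq_nonneg (s + p.1 * t)),
    mul_le_mul_of_nonneg_left hsq (mul_nonneg hr.le (sq_nonneg t))]

/-! ### Weak gradients of maps -/

section WeakGrad

variable {u η : Plane → Plane} {G H : Plane → Mat}

lemma HasWeakGrad.hasWeakGrad_weakGrad (h : HasWeakGrad u G) : HasWeakGrad u (weakGrad u) := by
  have hex : ∃ G, HasWeakGrad u G := ⟨G, h⟩
  rw [weakGrad, dif_pos hex]
  exact hex.choose_spec

lemma HasWeakGrad.weakGrad_ae_eq (h : HasWeakGrad u G) : weakGrad u =ᵐ[discMeasure] G := by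
  have hae : ∀ᵐ x ∂discMeasure, ∀ i j, weakGrad u x i j = G x i j :=
    ae_all_iff.2 fun i => ae_all_iff.2 fun j => (h.hasWeakGrad_weakGrad i j).ae_eq (h i j)
  filter_upwards [hae] with x hx using Matrix.ext hx

lemma MapMemW12.hasWeakGrad (hu : MapMemW12 u) : HasWeakGrad u (weakGrad u) := by
  choose g hg _ using fun i => (hu i).2
  exact HasWeakGrad.hasWeakGrad_weakGrad (G := fun x => Matrix.of fun i j => g i j x) hg

lemma MapMemW12.memLp_weakGrad (hu : MapMemW12 u) (i j : Fin 2) :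
    MemLp (fun x => weakGrad u x i j) 2 discMeasure := by
  obtain ⟨g, hg, hg2⟩ := (hu i).2 j
  exact hg2.ae_eq (hg.ae_eq (hu.hasWeakGrad i j))

lemma HasWeakGrad.add_smul (hu : HasWeakGrad u G) (hη : HasWeakGrad η H) (t : ℝ) :
    HasWeakGrad (fun x => u x + t • η x) (fun x => G x + t • H x) := fun i j =>
  (hu i j).add_const_mul (hη i j) t

end WeakGrad

section Jac

variable {φ : Plane → Plane} {x : Plane}

lemma jac_eq_partialDeriv (hφ : DifferentiableAt ℝ φ x) (i j : Fin 2) :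
    jac φ x i j = partialDeriv j (fun y => φ y i) x := by
  have h := (EuclideanSpace.proj (𝕜 := ℝ) i).hasFDerivAt.comp x hφ.hasFDerivAt
  exact (congrArg (fun A => A (EuclideanSpace.single j 1)) h.fderiv).symm

lemma radPart_jac (hφ : DifferentiableAt ℝ φ x) (i : Fin 2) :
    radPart (jac φ x) (angle x) i = radDeriv (fun y => φ y i) x := by
  rw [radPart, jac_eq_partialDeriv hφ, jac_eq_partialDeriv hφ, radDeriv, fderiv_eR]

lemma tanPart_jac (hφ : DifferentiableAt ℝ φ x) (i : Fin 2) :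
    tanPart (jac φ x) (angle x) i = angDeriv (fun y => φ y i) x := by
  rw [tanPart, jac_eq_partialDeriv hφ, jac_eq_partialDeriv hφ, angDeriv, fderiv_eTheta]

end Jac

section ELpNorm

variable {α E ι : Type*} [MeasurableSpace α] {μ : Measure α} {p : ℝ≥0∞}

lemma tendsto_eLpNorm_apply [Fintype ι] {f : ℕ → α → EuclideanSpace ℝ ι}
    (h : Tendsto (fun n => eLpNorm (f n) p μ) atTop (𝓝 0)) (i : ι) :
    Tendsto (fun n => eLpNorm (fun x => f n x i) p μ) atTop (𝓝 0) :=
  tendsto_of_tendsto_of_tendsto_of_le_of_le tendsto_const_nhds h (fun _ => zero_le)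
    fun n => eLpNorm_mono fun x => PiLp.norm_apply_le (f n x) i

lemma tendsto_eLpNorm_add [NormedAddCommGroup E] (hp : 1 ≤ p) {f g : ℕ → α → E}
    (hfm : ∀ n, AEStronglyMeasurable (f n) μ) (hgm : ∀ n, AEStronglyMeasurable (g n) μ)
    (hf : Tendsto (fun n => eLpNorm (f n) p μ) atTop (𝓝 0))
    (hg : Tendsto (fun n => eLpNorm (g n) p μ) atTop (𝓝 0)) :
    Tendsto (fun n => eLpNorm (f n + g n) p μ) atTop (𝓝 0) := by
  refine tendsto_of_tendsto_of_tendsto_of_le_of_le tendsto_const_nhds ?_ (fun _ => zero_le)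
    fun n => eLpNorm_add_le (hfm n) (hgm n) hp
  simpa only [add_zero] using hf.add hg

lemma tendsto_eLpNorm_sub [NormedAddCommGroup E] (hp : 1 ≤ p) {f g : ℕ → α → E}
    (hfm : ∀ n, AEStronglyMeasurable (f n) μ) (hgm : ∀ n, AEStronglyMeasurable (g n) μ)
    (hf : Tendsto (fun n => eLpNorm (f n) p μ) atTop (𝓝 0))
    (hg : Tendsto (fun n => eLpNorm (g n) p μ) atTop (𝓝 0)) :
    Tendsto (fun n => eLpNorm (f n - g n) p μ) atTop (𝓝 0) := by
  simp only [sub_eq_add_neg]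
  exact tendsto_eLpNorm_add hp hfm (fun n => (hgm n).neg) hf (by simpa only [eLpNorm_neg] using hg)

lemma norm_le_sum_norm_apply [Fintype ι] (x : EuclideanSpace ℝ ι) : ‖x‖ ≤ ∑ i, ‖x i‖ := by
  classical
  conv_lhs => rw [← (EuclideanSpace.basisFun ι ℝ).sum_repr x]
  refine (norm_sum_le _ _).trans_eq (Finset.sum_congr rfl fun i _ => ?_)
  rw [norm_smul, (EuclideanSpace.basisFun ι ℝ).norm_eq_one, mul_one]
  rfl

lemma tendsto_eLpNorm_of_apply [Fintype ι] (hp : 1 ≤ p) {f : ℕ → α → EuclideanSpace ℝ ι}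
    (hm : ∀ n i, AEStronglyMeasurable (fun x => f n x i) μ)
    (h : ∀ i, Tendsto (fun n => eLpNorm (fun x => f n x i) p μ) atTop (𝓝 0)) :
    Tendsto (fun n => eLpNorm (f n) p μ) atTop (𝓝 0) := by
  have hsum : Tendsto (fun n => ∑ i, eLpNorm (fun x => ‖f n x i‖) p μ) atTop (𝓝 0) := by
    simpa only [eLpNorm_norm, Finset.sum_const_zero] using
      tendsto_finsetSum Finset.univ fun i _ => h i
  refine tendsto_of_tendsto_of_tendsto_of_le_of_le tendsto_const_nhds hsum (fun _ => zero_le)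
    fun n => ?_
  refine (eLpNorm_mono_real fun x => ?_).trans (eLpNorm_sum_le (fun i _ => (hm n i).norm) hp)
  simpa only [Finset.sum_apply] using norm_le_sum_norm_apply (f n x)

end ELpNorm

/-! ### The covering map -/

/-- The components of the covering map without the translation `b`, which are homogeneous of
degree one. -/
def coveringPart (N : ℕ) (i : Fin 2) (x : Plane) : ℝ := ‖x‖ / √(N : ℝ) * eR (N * angle x) i

/-- The gradient of the covering map in the classical sense, which exists off the origin. -/
def coveringGrad (N : ℕ) (x : Plane) : Mat :=
  Matrix.of fun i j => partialDeriv j (coveringPart N i) x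

lemma coveringMap_apply (N : ℕ) (b x : Plane) (i : Fin 2) :
    coveringMap N b x i = coveringPart N i x + b i := by
  simp [coveringMap, coveringPart]

lemma posHomogeneous_coveringPart (N : ℕ) (i : Fin 2) : PosHomogeneous 1 (coveringPart N i) :=
  fun r hr x => by
    rw [coveringPart, coveringPart, angle_smul hr, norm_smul, Real.norm_of_nonneg hr.le,
      Real.rpow_one, smul_eq_mul]
    ring

lemma coveringPart_smul_eR (N : ℕ) (i : Fin 2) {r : ℝ} (hr : 0 < r) (θ : ℝ) :
    coveringPart N i (r • eR θ) = r / √(N : ℝ) * eR (N * θ) i := by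
  rw [coveringPart, norm_smul_eR hr.le, eR_nat_mul_congr N (eR_angle_smul_eR hr θ)]

lemma contDiffOn_cos_sin_nat_mul_angle (N : ℕ) :
    ContDiffOn ℝ ∞ (fun x => cos (N * angle x)) {0}ᶜ ∧
      ContDiffOn ℝ ∞ (fun x => sin (N * angle x)) {0}ᶜ := by
  induction N with
  | zero => simp [contDiffOn_const]
  | succ n ih =>
    simp only [Nat.cast_succ, add_mul, one_mul, Real.cos_add, Real.sin_add]
    exact ⟨(ih.1.mul contDiffOn_cos_angle).sub (ih.2.mul contDiffOn_sin_angle),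
      (ih.2.mul contDiffOn_cos_angle).add (ih.1.mul contDiffOn_sin_angle)⟩

lemma contDiffOn_coveringPart (N : ℕ) (i : Fin 2) : ContDiffOn ℝ ∞ (coveringPart N i) {0}ᶜ := by
  have hnorm : ContDiffOn ℝ ∞ (fun x : Plane => ‖x‖ / √(N : ℝ)) {0}ᶜ := fun x hx =>
    ((contDiffAt_norm ℝ hx).div_const _).contDiffWithinAt
  fin_cases i
  · exact hnorm.mul (contDiffOn_cos_sin_nat_mul_angle N).1
  · exact hnorm.mul (contDiffOn_cos_sin_nat_mul_angle N).2

lemma differentiableAt_coveringPart (N : ℕ) (i : Fin 2) {x : Plane} (hx : x ≠ 0) :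
    DifferentiableAt ℝ (coveringPart N i) x :=
  ((contDiffOn_coveringPart N i).contDiffAt
    (isOpen_compl_singleton.mem_nhds hx)).differentiableAt (by simp)

lemma fderiv_coveringPart_eR (N : ℕ) (i : Fin 2) {r : ℝ} (hr : 0 < r) (θ : ℝ) :
    fderiv ℝ (coveringPart N i) (r • eR θ) (eR θ) = eR (N * θ) i / √(N : ℝ) := by
  have h := hasDerivAt_comp_smul_eR_left
    (differentiableAt_coveringPart N i (smul_eR_ne_zero hr.ne' θ))
  have hformula := ((hasDerivAt_id' r).div_const √(N : ℝ)).mul_const (eR (N * θ) i)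
  have hray : (fun s : ℝ => coveringPart N i (s • eR θ)) =ᶠ[𝓝 r]
      fun s => s / √(N : ℝ) * eR (N * θ) i := by
    filter_upwards [lt_mem_nhds hr] with s hs using coveringPart_smul_eR N i hs θ
  rw [h.unique (hformula.congr_of_eventuallyEq hray), one_div_mul_eq_div]

lemma fderiv_coveringPart_eTheta (N : ℕ) (i : Fin 2) {r : ℝ} (hr : 0 < r) (θ : ℝ) :
    fderiv ℝ (coveringPart N i) (r • eR θ) (eTheta θ) = √(N : ℝ) * eTheta (N * θ) i := by
  have h := hasDerivAt_comp_smul_eR_right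
    (differentiableAt_coveringPart N i (smul_eR_ne_zero hr.ne' θ))
  simp only [coveringPart_smul_eR N i hr] at h
  have hformula := h.unique ((hasDerivAt_eR_nat_mul N i θ).const_mul (r / √(N : ℝ)))
  refine mul_left_cancel₀ hr.ne' ?_
  calc r * fderiv ℝ (coveringPart N i) (r • eR θ) (eTheta θ)
      = r * (N / √(N : ℝ) * eTheta (N * θ) i) := by rw [← smul_eq_mul, hformula]; ring
    _ = r * (√(N : ℝ) * eTheta (N * θ) i) := by rw [Real.div_sqrt]

lemma radPart_coveringGrad (N : ℕ) {x : Plane} (hx : x ≠ 0) (i : Fin 2) :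
    radPart (coveringGrad N x) (angle x) i = eR (N * angle x) i / √(N : ℝ) := by
  have h := fderiv_coveringPart_eR N i (norm_pos_iff.2 hx) (angle x)
  rwa [norm_smul_eR_angle, fderiv_eR] at h

lemma tanPart_coveringGrad (N : ℕ) {x : Plane} (hx : x ≠ 0) (i : Fin 2) :
    tanPart (coveringGrad N x) (angle x) i = √(N : ℝ) * eTheta (N * angle x) i := by
  have h := fderiv_coveringPart_eTheta N i (norm_pos_iff.2 hx) (angle x)
  rwa [norm_smul_eR_angle, fderiv_eTheta] at h

lemma memLp_coveringGrad (N : ℕ) (i j : Fin 2) (q : ℝ≥0∞) :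
    MemLp (fun x => coveringGrad N x i j) q discMeasure := by
  have h := (posHomogeneous_coveringPart N i).partialDeriv_apply j
  rw [sub_self] at h
  exact (h.memLp_top (continuousOn_partialDeriv (contDiffOn_coveringPart N i) j)).mono_exponent
    le_top

lemma hasWeakGrad_coveringMap (N : ℕ) (b : Plane) :
    HasWeakGrad (coveringMap N b) (coveringGrad N) := by
  intro i j
  have h := ((posHomogeneous_coveringPart N i).hasWeakPartial (by norm_num)
    (contDiffOn_coveringPart N i) j).add_const_mul (hasWeakPartial_of_contDiff
      (contDiff_const (c := b i) (𝕜 := ℝ) (E := Plane) (n := ∞)) j) 1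
  convert h using 2 with x x
  · rw [coveringMap_apply, one_mul]
  · simp [coveringGrad, partialDeriv]

lemma mapMemW12_coveringMap (N : ℕ) (b : Plane) : MapMemW12 (coveringMap N b) := by
  intro i
  refine ⟨?_, fun j => ⟨_, hasWeakGrad_coveringMap N b i j, memLp_coveringGrad N i j 2⟩⟩
  simp only [coveringMap_apply]
  exact ((posHomogeneous_coveringPart N i).memLp (contDiffOn_coveringPart N i).continuousOn
    two_ne_zero ENNReal.ofNat_ne_top (by norm_num)).add (memLp_const _)

lemma weakGrad_coveringMap (N : ℕ) (b : Plane) :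
    weakGrad (coveringMap N b) =ᵐ[discMeasure] coveringGrad N :=
  (hasWeakGrad_coveringMap N b).weakGrad_ae_eq

/-- Smooth maps that agree with the covering map away from the origin and approximate it in
`W^{1,2}`. -/
def coveringApprox (N : ℕ) (b : Plane) (n : ℕ) (x : Plane) : Plane :=
  WithLp.toLp 2 fun i => cutoff n x * coveringPart N i x + b i

lemma contDiff_coveringApprox (N : ℕ) (b : Plane) (n : ℕ) :
    ContDiff ℝ ∞ (coveringApprox N b n) :=
  contDiff_euclidean.2 fun i =>
    (contDiff_cutoff_mul (contDiffOn_coveringPart N i) n).add contDiff_const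

lemma tendstoW12_coveringApprox (N : ℕ) (b : Plane) :
    TendstoW12 (coveringApprox N b) (coveringMap N b) := by
  have hsmooth := contDiff_coveringApprox N b
  constructor
  · refine tendsto_eLpNorm_of_apply one_le_two (fun n i => ?_) fun i => ?_
    · exact (contDiff_euclidean.1 (hsmooth n) i).continuous.aestronglyMeasurable.sub
        (mapMemW12_coveringMap N b i).1.1
    · refine (tendsto_cutoff_mul two_ne_zero ENNReal.ofNat_ne_top (contDiffOn_coveringPart N i)
        ((posHomogeneous_coveringPart N i).memLp (contDiffOn_coveringPart N i).continuousOn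
          two_ne_zero ENNReal.ofNat_ne_top (by norm_num))).congr fun n => ?_
      congr 1 with x
      rw [PiLp.sub_apply, coveringMap_apply]
      simp [coveringApprox]
  · intro i j
    refine (tendsto_partialDeriv_cutoff_mul two_ne_zero ENNReal.ofNat_ne_top
      (contDiffOn_coveringPart N i) ((posHomogeneous_coveringPart N i).div_norm.memLp
        (continuousOn_div_norm (contDiffOn_coveringPart N i).continuousOn) two_ne_zero
        ENNReal.ofNat_ne_top (by norm_num))
      (memLp_coveringGrad N i j 2)).congr fun n => eLpNorm_congr_ae ?_
    filter_upwards [weakGrad_coveringMap N b] with x hx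
    rw [hx, jac_eq_partialDeriv ((hsmooth n).differentiable (by simp) x)]
    simp [coveringGrad, coveringApprox, partialDeriv]

lemma coveringApprox_eR (N : ℕ) (b : Plane) {n : ℕ} (hn : 1 ≤ n) (θ : ℝ) :
    coveringApprox N b n (eR θ) = boundaryData N b θ := by
  have hcutoff : cutoff n (eR θ) = 1 := by
    have hn' : (1 : ℝ) ≤ n := Nat.one_le_cast.2 hn
    rw [cutoff, norm_eR]
    exact Real.smoothTransition.one_of_one_le (by nlinarith)
  have hpart (i : Fin 2) : coveringPart N i (eR θ) = 1 / √(N : ℝ) * eR (N * θ) i := by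
    simpa only [one_smul] using coveringPart_smul_eR N i one_pos θ
  ext i
  simp [coveringApprox, boundaryData, hcutoff, hpart]

lemma hasTrace_coveringMap (N : ℕ) (b : Plane) :
    HasTrace (coveringMap N b) (boundaryData N b) := by
  refine ⟨coveringApprox N b, contDiff_coveringApprox N b, tendstoW12_coveringApprox N b, ?_⟩
  refine tendsto_const_nhds.congr' ?_
  filter_upwards [eventually_ge_atTop 1] with n hn
  simp [coveringApprox_eR N b hn]

lemma frob_cof_coveringGrad {N : ℕ} (hN : N ≠ 0) {x : Plane} (hx : x ≠ 0) (H : Mat) :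
    √(N : ℝ) * frob (cof (coveringGrad N x)) H =
      ∑ i, (N * (eR (N * angle x) i * radPart H (angle x) i) +
        eTheta (N * angle x) i * tanPart H (angle x) i) := by
  have hpos : (0 : ℝ) < √(N : ℝ) := Real.sqrt_pos.2 (by positivity)
  have hsq : (N : ℝ) = √(N : ℝ) * √(N : ℝ) := (Real.mul_self_sqrt (by positivity)).symm
  rw [frob_cof_eq_radPart_tanPart _ _ (angle x)]
  simp only [radPart_coveringGrad N hx, tanPart_coveringGrad N hx, Fin.sum_univ_two, eR_zero,
    eR_one, eTheta_zero, eTheta_one]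
  generalize (N : ℝ) * angle x = φ
  generalize √(N : ℝ) = s at *
  rw [hsq]
  field_simp
  ring

lemma det_coveringGrad {N : ℕ} (hN : N ≠ 0) {x : Plane} (hx : x ≠ 0) :
    (coveringGrad N x).det = 1 := by
  have hcancel : (√(N : ℝ))⁻¹ * √(N : ℝ) = 1 :=
    inv_mul_cancel₀ (Real.sqrt_pos.2 (by positivity)).ne'
  rw [det_eq_radPart_tanPart _ (angle x)]
  simp only [radPart_coveringGrad N hx, tanPart_coveringGrad N hx, eR_zero, eR_one, eTheta_zero,
    eTheta_one]
  linear_combination (cos (N * angle x) ^ 2 + sin (N * angle x) ^ 2) * hcancel +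
    Real.sin_sq_add_cos_sq (N * angle x)

theorem coveringMap_mem_admissible {N : ℕ} (hN : N ≠ 0) (b : Plane) :
    coveringMap N b ∈ Admissible (boundaryData N b) := by
  refine ⟨mapMemW12_coveringMap N b, ?_, hasTrace_coveringMap N b⟩
  filter_upwards [weakGrad_coveringMap N b, ae_discMeasure_mem] with x hx hx0
  rw [hx, det_coveringGrad hN hx0.2]

lemma integrand_coveringGrad (ν a : ℝ) (N : ℕ) {x : Plane} (hx : x ≠ 0) :
    integrand ν a x (coveringGrad N x) = ν * (a / N + N) := by
  have hsq : √(N : ℝ) ^ 2 = N := Real.sq_sqrt (by positivity)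
  have hinv : (√(N : ℝ))⁻¹ ^ 2 = (N : ℝ)⁻¹ := by rw [inv_pow, hsq]
  rw [integrand_eq_polarForm, polarForm]
  simp only [radPart_coveringGrad N hx, tanPart_coveringGrad N hx, Fin.sum_univ_two, eR_zero,
    eR_one, eTheta_zero, eTheta_one]
  linear_combination (ν * (a / N + N)) * Real.sin_sq_add_cos_sq (N * angle x) +
    ν * (cos (N * angle x) ^ 2 + sin (N * angle x) ^ 2) * (a * hinv + hsq)

theorem energy_coveringMap (ν a : ℝ) (N : ℕ) (b : Plane) :
    energy (integrand ν a) (coveringMap N b) = ν * Real.pi * (a / N + N) := by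
  have hconst : energy (integrand ν a) (coveringMap N b) =
      ∫ _, ν * (a / N + N) ∂discMeasure := by
    refine integral_congr_ae ?_
    filter_upwards [weakGrad_coveringMap N b, ae_discMeasure_mem] with x hx hx0
    rw [hx, integrand_coveringGrad ν a N hx0.2]
  rw [hconst, integral_const, discMeasure_univ, smul_eq_mul]
  ring

lemma abs_sin_nat_mul_le (N : ℕ) (t : ℝ) : |sin (N * t)| ≤ N * |sin t| := by
  induction N with
  | zero => simp
  | succ n ih =>
    rw [Nat.cast_succ, add_mul, one_mul, Real.sin_add, add_mul, one_mul]
    refine (abs_add_le _ _).trans (add_le_add ?_ ?_)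
    · rw [abs_mul]
      exact (mul_le_of_le_one_right (abs_nonneg _) (Real.abs_cos_le_one _)).trans ih
    · rw [abs_mul]
      exact mul_le_of_le_one_left (abs_nonneg _) (Real.abs_cos_le_one _)

lemma norm_eR_sub_eR (α β : ℝ) : ‖eR α - eR β‖ = 2 * |sin ((α - β) / 2)| := by
  have h : ‖eR α - eR β‖ ^ 2 = (2 * |sin ((α - β) / 2)|) ^ 2 := by
    rw [EuclideanSpace.norm_sq_eq, Fin.sum_univ_two, mul_pow, sq_abs, Real.sin_sq_eq_half_sub,
      mul_div_cancel₀ _ two_ne_zero, Real.cos_sub]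
    simp only [PiLp.sub_apply, eR_zero, eR_one, Real.norm_eq_abs, sq_abs]
    linear_combination Real.sin_sq_add_cos_sq α + Real.sin_sq_add_cos_sq β
  exact (pow_left_inj₀ (norm_nonneg _) (by positivity) two_ne_zero).1 h

lemma norm_eR_nat_mul_sub_le (N : ℕ) (α β : ℝ) :
    ‖eR (N * α) - eR (N * β)‖ ≤ N * ‖eR α - eR β‖ := by
  rw [norm_eR_sub_eR, norm_eR_sub_eR, ← mul_sub, mul_div_assoc, mul_left_comm]
  exact mul_le_mul_of_nonneg_left (abs_sin_nat_mul_le N _) two_pos.le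

lemma norm_mul_norm_eR_angle_sub_le (x y : Plane) :
    ‖y‖ * ‖eR (angle x) - eR (angle y)‖ ≤ 2 * ‖x - y‖ := by
  have hsplit : ‖y‖ • (eR (angle x) - eR (angle y)) = (x - y) - (‖x‖ - ‖y‖) • eR (angle x) := by
    rw [smul_sub, norm_smul_eR_angle, sub_smul, norm_smul_eR_angle]
    abel
  calc ‖y‖ * ‖eR (angle x) - eR (angle y)‖
      = ‖(x - y) - (‖x‖ - ‖y‖) • eR (angle x)‖ := by rw [← hsplit, norm_smul, norm_norm]
    _ ≤ ‖x - y‖ + |‖x‖ - ‖y‖| := by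
        refine (norm_sub_le _ _).trans_eq ?_
        rw [norm_smul, norm_eR, mul_one, Real.norm_eq_abs]
    _ ≤ 2 * ‖x - y‖ := by rw [two_mul]; gcongr; exact abs_norm_sub_norm_le x y

theorem lipschitzWith_coveringMap (N : ℕ) (b : Plane) :
    LipschitzWith (Real.toNNReal (1 / √(N : ℝ) * (1 + N * 2))) (coveringMap N b) := by
  refine LipschitzWith.of_dist_le_mul fun x y => ?_
  rw [Real.coe_toNNReal _ (by positivity), dist_eq_norm, dist_eq_norm]
  have hsplit : coveringMap N b x - coveringMap N b y = (1 / √(N : ℝ)) •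
      ((‖x‖ - ‖y‖) • eR (N * angle x) + ‖y‖ • (eR (N * angle x) - eR (N * angle y))) := by
    simp only [coveringMap]
    module
  have hangular : ‖y‖ * ‖eR (N * angle x) - eR (N * angle y)‖ ≤ N * (2 * ‖x - y‖) :=
    calc ‖y‖ * ‖eR (N * angle x) - eR (N * angle y)‖
        ≤ ‖y‖ * (N * ‖eR (angle x) - eR (angle y)‖) := by
          gcongr
          exact norm_eR_nat_mul_sub_le N _ _
      _ = N * (‖y‖ * ‖eR (angle x) - eR (angle y)‖) := mul_left_comm _ _ _
      _ ≤ N * (2 * ‖x - y‖) :=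
          mul_le_mul_of_nonneg_left (norm_mul_norm_eR_angle_sub_le x y) (Nat.cast_nonneg N)
  rw [hsplit, norm_smul, Real.norm_of_nonneg (by positivity), mul_assoc]
  refine mul_le_mul_of_nonneg_left ((norm_add_le _ _).trans ?_) (by positivity)
  rw [norm_smul, norm_eR, mul_one, Real.norm_eq_abs, norm_smul, norm_norm]
  linarith [abs_norm_sub_norm_le x y]

lemma fderiv_coveringMap_zero_eR {N : ℕ} {b : Plane}
    (h : DifferentiableAt ℝ (coveringMap N b) 0) (θ : ℝ) :
    fderiv ℝ (coveringMap N b) 0 (eR θ) = (1 / √(N : ℝ)) • eR (N * θ) := by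
  have hray : HasDerivAt (fun s : ℝ => coveringMap N b (s • eR θ))
      (fderiv ℝ (coveringMap N b) 0 (eR θ)) 0 := by
    have h' := hasDerivAt_comp_smul_eR_left (f := coveringMap N b) (r := 0) (θ := θ)
      (by rwa [zero_smul])
    rwa [zero_smul] at h'
  have hformula : HasDerivAt (fun s : ℝ => (s / √(N : ℝ)) • eR (N * θ) + b)
      ((1 / √(N : ℝ)) • eR (N * θ)) 0 :=
    (((hasDerivAt_id' 0).div_const _).smul_const _).add_const b
  refine (uniqueDiffOn_Ici (0 : ℝ) 0 self_mem_Ici).eq_deriv _ hray.hasDerivWithinAt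
    (hformula.hasDerivWithinAt.congr_of_mem (fun s hs => ?_) self_mem_Ici)
  rcases (mem_Ici.1 hs).eq_or_lt with rfl | hs
  · simp [coveringMap]
  · rw [coveringMap, norm_smul_eR hs.le, eR_nat_mul_congr N (eR_angle_smul_eR hs θ)]

lemma eR_add_eR_neg (φ : ℝ) : eR φ + eR (-φ) = (2 * cos φ) • eR 0 := by
  ext i
  fin_cases i
  · simp [two_mul]
  · simp

lemma not_differentiableAt_coveringMap {N : ℕ} (hN : 2 ≤ N) (b : Plane) :
    ¬ DifferentiableAt ℝ (coveringMap N b) 0 := by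
  intro h
  have hN2 : (2 : ℝ) ≤ N := by exact_mod_cast hN
  -- `π / N` and `-π / N` have the same image, but `cos (π / N) ≥ 0` whereas `cos π < 0`.
  have hlin : (1 / √(N : ℝ)) • (eR Real.pi + eR (-Real.pi)) =
      (2 * cos (Real.pi / N)) • (1 / √(N : ℝ)) • eR 0 := by
    have h' := congrArg (fderiv ℝ (coveringMap N b) 0) (eR_add_eR_neg (Real.pi / N))
    rwa [map_add, map_smul, fderiv_coveringMap_zero_eR h, fderiv_coveringMap_zero_eR h,
      fderiv_coveringMap_zero_eR h, mul_neg, mul_zero,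
      mul_div_cancel₀ _ (by positivity : (N : ℝ) ≠ 0), ← smul_add] at h'
  have hzero := congrArg (fun v : Plane => v 0) hlin
  simp only [PiLp.add_apply, PiLp.smul_apply, eR_zero, Real.cos_neg, Real.cos_pi,
    Real.cos_zero, smul_eq_mul] at hzero
  have hcos : 0 ≤ cos (Real.pi / N) := by
    refine Real.cos_nonneg_of_neg_pi_div_two_le_of_le ?_ (by gcongr)
    exact (neg_nonpos.2 (by positivity)).trans (by positivity)
  have hpos : 0 < 1 / √(N : ℝ) := by positivity
  nlinarith [mul_nonneg hcos hpos.le]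

theorem not_contDiffOn_coveringMap {N : ℕ} (hN : 2 ≤ N) (b : Plane) :
    ¬ ContDiffOn ℝ 1 (coveringMap N b) disc := fun h =>
  not_differentiableAt_coveringMap hN b <|
    (h.contDiffAt (isOpen_disc.mem_nhds (by simp [disc]))).differentiableAt one_ne_zero

/-! ### The Euler-Lagrange equation of the covering map -/

lemma memLp_bdd_mul {α : Type*} [MeasurableSpace α] {μ : Measure α} {p : ℝ≥0∞} {w f : α → ℝ}
    {C : ℝ} (hwm : AEStronglyMeasurable w μ) (hw : ∀ᵐ x ∂μ, |w x| ≤ C) (hf : MemLp f p μ) :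
    MemLp (fun x => w x * f x) p μ := by
  refine hf.of_le_mul (c := C) (hwm.mul hf.1) ?_
  filter_upwards [hw] with x hx
  rw [norm_mul]
  exact mul_le_mul_of_nonneg_right hx (norm_nonneg _)

section MatrixFields

variable {μ : Measure Plane} {p : ℝ≥0∞} {D G U : Plane → Mat}

lemma memLp_radPart (hD : ∀ i j, MemLp (fun x => D x i j) p μ) (i : Fin 2) :
    MemLp (fun x => radPart (D x) (angle x) i) p μ := by
  have hcos := memLp_bdd_mul measurable_cos_angle.aestronglyMeasurable
    (ae_of_all _ fun x => Real.abs_cos_le_one (angle x)) (hD i 0)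
  have hsin := memLp_bdd_mul measurable_sin_angle.aestronglyMeasurable
    (ae_of_all _ fun x => Real.abs_sin_le_one (angle x)) (hD i 1)
  refine (hcos.add hsin).ae_eq (ae_of_all _ fun x => ?_)
  simp only [Pi.add_apply, radPart]
  ring

lemma memLp_tanPart (hD : ∀ i j, MemLp (fun x => D x i j) p μ) (i : Fin 2) :
    MemLp (fun x => tanPart (D x) (angle x) i) p μ := by
  have hsin := memLp_bdd_mul measurable_sin_angle.aestronglyMeasurable
    (ae_of_all _ fun x => Real.abs_sin_le_one (angle x)) (hD i 0)
  have hcos := memLp_bdd_mul measurable_cos_angle.aestronglyMeasurable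
    (ae_of_all _ fun x => Real.abs_cos_le_one (angle x)) (hD i 1)
  refine (hcos.sub hsin).ae_eq (ae_of_all _ fun x => ?_)
  simp only [Pi.sub_apply, tanPart]
  ring

lemma integrable_polarForm (a : ℝ) (hD : ∀ i j, MemLp (fun x => D x i j) 2 μ)
    (hG : ∀ i j, MemLp (fun x => G x i j) 2 μ) :
    Integrable (fun x => polarForm a (angle x) (D x) (G x)) μ :=
  integrable_finsetSum _ fun i _ =>
    (((memLp_radPart hD i).const_mul a).integrable_mul (memLp_radPart hG i)).add
      ((memLp_tanPart hD i).integrable_mul (memLp_tanPart hG i))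

lemma memLp_frob_cof (hU : ∀ i j, MemLp (fun x => U x i j) ⊤ μ)
    (hD : ∀ i j, MemLp (fun x => D x i j) p μ) :
    MemLp (fun x => frob (cof (U x)) (D x)) p μ := by
  have hmul (i j k l : Fin 2) : MemLp (fun x => U x i j * D x k l) p μ :=
    (hD k l).mul' (hU i j)
  simp only [frob_cof]
  exact (((hmul 1 1 0 0).sub (hmul 1 0 0 1)).sub (hmul 0 1 1 0)).add (hmul 0 0 1 1)

end MatrixFields

lemma integrable_log_norm_mul {f : Plane → ℝ} (hf : MemLp f 2 discMeasure) :
    Integrable (fun x => Real.log ‖x‖ * f x) discMeasure :=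
  (memLp_log_norm two_ne_zero ENNReal.ofNat_ne_top).integrable_mul hf

lemma memLp_jac {φ : Plane → Plane} (hφ : ContDiff ℝ ∞ φ) (i j : Fin 2) (q : ℝ≥0∞) :
    MemLp (fun x => jac φ x i j) q discMeasure := by
  have hdiff : Differentiable ℝ φ := hφ.differentiable (by simp)
  simp only [fun x => jac_eq_partialDeriv (hdiff x) i j]
  exact memLp_disc_of_continuous
    (continuous_partialDeriv (f := fun y => φ y i) (contDiff_euclidean.1 hφ i) j) q

/-- The gradients of the smooth maps `ψ n` converge in `L²` on the disc to the matrix field `D`.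
This is how the identities for smooth maps are passed on to weak gradients. -/
structure GradTendsto (ψ : ℕ → Plane → Plane) (D : Plane → Mat) : Prop where
  contDiff : ∀ n, ContDiff ℝ ∞ (ψ n)
  memLp : ∀ i j, MemLp (fun x => D x i j) 2 discMeasure
  tendsto : ∀ i j, Tendsto (fun n => eLpNorm (fun x => jac (ψ n) x i j - D x i j) 2 discMeasure)
    atTop (𝓝 0)

lemma gradTendsto_const {φ : Plane → Plane} (hφ : ContDiff ℝ ∞ φ) :
    GradTendsto (fun _ => φ) (jac φ) :=
  ⟨fun _ => hφ, fun i j => memLp_jac hφ i j 2, fun i j => by simp⟩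

namespace GradTendsto

variable {ψ : ℕ → Plane → Plane} {D : Plane → Mat} (h : GradTendsto ψ D)

include h

lemma contDiff_apply (n : ℕ) (i : Fin 2) : ContDiff ℝ ∞ fun y => ψ n y i :=
  contDiff_euclidean.1 (h.contDiff n) i

lemma radPart_jac (n : ℕ) (i : Fin 2) (x : Plane) :
    radPart (jac (ψ n) x) (angle x) i = radDeriv (fun y => ψ n y i) x :=
  IncompressibleDisc.radPart_jac ((h.contDiff n).differentiable (by simp) x) i

lemma tanPart_jac (n : ℕ) (i : Fin 2) (x : Plane) :
    tanPart (jac (ψ n) x) (angle x) i = angDeriv (fun y => ψ n y i) x :=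
  IncompressibleDisc.tanPart_jac ((h.contDiff n).differentiable (by simp) x) i

lemma memLp_radDeriv (n : ℕ) (i : Fin 2) :
    MemLp (radDeriv fun y => ψ n y i) 2 discMeasure := by
  simpa only [h.radPart_jac] using memLp_radPart (fun i j => memLp_jac (h.contDiff n) i j 2) i

lemma memLp_angDeriv (n : ℕ) (i : Fin 2) :
    MemLp (angDeriv fun y => ψ n y i) 2 discMeasure := by
  simpa only [h.tanPart_jac] using memLp_tanPart (fun i j => memLp_jac (h.contDiff n) i j 2) i

lemma aestronglyMeasurable_mul_sub {w : Plane → ℝ} (hw : Measurable w) (n : ℕ) (i j : Fin 2) :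
    AEStronglyMeasurable (fun x => w x * jac (ψ n) x i j - w x * D x i j) discMeasure :=
  (hw.aestronglyMeasurable.mul (memLp_jac (h.contDiff n) i j 2).1).sub
    (hw.aestronglyMeasurable.mul (h.memLp i j).1)

lemma tendsto_radDeriv (i : Fin 2) :
    Tendsto (fun n => eLpNorm (fun x => radDeriv (fun y => ψ n y i) x -
      radPart (D x) (angle x) i) 2 discMeasure) atTop (𝓝 0) := by
  have hcos := tendsto_eLpNorm_mul_bdd
    (ae_of_all _ fun x => Real.abs_cos_le_one (angle x)) (h.tendsto i 0)
  have hsin := tendsto_eLpNorm_mul_bdd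
    (ae_of_all _ fun x => Real.abs_sin_le_one (angle x)) (h.tendsto i 1)
  refine (tendsto_eLpNorm_add one_le_two
    (fun n => h.aestronglyMeasurable_mul_sub measurable_cos_angle n i 0)
    (fun n => h.aestronglyMeasurable_mul_sub measurable_sin_angle n i 1) hcos hsin).congr
    fun n => ?_
  congr 1 with x
  simp only [Pi.add_apply, ← h.radPart_jac, radPart]
  ring

lemma tendsto_angDeriv (i : Fin 2) :
    Tendsto (fun n => eLpNorm (fun x => angDeriv (fun y => ψ n y i) x -
      tanPart (D x) (angle x) i) 2 discMeasure) atTop (𝓝 0) := by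
  have hsin := tendsto_eLpNorm_mul_bdd
    (ae_of_all _ fun x => Real.abs_sin_le_one (angle x)) (h.tendsto i 0)
  have hcos := tendsto_eLpNorm_mul_bdd
    (ae_of_all _ fun x => Real.abs_cos_le_one (angle x)) (h.tendsto i 1)
  refine (tendsto_eLpNorm_sub one_le_two
    (fun n => h.aestronglyMeasurable_mul_sub measurable_cos_angle n i 1)
    (fun n => h.aestronglyMeasurable_mul_sub measurable_sin_angle n i 0) hcos hsin).congr
    fun n => ?_
  congr 1 with x
  simp only [Pi.sub_apply, ← h.tanPart_jac, tanPart]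
  ring

end GradTendsto

/-- The radial part of the stress of the covering map with pressure `(N ^ 2 - a) / N * log ‖x‖`,
multiplied by `√N`. -/
def radStress (a : ℝ) (N : ℕ) (i : Fin 2) (x : Plane) : ℝ :=
  (a + ((N : ℝ) ^ 2 - a) * Real.log ‖x‖) * eR (N * angle x) i

/-- The angular part of the stress of the covering map with pressure `(N ^ 2 - a) / N * log ‖x‖`,
multiplied by `√N`. -/
def angStress (a : ℝ) (N : ℕ) (i : Fin 2) (x : Plane) : ℝ :=
  (N + ((N : ℝ) ^ 2 - a) / N * Real.log ‖x‖) * eTheta (N * angle x) i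

lemma sqrt_mul_polarForm_coveringGrad_add (a : ℝ) {N : ℕ} (hN : N ≠ 0) {x : Plane} (hx : x ≠ 0)
    (ξ : Mat) :
    √(N : ℝ) * (polarForm a (angle x) (coveringGrad N x) ξ +
        ((N : ℝ) ^ 2 - a) / N * (Real.log ‖x‖ * frob (cof (coveringGrad N x)) ξ)) =
      ∑ i, (radStress a N i x * radPart ξ (angle x) i +
        angStress a N i x * tanPart ξ (angle x) i) := by
  have hcof := frob_cof_coveringGrad hN hx ξ
  rw [mul_add, mul_left_comm, mul_left_comm √(N : ℝ), hcof]
  simp only [polarForm, radStress, angStress, radPart_coveringGrad N hx,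
    tanPart_coveringGrad N hx, Fin.sum_univ_two]
  have hsqrt : √(N : ℝ) ≠ 0 := (Real.sqrt_pos.2 (by positivity)).ne'
  have hN' : (N : ℝ) ≠ 0 := Nat.cast_ne_zero.2 hN
  field_simp
  rw [Real.sq_sqrt (Nat.cast_nonneg N)]
  ring

lemma memLp_const_add_log_norm_mul (A B : ℝ) {w : Plane → ℝ} {q : ℝ≥0∞} (hq0 : q ≠ 0)
    (hq : q ≠ ⊤) (hwm : Measurable w) (hw : ∀ x, |w x| ≤ 1) :
    MemLp (fun x => (A + B * Real.log ‖x‖) * w x) q discMeasure := by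
  have hlog : MemLp (fun x : Plane => A + B * Real.log ‖x‖) q discMeasure :=
    (memLp_const A).add ((memLp_log_norm hq0 hq).const_mul B)
  simpa only [mul_comm] using memLp_bdd_mul hwm.aestronglyMeasurable (ae_of_all _ hw) hlog

lemma memLp_radStress (a : ℝ) (N : ℕ) (i : Fin 2) : MemLp (radStress a N i) 2 discMeasure :=
  memLp_const_add_log_norm_mul _ _ two_ne_zero ENNReal.ofNat_ne_top
    (measurable_eR_nat_mul_angle N i) fun _ => abs_eR_apply_le _ i

lemma memLp_angStress (a : ℝ) (N : ℕ) (i : Fin 2) : MemLp (angStress a N i) 2 discMeasure :=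
  memLp_const_add_log_norm_mul _ _ two_ne_zero ENNReal.ofNat_ne_top
    (measurable_eTheta_nat_mul_angle N i) fun _ => abs_eTheta_apply_le _ i

lemma GradTendsto.integrable_stress {ψ : ℕ → Plane → Plane} {D : Plane → Mat}
    (h : GradTendsto ψ D) (a : ℝ) (N : ℕ) (i : Fin 2) :
    Integrable (fun x => radStress a N i x * radPart (D x) (angle x) i +
      angStress a N i x * tanPart (D x) (angle x) i) discMeasure :=
  ((memLp_radStress a N i).integrable_mul (memLp_radPart h.memLp i)).add
    ((memLp_angStress a N i).integrable_mul (memLp_tanPart h.memLp i))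

lemma GradTendsto.integral_stress_eq_zero {ψ : ℕ → Plane → Plane} {D : Plane → Mat}
    (h : GradTendsto ψ D) (a : ℝ) {N : ℕ} (hN : N ≠ 0) (i : Fin 2)
    (hb : Tendsto (fun n => ∫ θ in -Real.pi..Real.pi, eR (N * θ) i * ψ n (eR θ) i) atTop (𝓝 0)) :
    ∫ x, (radStress a N i x * radPart (D x) (angle x) i +
      angStress a N i x * tanPart (D x) (angle x) i) ∂discMeasure = 0 := by
  have hrad := memLp_radStress a N i
  have hang := memLp_angStress a N i
  have hlim := (tendsto_integral_mul_of_eLpNorm_two (fun _ => hrad)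
    (fun n => h.memLp_radDeriv n i) hrad (memLp_radPart h.memLp i) (by simp)
    (h.tendsto_radDeriv i)).add (tendsto_integral_mul_of_eLpNorm_two (fun _ => hang)
    (fun n => h.memLp_angDeriv n i) hang (memLp_tanPart h.memLp i) (by simp)
    (h.tendsto_angDeriv i))
  refine (integral_add (hrad.integrable_mul (memLp_radPart h.memLp i))
    (hang.integrable_mul (memLp_tanPart h.memLp i))).trans (tendsto_nhds_unique hlim ?_)
  rw [← mul_zero a]
  refine (hb.const_mul a).congr fun n => ?_
  rw [← integral_radDeriv_add_angDeriv a i hN (h.contDiff_apply n i)]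
  exact integral_add (hrad.integrable_mul (h.memLp_radDeriv n i))
    (hang.integrable_mul (h.memLp_angDeriv n i))

theorem integral_polarForm_coveringMap (a : ℝ) {N : ℕ} (hN : N ≠ 0) (b : Plane)
    {ψ : ℕ → Plane → Plane} {D : Plane → Mat} (h : GradTendsto ψ D)
    (hb : ∀ i, Tendsto (fun n => ∫ θ in -Real.pi..Real.pi, eR (N * θ) i * ψ n (eR θ) i)
      atTop (𝓝 0)) :
    ∫ x, polarForm a (angle x) (weakGrad (coveringMap N b) x) (D x) ∂discMeasure =
      -(((N : ℝ) ^ 2 - a) / N * ∫ x, Real.log ‖x‖ *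
        frob (cof (weakGrad (coveringMap N b) x)) (D x) ∂discMeasure) := by
  have hsqrt : √(N : ℝ) ≠ 0 := (Real.sqrt_pos.2 (by positivity)).ne'
  have hform := integrable_polarForm a (fun i j => memLp_coveringGrad N i j 2) h.memLp
  have hcof := (integrable_log_norm_mul
    (memLp_frob_cof (fun i j => memLp_coveringGrad N i j ⊤) h.memLp)).const_mul
    (((N : ℝ) ^ 2 - a) / N)
  have hsum : ∫ x, (polarForm a (angle x) (coveringGrad N x) (D x) + ((N : ℝ) ^ 2 - a) / N *
      (Real.log ‖x‖ * frob (cof (coveringGrad N x)) (D x))) ∂discMeasure = 0 := by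
    refine (mul_eq_zero_iff_left hsqrt).1 ?_
    calc _ = ∫ x, ∑ i, (radStress a N i x * radPart (D x) (angle x) i +
          angStress a N i x * tanPart (D x) (angle x) i) ∂discMeasure := by
          rw [← integral_const_mul]
          refine integral_congr_ae ?_
          filter_upwards [ae_discMeasure_mem] with x hx
          exact sqrt_mul_polarForm_coveringGrad_add a hN hx.2 (D x)
      _ = 0 := by
          rw [integral_finsetSum _ fun i _ => h.integrable_stress a N i]
          exact Finset.sum_eq_zero fun i _ => h.integral_stress_eq_zero a hN i (hb i)
  rw [integral_add hform hcof, integral_const_mul] at hsum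
  have hweak := weakGrad_coveringMap N b
  rw [integral_congr_ae (hweak.mono fun x hx => by rw [hx] :
      ∀ᵐ x ∂discMeasure, polarForm a (angle x) (weakGrad (coveringMap N b) x) (D x) =
        polarForm a (angle x) (coveringGrad N x) (D x)),
    integral_congr_ae (hweak.mono fun x hx => by rw [hx] :
      ∀ᵐ x ∂discMeasure, Real.log ‖x‖ * frob (cof (weakGrad (coveringMap N b) x)) (D x) =
        Real.log ‖x‖ * frob (cof (coveringGrad N x)) (D x))]
  exact eq_neg_of_add_eq_zero_left hsum

/-! ### The weighted determinant inequality for weak gradients -/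

section DetInequality

variable {ψ : ℕ → Plane → Plane} {D : Plane → Mat}

lemma GradTendsto.tendsto_integral_mul_jacobian (h : GradTendsto ψ D) {w : Plane → ℝ} {C : ℝ}
    (hwm : AEStronglyMeasurable w discMeasure) (hw : ∀ᵐ x ∂discMeasure, |w x| ≤ C) :
    Tendsto (fun n => ∫ x, w x * (radDeriv (fun y => ψ n y 0) x * angDeriv (fun y => ψ n y 1) x -
      angDeriv (fun y => ψ n y 0) x * radDeriv (fun y => ψ n y 1) x) ∂discMeasure) atTop
      (𝓝 (∫ x, w x * (D x).det ∂discMeasure)) := by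
  have hbdd {f : Plane → ℝ} (hf : MemLp f 2 discMeasure) := memLp_bdd_mul hwm hw hf
  have hR := memLp_radPart h.memLp
  have hT := memLp_tanPart h.memLp
  have hRn := h.memLp_radDeriv
  have hTn := h.memLp_angDeriv
  have hRT := tendsto_integral_mul_of_eLpNorm_two (fun n => hbdd (hRn n 0)) (fun n => hTn n 1)
    (hbdd (hR 0)) (hT 1) (tendsto_eLpNorm_mul_bdd hw (h.tendsto_radDeriv 0)) (h.tendsto_angDeriv 1)
  have hTR := tendsto_integral_mul_of_eLpNorm_two (fun n => hbdd (hTn n 0)) (fun n => hRn n 1)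
    (hbdd (hT 0)) (hR 1) (tendsto_eLpNorm_mul_bdd hw (h.tendsto_angDeriv 0)) (h.tendsto_radDeriv 1)
  convert hRT.sub hTR using 2 with n
  · simp only [mul_sub, ← mul_assoc]
    exact integral_sub ((hbdd (hRn n 0)).integrable_mul (hTn n 1))
      ((hbdd (hTn n 0)).integrable_mul (hRn n 1))
  · simp only [fun x => det_eq_radPart_tanPart (D x) (angle x), mul_sub, ← mul_assoc]
    exact integral_sub ((hbdd (hR 0)).integrable_mul (hT 1))
      ((hbdd (hT 0)).integrable_mul (hR 1))

lemma GradTendsto.tendsto_integral_angDeriv_sq (h : GradTendsto ψ D) :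
    Tendsto (fun n => ∫ x, (angDeriv (fun y => ψ n y 0) x ^ 2 +
      angDeriv (fun y => ψ n y 1) x ^ 2) ∂discMeasure) atTop
      (𝓝 (∫ x, ∑ i, tanPart (D x) (angle x) i ^ 2 ∂discMeasure)) := by
  have hT := memLp_tanPart h.memLp
  have hlim (i : Fin 2) := tendsto_integral_mul_of_eLpNorm_two (fun n => h.memLp_angDeriv n i)
    (fun n => h.memLp_angDeriv n i) (hT i) (hT i) (h.tendsto_angDeriv i) (h.tendsto_angDeriv i)
  simp only [← sq] at hlim
  convert (hlim 0).add (hlim 1) using 2 with n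
  · exact integral_add (h.memLp_angDeriv n 0).integrable_sq (h.memLp_angDeriv n 1).integrable_sq
  · rw [← integral_add (hT 0).integrable_sq (hT 1).integrable_sq]
    simp only [Fin.sum_univ_two]

lemma abs_two_mul_integral_mul_det_le {L L' : ℝ → ℝ} (hL : ∀ r, HasDerivAt L (L' r) r)
    (hL' : Continuous L') (hL1 : L 1 = 0) (hL0 : ∀ r ∈ Ioo (0 : ℝ) 1, 0 ≤ L' r)
    (hrL : ∀ r ∈ Ioo (0 : ℝ) 1, r * L' r ≤ 1) (h : GradTendsto ψ D) :
    |2 * ∫ x, L ‖x‖ * (D x).det ∂discMeasure| ≤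
      ∫ x, ∑ i, tanPart (D x) (angle x) i ^ 2 ∂discMeasure := by
  have hLc : Continuous L := continuous_iff_continuousAt.2 fun r => (hL r).continuousAt
  obtain ⟨C, hC⟩ := (isCompact_Icc (a := (0 : ℝ)) (b := 1)).exists_bound_of_continuousOn
    hLc.continuousOn
  have hbound : ∀ᵐ x ∂discMeasure, |L ‖x‖| ≤ C := by
    filter_upwards [ae_discMeasure_mem] with x hx
    exact hC _ (Ioo_subset_Icc_self (norm_mem_Ioo hx))
  have hjac := h.tendsto_integral_mul_jacobian
    (hLc.comp continuous_norm).aestronglyMeasurable hbound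
  exact le_of_tendsto_of_tendsto' (hjac.const_mul 2).abs h.tendsto_integral_angDeriv_sq fun n =>
    abs_two_mul_integral_jacobian_le hL hL' hL1 hL0 hrL (h.contDiff_apply n 0)
      (h.contDiff_apply n 1)

/-- A smooth approximation of the logarithm that vanishes at `1`, as the logarithm does. It is
bounded on `[0, 1]`, which is needed as long as the determinants converge only in `L¹`. -/
def logApprox (ε r : ℝ) : ℝ := 1 / 2 * (Real.log (r ^ 2 + ε) - Real.log (1 + ε))

lemma hasDerivAt_logApprox {ε : ℝ} (hε : 0 < ε) (r : ℝ) :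
    HasDerivAt (logApprox ε) (r / (r ^ 2 + ε)) r := by
  have hne : r ^ 2 + ε ≠ 0 := by positivity
  refine (((((hasDerivAt_pow 2 r).add_const ε).log hne).sub_const
    (Real.log (1 + ε))).const_mul (1 / 2)).congr_deriv ?_
  norm_num
  ring

lemma abs_logApprox_le {ε r : ℝ} (hε : 0 < ε) (hr : r ∈ Ioo (0 : ℝ) 1) :
    |logApprox ε r| ≤ |Real.log r| := by
  have hr0 : 0 < r := hr.1
  have hsq : r ^ 2 ≤ 1 := pow_le_one₀ hr0.le hr.2.le
  have hupper : Real.log (r ^ 2 + ε) ≤ Real.log (1 + ε) :=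
    Real.log_le_log (by positivity) (by linarith)
  have hlower : 2 * Real.log r + Real.log (1 + ε) ≤ Real.log (r ^ 2 + ε) := by
    rw [← Nat.cast_ofNat, ← Real.log_pow, ← Real.log_mul (by positivity) (by positivity)]
    exact Real.log_le_log (by positivity) (by nlinarith)
  rw [abs_of_nonpos (Real.log_nonpos hr0.le hr.2.le), logApprox, abs_of_nonpos (by linarith)]
  linarith

lemma tendsto_logApprox {r : ℝ} (hr : r ≠ 0) :
    Tendsto (fun ε => logApprox ε r) (𝓝 0) (𝓝 (Real.log r)) := by
  have hcont : ContinuousAt (fun ε => logApprox ε r) 0 := by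
    unfold logApprox
    fun_prop (disch := simp [hr])
  simpa [ContinuousAt, logApprox, Real.log_pow] using hcont

theorem abs_two_mul_integral_log_mul_det_le (h : GradTendsto ψ D)
    (hdet : MemLp (fun x => (D x).det) 2 discMeasure) :
    |2 * ∫ x, Real.log ‖x‖ * (D x).det ∂discMeasure| ≤
      ∫ x, ∑ i, tanPart (D x) (angle x) i ^ 2 ∂discMeasure := by
  have hlim : Tendsto (fun ε => ∫ x, logApprox ε ‖x‖ * (D x).det ∂discMeasure) (𝓝[>] 0)
      (𝓝 (∫ x, Real.log ‖x‖ * (D x).det ∂discMeasure)) := by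
    refine tendsto_integral_filter_of_dominated_convergence
      (fun x => ‖Real.log ‖x‖ * (D x).det‖) ?_ ?_ (integrable_log_norm_mul hdet).norm ?_
    · filter_upwards with ε
      have hm : Measurable fun x : Plane => logApprox ε ‖x‖ := by
        unfold logApprox
        fun_prop
      exact hm.aestronglyMeasurable.mul hdet.1
    · filter_upwards [self_mem_nhdsWithin] with ε hε
      filter_upwards [ae_discMeasure_mem] with x hx
      rw [norm_mul, norm_mul]
      exact mul_le_mul_of_nonneg_right (abs_logApprox_le hε (norm_mem_Ioo hx)) (norm_nonneg _)
    · filter_upwards [ae_discMeasure_mem] with x hx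
      exact ((tendsto_logApprox (norm_ne_zero_iff.2 hx.2)).mono_left nhdsWithin_le_nhds).mul_const _
  refine le_of_tendsto (hlim.const_mul 2).abs ?_
  filter_upwards [self_mem_nhdsWithin] with ε (hε : 0 < ε)
  refine abs_two_mul_integral_mul_det_le (hasDerivAt_logApprox hε)
    (continuous_id.div (by fun_prop) fun r => by positivity) (by simp [logApprox])
    (fun r hr => div_nonneg hr.1.le (by positivity)) (fun r _ => ?_) h
  rw [← mul_div_assoc, div_le_one (by positivity)]
  nlinarith

end DetInequality

lemma integral_polarForm_add_smul (a : ℝ) {U H : Plane → Mat}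
    (hU : ∀ i j, MemLp (fun x => U x i j) 2 discMeasure)
    (hH : ∀ i j, MemLp (fun x => H x i j) 2 discMeasure) (t : ℝ) :
    ∫ x, polarForm a (angle x) (U x + t • H x) (U x + t • H x) ∂discMeasure =
      ∫ x, polarForm a (angle x) (U x) (U x) ∂discMeasure +
        t * (2 * ∫ x, polarForm a (angle x) (U x) (H x) ∂discMeasure) +
        t ^ 2 * ∫ x, polarForm a (angle x) (H x) (H x) ∂discMeasure := by
  simp only [polarForm_add_smul]
  have hUU := integrable_polarForm a hU hU
  have hUH := ((integrable_polarForm a hU hH).const_mul 2).const_mul t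
  have hHH := (integrable_polarForm a hH hH).const_mul (t ^ 2)
  rw [integral_add (hUU.fun_add hUH) hHH, integral_add hUU hUH, integral_const_mul,
    integral_const_mul, integral_const_mul]

lemma energy_eq_integral_polarForm (ν a : ℝ) (u : Plane → Plane) :
    energy (integrand ν a) u =
      ν * ∫ x, polarForm a (angle x) (weakGrad u x) (weakGrad u x) ∂discMeasure := by
  rw [energy, ← integral_const_mul]
  simp only [integrand_eq_polarForm]

lemma IsTest.eR_eq_zero {φ : Plane → Plane} (hφ : IsTest φ) (θ : ℝ) : φ (eR θ) = 0 :=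
  hφ.eq_zero fun h => by
    rw [disc, mem_ball_zero_iff, norm_eR] at h
    exact lt_irrefl _ h

lemma energy_coveringMap_add_smul (ν a : ℝ) {N : ℕ} (hN : N ≠ 0) (b : Plane)
    {η : Plane → Plane} (hη : MapMemW012 η)
    (hcof : ∀ᵐ x ∂discMeasure, frob (cof (weakGrad (coveringMap N b) x)) (weakGrad η x) = 0)
    (t : ℝ) :
    energy (integrand ν a) (fun x => coveringMap N b x + t • η x) =
      energy (integrand ν a) (coveringMap N b) + t ^ 2 * energy (integrand ν a) η := by
  obtain ⟨hη, φ, hφ, -, hφη⟩ := hη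
  have hU := mapMemW12_coveringMap N b
  have hEL := integral_polarForm_coveringMap a hN b
    (⟨fun n => (hφ n).1, hη.memLp_weakGrad, hφη⟩ : GradTendsto φ (weakGrad η))
    fun i => by simp [(hφ _).eR_eq_zero]
  have hpressure : ∫ x, Real.log ‖x‖ *
      frob (cof (weakGrad (coveringMap N b) x)) (weakGrad η x) ∂discMeasure = 0 := by
    refine integral_eq_zero_of_ae ?_
    filter_upwards [hcof] with x hx
    rw [hx, mul_zero, Pi.zero_apply]
  have hgrad : ∫ x, polarForm a (angle x) (weakGrad (fun y => coveringMap N b y + t • η y) x)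
        (weakGrad (fun y => coveringMap N b y + t • η y) x) ∂discMeasure =
      ∫ x, polarForm a (angle x) (weakGrad (coveringMap N b) x + t • weakGrad η x)
        (weakGrad (coveringMap N b) x + t • weakGrad η x) ∂discMeasure := by
    refine integral_congr_ae ?_
    filter_upwards [(hU.hasWeakGrad.add_smul hη.hasWeakGrad t).weakGrad_ae_eq] with x hx
    rw [hx]
  simp only [energy_eq_integral_polarForm]
  rw [hgrad, integral_polarForm_add_smul a hU.memLp_weakGrad hη.memLp_weakGrad t, hEL, hpressure]
  ring

theorem isStationaryPoint_coveringMap (ν a : ℝ) {N : ℕ} (hN : N ≠ 0) (b : Plane) :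
    IsStationaryPoint (integrand ν a) (coveringMap N b) := by
  intro η hη hcof
  simp only [energy_coveringMap_add_smul ν a hN b hη hcof]
  simpa using ((hasDerivAt_pow 2 (0 : ℝ)).mul_const (energy (integrand ν a) η)).const_add
    (energy (integrand ν a) (coveringMap N b))

theorem isPressure_log (ν a : ℝ) {N : ℕ} (hN : N ≠ 0) (b : Plane) :
    IsPressure (fun x => ν • coeff a x) (coveringMap N b)
      (fun x => ν * (((N : ℝ) ^ 2 - a) / N) * Real.log ‖x‖) := by
  intro η hη
  have hEL := integral_polarForm_coveringMap a hN b (gradTendsto_const hη.1)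
    fun i => by simp [hη.eR_eq_zero]
  simp only [Tensor.smul_act, frob_smul_left, frob_coeff_act, mul_assoc]
  rw [integral_const_mul, hEL, integral_const_mul, integral_const_mul]
  ring

lemma contDiffOn_log_norm : ContDiffOn ℝ ∞ (fun x : Plane => Real.log ‖x‖) {0}ᶜ := fun _ hx =>
  ((contDiffAt_norm ℝ hx).log (norm_ne_zero_iff.2 hx)).contDiffWithinAt

lemma norm_partialDeriv_log_norm_le (j : Fin 2) {x : Plane} (hx : x ≠ 0) :
    ‖partialDeriv j (fun x : Plane => Real.log ‖x‖) x‖ ≤ 1 * ‖x‖ ^ (-1 : ℝ) := by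
  have hnorm : DifferentiableAt ℝ (fun x : Plane => ‖x‖) x :=
    (contDiffAt_norm (n := 1) ℝ hx).differentiableAt one_ne_zero
  have hlip : ‖fderiv ℝ (fun x : Plane => ‖x‖) x‖ ≤ 1 := by
    simpa using norm_fderiv_le_of_lipschitz ℝ (lipschitzWith_one_norm (E := Plane)) (x₀ := x)
  calc ‖partialDeriv j (fun x : Plane => Real.log ‖x‖) x‖
      ≤ ‖fderiv ℝ (fun x : Plane => Real.log ‖x‖) x‖ := abs_partialDeriv_le_norm_fderiv j _ x
    _ = ‖x‖⁻¹ * ‖fderiv ℝ (fun x : Plane => ‖x‖) x‖ := by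
        rw [(hnorm.hasFDerivAt.log (norm_ne_zero_iff.2 hx)).fderiv, norm_smul, norm_inv, norm_norm]
    _ ≤ ‖x‖⁻¹ * 1 := by gcongr
    _ = 1 * ‖x‖ ^ (-1 : ℝ) := by rw [Real.rpow_neg_one, mul_comm]

lemma memLp_partialDeriv_log_norm (j : Fin 2) {q : ℝ≥0∞} (hq0 : q ≠ 0) (hq : q < 2) :
    MemLp (partialDeriv j fun x : Plane => Real.log ‖x‖) q discMeasure := by
  refine memLp_of_norm_le_rpow hq0 hq.ne_top ?_ (aestronglyMeasurable_of_continuousOn_compl_zero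
    (continuousOn_partialDeriv contDiffOn_log_norm j))
    fun _ hx => norm_partialDeriv_log_norm_le j hx
  rw [neg_neg, one_mul]
  exact (ENNReal.toReal_lt_toReal hq.ne_top ENNReal.ofNat_ne_top).2 hq

lemma memLp_log_norm_div_norm : MemLp (fun x : Plane => Real.log ‖x‖ / ‖x‖) 1 discMeasure := by
  have hm : Measurable fun x : Plane => Real.log ‖x‖ / ‖x‖ := by fun_prop
  refine ((memLp_norm_rpow_neg (s := 3 / 2) one_ne_zero ENNReal.one_ne_top
    (by norm_num)).const_mul (1 / 2)⁻¹).mono' hm.aestronglyMeasurable ?_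
  filter_upwards [ae_discMeasure_mem] with x hx
  obtain ⟨hpos, hlt⟩ := norm_mem_Ioo hx
  have hexp : ‖x‖ ^ (-(3 / 2) : ℝ) * ‖x‖ = ‖x‖ ^ (-(1 / 2) : ℝ) := by
    rw [← Real.rpow_add_one hpos.ne']
    norm_num
  rw [norm_div, norm_norm, Real.norm_eq_abs, div_le_iff₀ hpos, mul_assoc, hexp]
  exact abs_log_le_inv_mul_rpow_neg hpos hlt.le (by norm_num)

lemma hasWeakPartial_log_norm (j : Fin 2) :
    HasWeakPartial j (fun x : Plane => Real.log ‖x‖)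
      (partialDeriv j fun x : Plane => Real.log ‖x‖) :=
  hasWeakPartial_of_contDiffOn contDiffOn_log_norm memLp_log_norm_div_norm
    (memLp_partialDeriv_log_norm j one_ne_zero (by norm_num))

theorem memW1_const_mul_log_norm (c : ℝ) {q : ℝ≥0∞} (hq1 : 1 ≤ q) (hq : q < 2) :
    MemW1 q fun x : Plane => c * Real.log ‖x‖ := by
  have hq0 : q ≠ 0 := (zero_lt_one.trans_le hq1).ne'
  refine ⟨(memLp_log_norm hq0 hq.ne_top).const_mul c, fun j => ⟨_, ?_,
    (memLp_partialDeriv_log_norm j hq0 hq).const_mul c⟩⟩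
  have hzero := hasWeakPartial_of_contDiff (contDiff_const (c := (0 : ℝ)) (𝕜 := ℝ) (E := Plane)
    (n := ∞)) j
  simpa [partialDeriv] using hzero.add_const_mul (hasWeakPartial_log_norm j) c

/-! ### Minimality and uniqueness -/

/-- The smooth maps `ψ n` converge in `W^{1,2}` of the disc to the map `w` with gradient `D`, and
their boundary values converge to `0` in `L²` of the circle. -/
structure ZeroTraceTendsto (ψ : ℕ → Plane → Plane) (w : Plane → Plane) (D : Plane → Mat) : Prop
    extends GradTendsto ψ D where
  memLp_apply : ∀ i, MemLp (fun x => w x i) 2 discMeasure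
  tendsto_apply : ∀ i, Tendsto (fun n => eLpNorm (fun x => ψ n x i - w x i) 2 discMeasure)
    atTop (𝓝 0)
  tendsto_circle : Tendsto (fun n => eLpNorm (fun θ => ψ n (eR θ)) 2
    (volume.restrict (Ioc 0 (2 * Real.pi)))) atTop (𝓝 0)

lemma intervalIntegral_neg_pi_pi_eq {F : ℝ → ℝ} (hF : Function.Periodic F (2 * Real.pi)) :
    ∫ θ in -Real.pi..Real.pi, F θ = ∫ θ in Ioc 0 (2 * Real.pi), F θ := by
  have h := hF.intervalIntegral_add_eq (-Real.pi) 0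
  rw [show -Real.pi + 2 * Real.pi = Real.pi by ring, zero_add] at h
  rw [h, intervalIntegral.integral_of_le (by linarith [pi_pos])]

namespace ZeroTraceTendsto

variable {ψ : ℕ → Plane → Plane} {w : Plane → Plane} {D : Plane → Mat}
  (h : ZeroTraceTendsto ψ w D)

include h

lemma memLp_circle (n : ℕ) (i : Fin 2) :
    MemLp (fun θ => ψ n (eR θ) i) 2 (volume.restrict (Ioc 0 (2 * Real.pi))) :=
  memLp_restrict_Ioc_of_continuous ((h.contDiff_apply n i).continuous.comp continuous_eR) _ _ _

lemma tendsto_circle_apply (i : Fin 2) :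
    Tendsto (fun n => eLpNorm (fun θ => ψ n (eR θ) i - 0) 2
      (volume.restrict (Ioc 0 (2 * Real.pi)))) atTop (𝓝 0) := by
  simpa only [sub_zero] using tendsto_eLpNorm_apply h.tendsto_circle i

lemma tendsto_integral_eR_mul (N : ℕ) (i : Fin 2) :
    Tendsto (fun n => ∫ θ in -Real.pi..Real.pi, eR (N * θ) i * ψ n (eR θ) i) atTop (𝓝 0) := by
  have hw : MemLp (fun θ => eR (N * θ) i) 2 (volume.restrict (Ioc 0 (2 * Real.pi))) :=
    memLp_restrict_Ioc_of_continuous (by fun_prop) _ _ _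
  have hlim := tendsto_integral_mul_of_eLpNorm_two (fun _ => hw) (fun n => h.memLp_circle n i) hw
    MemLp.zero' (by simp) (h.tendsto_circle_apply i)
  simp only [mul_zero, integral_zero] at hlim
  refine hlim.congr fun n => (intervalIntegral_neg_pi_pi_eq fun θ => ?_).symm
  rw [eR_nat_mul_congr N (eR_add_two_pi θ), eR_add_two_pi]

lemma tendsto_integral_circle_sq (i : Fin 2) :
    Tendsto (fun n => ∫ θ in -Real.pi..Real.pi, ψ n (eR θ) i ^ 2) atTop (𝓝 0) := by
  have hlim := tendsto_integral_mul_of_eLpNorm_two (fun n => h.memLp_circle n i)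
    (fun n => h.memLp_circle n i) MemLp.zero' MemLp.zero' (h.tendsto_circle_apply i)
    (h.tendsto_circle_apply i)
  simp only [mul_zero, integral_zero] at hlim
  simp only [← sq] at hlim
  refine hlim.congr fun n => (intervalIntegral_neg_pi_pi_eq fun θ => ?_).symm
  rw [eR_add_two_pi]

lemma integral_sq_le_integral_radPart_sq (i : Fin 2) :
    ∫ x, w x i ^ 2 ∂discMeasure ≤ ∫ x, radPart (D x) (angle x) i ^ 2 ∂discMeasure := by
  have hψ n := memLp_disc_of_continuous (h.contDiff_apply n i).continuous 2
  have hR := memLp_radPart h.memLp i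
  have hleft := tendsto_integral_mul_of_eLpNorm_two hψ hψ (h.memLp_apply i) (h.memLp_apply i)
    (h.tendsto_apply i) (h.tendsto_apply i)
  have hright := tendsto_integral_mul_of_eLpNorm_two (fun n => h.memLp_radDeriv n i)
    (fun n => h.memLp_radDeriv n i) hR hR (h.tendsto_radDeriv i) (h.tendsto_radDeriv i)
  simp only [← sq] at hleft hright
  have hsum := (h.tendsto_integral_circle_sq i).add hright
  rw [zero_add] at hsum
  exact le_of_tendsto_of_tendsto' hleft hsum fun n => integral_sq_le (h.contDiff_apply n i)

lemma ae_eq_zero_of_integral_radPart_sq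
    (h0 : ∫ x, ∑ i, radPart (D x) (angle x) i ^ 2 ∂discMeasure = 0) : w =ᵐ[discMeasure] 0 := by
  have hR i := (memLp_radPart h.memLp i).integrable_sq
  have hw : ∀ i, ∀ᵐ x ∂discMeasure, w x i = 0 := by
    intro i
    have hle : ∫ x, radPart (D x) (angle x) i ^ 2 ∂discMeasure ≤ 0 := by
      refine h0 ▸ integral_mono (hR i) (integrable_finsetSum _ fun i _ => hR i) fun x => ?_
      exact Finset.single_le_sum (f := fun i => radPart (D x) (angle x) i ^ 2)
        (fun i _ => sq_nonneg _) (Finset.mem_univ i)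
    have hzero : ∫ x, w x i ^ 2 ∂discMeasure = 0 :=
      le_antisymm ((h.integral_sq_le_integral_radPart_sq i).trans hle)
        (integral_nonneg fun x => sq_nonneg _)
    rw [integral_eq_zero_iff_of_nonneg (fun x => sq_nonneg _) (h.memLp_apply i).integrable_sq]
      at hzero
    filter_upwards [hzero] with x hx using pow_eq_zero_iff two_ne_zero |>.1 hx
  filter_upwards [ae_all_iff.2 hw] with x hx
  ext i
  exact hx i

end ZeroTraceTendsto

section Difference

variable {α β : ℕ → Plane → Plane} {u v : Plane → Plane} {h : ℝ → Plane}

lemma gradTendsto_sub (hu : MapMemW12 u) (hv : MapMemW12 v) (hα : ∀ n, ContDiff ℝ ∞ (α n))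
    (hβ : ∀ n, ContDiff ℝ ∞ (β n)) (hαu : TendstoW12 α u) (hβv : TendstoW12 β v) :
    GradTendsto (fun n x => β n x - α n x) fun x => weakGrad v x - weakGrad u x where
  contDiff n := (hβ n).sub (hα n)
  memLp i j := (hv.memLp_weakGrad i j).sub (hu.memLp_weakGrad i j)
  tendsto i j := by
    refine (tendsto_eLpNorm_sub one_le_two
      (fun n => (memLp_jac (hβ n) i j 2).1.sub (hv.memLp_weakGrad i j).1)
      (fun n => (memLp_jac (hα n) i j 2).1.sub (hu.memLp_weakGrad i j).1)
      (hβv.2 i j) (hαu.2 i j)).congr fun n => ?_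
    congr 1 with x
    have hjac : jac (fun x => β n x - α n x) x i j = jac (β n) x i j - jac (α n) x i j := by
      simp only [jac, Matrix.of_apply]
      rw [fderiv_fun_sub ((hβ n).differentiable (by simp) x) ((hα n).differentiable (by simp) x)]
      rfl
    rw [hjac]
    exact sub_sub_sub_comm _ _ _ _

lemma tendsto_eLpNorm_sub_apply (hu : MapMemW12 u) (hv : MapMemW12 v)
    (hα : ∀ n, ContDiff ℝ ∞ (α n)) (hβ : ∀ n, ContDiff ℝ ∞ (β n)) (hαu : TendstoW12 α u)
    (hβv : TendstoW12 β v) (i : Fin 2) :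
    Tendsto (fun n => eLpNorm (fun x => (β n x - α n x) i - (v x - u x) i) 2 discMeasure)
      atTop (𝓝 0) := by
  have hm {φ : Plane → Plane} (hφ : ContDiff ℝ ∞ φ) :
      AEStronglyMeasurable (fun x => φ x i) discMeasure :=
    (contDiff_euclidean.1 hφ i).continuous.aestronglyMeasurable
  refine (tendsto_eLpNorm_sub one_le_two
    (fun n => (hm (hβ n)).sub (hv i).1.1) (fun n => (hm (hα n)).sub (hu i).1.1)
    (tendsto_eLpNorm_apply hβv.1 i) (tendsto_eLpNorm_apply hαu.1 i)).congr fun n => ?_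
  congr 1 with x
  exact sub_sub_sub_comm _ _ _ _

lemma tendsto_eLpNorm_circle_sub (hh : Continuous h) (hα : ∀ n, ContDiff ℝ ∞ (α n))
    (hβ : ∀ n, ContDiff ℝ ∞ (β n))
    (hαh : Tendsto (fun n => eLpNorm (fun θ => α n (eR θ) - h θ) 2
      (volume.restrict (Ioc 0 (2 * Real.pi)))) atTop (𝓝 0))
    (hβh : Tendsto (fun n => eLpNorm (fun θ => β n (eR θ) - h θ) 2
      (volume.restrict (Ioc 0 (2 * Real.pi)))) atTop (𝓝 0)) :
    Tendsto (fun n => eLpNorm (fun θ => β n (eR θ) - α n (eR θ)) 2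
      (volume.restrict (Ioc 0 (2 * Real.pi)))) atTop (𝓝 0) := by
  have hm {φ : Plane → Plane} (hφ : ContDiff ℝ ∞ φ) : AEStronglyMeasurable
      (fun θ => φ (eR θ) - h θ) (volume.restrict (Ioc 0 (2 * Real.pi))) :=
    ((hφ.continuous.comp continuous_eR).sub hh).aestronglyMeasurable
  refine (tendsto_eLpNorm_sub one_le_two (fun n => hm (hβ n)) (fun n => hm (hα n)) hβh hαh).congr
    fun n => ?_
  congr 1 with θ : 1
  exact sub_sub_sub_cancel_right _ _ _

lemma exists_zeroTraceTendsto_sub (hh : Continuous h) (hu : MapMemW12 u) (hv : MapMemW12 v)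
    (hut : HasTrace u h) (hvt : HasTrace v h) :
    ∃ ψ, ZeroTraceTendsto ψ (fun x => v x - u x) fun x => weakGrad v x - weakGrad u x := by
  obtain ⟨α, hα, hαu, hαh⟩ := hut
  obtain ⟨β, hβ, hβv, hβh⟩ := hvt
  exact ⟨_, gradTendsto_sub hu hv hα hβ hαu hβv, fun i => (hv i).1.sub (hu i).1,
    tendsto_eLpNorm_sub_apply hu hv hα hβ hαu hβv, tendsto_eLpNorm_circle_sub hh hα hβ hαh hβh⟩

end Difference

lemma continuous_boundaryData (N : ℕ) (b : Plane) : Continuous (boundaryData N b) := by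
  unfold boundaryData
  fun_prop

/-- The gradient of the difference of `v` and the covering map. -/
def gradDiff (N : ℕ) (b : Plane) (v : Plane → Plane) (x : Plane) : Mat :=
  weakGrad v x - weakGrad (coveringMap N b) x

lemma integral_polarForm_self (a : ℝ) {D : Plane → Mat}
    (hD : ∀ i j, MemLp (fun x => D x i j) 2 discMeasure) :
    ∫ x, polarForm a (angle x) (D x) (D x) ∂discMeasure =
      a * ∫ x, ∑ i, radPart (D x) (angle x) i ^ 2 ∂discMeasure +
        ∫ x, ∑ i, tanPart (D x) (angle x) i ^ 2 ∂discMeasure := by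
  have hR : Integrable (fun x => ∑ i, radPart (D x) (angle x) i ^ 2) discMeasure :=
    integrable_finsetSum _ fun i _ => (memLp_radPart hD i).integrable_sq
  have hT : Integrable (fun x => ∑ i, tanPart (D x) (angle x) i ^ 2) discMeasure :=
    integrable_finsetSum _ fun i _ => (memLp_tanPart hD i).integrable_sq
  rw [← integral_const_mul, ← integral_add (hR.const_mul a) hT]
  congr 1 with x
  simp only [polarForm, Fin.sum_univ_two]
  ring

section Competitor

variable {N : ℕ} {b : Plane} {v : Plane → Plane}

lemma exists_zeroTraceTendsto_gradDiff (hN : N ≠ 0) (hv : v ∈ Admissible (boundaryData N b)) :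
    ∃ ψ, ZeroTraceTendsto ψ (fun x => v x - coveringMap N b x) (gradDiff N b v) :=
  exists_zeroTraceTendsto_sub (continuous_boundaryData N b) (mapMemW12_coveringMap N b) hv.1
    (coveringMap_mem_admissible hN b).2.2 hv.2.2

lemma frob_cof_gradDiff (hN : N ≠ 0) (hv : v ∈ Admissible (boundaryData N b)) :
    ∀ᵐ x ∂discMeasure, frob (cof (weakGrad (coveringMap N b) x)) (gradDiff N b v x) =
      -(gradDiff N b v x).det := by
  filter_upwards [hv.2.1, (coveringMap_mem_admissible hN b).2.1] with x hdet_v hdet_u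
  have h := det_add_eq_add_frob_cof (weakGrad (coveringMap N b) x) (gradDiff N b v x)
  rw [gradDiff, add_sub_cancel, hdet_v, hdet_u] at h
  rw [gradDiff]
  linarith

lemma memLp_det_gradDiff (hN : N ≠ 0) (hv : v ∈ Admissible (boundaryData N b)) :
    MemLp (fun x => (gradDiff N b v x).det) 2 discMeasure := by
  obtain ⟨ψ, hψ⟩ := exists_zeroTraceTendsto_gradDiff hN hv
  refine (memLp_frob_cof (fun i j => memLp_coveringGrad N i j ⊤) hψ.memLp).neg.ae_eq ?_
  filter_upwards [frob_cof_gradDiff hN hv, weakGrad_coveringMap N b] with x hcof hgrad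
  rw [Pi.neg_apply, ← hgrad, hcof, neg_neg]

theorem energy_eq_energy_coveringMap_add (ν a : ℝ) (hN : N ≠ 0)
    (hv : v ∈ Admissible (boundaryData N b)) :
    energy (integrand ν a) v = energy (integrand ν a) (coveringMap N b) +
      ν * (a * ∫ x, ∑ i, radPart (gradDiff N b v x) (angle x) i ^ 2 ∂discMeasure +
        ∫ x, ∑ i, tanPart (gradDiff N b v x) (angle x) i ^ 2 ∂discMeasure +
        ((N : ℝ) ^ 2 - a) / N *
          (2 * ∫ x, Real.log ‖x‖ * (gradDiff N b v x).det ∂discMeasure)) := by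
  obtain ⟨ψ, hψ⟩ := exists_zeroTraceTendsto_gradDiff hN hv
  have hEL := integral_polarForm_coveringMap a hN b hψ.toGradTendsto
    (hψ.tendsto_integral_eR_mul N)
  have hdet : ∫ x, Real.log ‖x‖ * frob (cof (weakGrad (coveringMap N b) x)) (gradDiff N b v x)
      ∂discMeasure = -∫ x, Real.log ‖x‖ * (gradDiff N b v x).det ∂discMeasure := by
    rw [← integral_neg]
    refine integral_congr_ae ?_
    filter_upwards [frob_cof_gradDiff hN hv] with x hx
    rw [hx, mul_neg]
  have hexpand := integral_polarForm_add_smul a (mapMemW12_coveringMap N b).memLp_weakGrad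
    hψ.memLp 1
  have hadd (x : Plane) : weakGrad (coveringMap N b) x + gradDiff N b v x = weakGrad v x :=
    add_sub_cancel _ _
  simp only [one_smul, hadd] at hexpand
  rw [energy_eq_integral_polarForm, energy_eq_integral_polarForm, hexpand, hEL, hdet,
    integral_polarForm_self a hψ.memLp]
  ring

theorem energy_coveringMap_add_le {ν a : ℝ} (hν : 0 ≤ ν) (hN : N ≠ 0)
    (ha : |(N : ℝ) ^ 2 - a| ≤ N) (hv : v ∈ Admissible (boundaryData N b)) :
    energy (integrand ν a) (coveringMap N b) +
        ν * (a * ∫ x, ∑ i, radPart (gradDiff N b v x) (angle x) i ^ 2 ∂discMeasure) ≤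
      energy (integrand ν a) v := by
  obtain ⟨ψ, hψ⟩ := exists_zeroTraceTendsto_gradDiff hN hv
  have hlog := abs_two_mul_integral_log_mul_det_le hψ.toGradTendsto (memLp_det_gradDiff hN hv)
  have hcoeff : |((N : ℝ) ^ 2 - a) / N| ≤ 1 := by
    rw [abs_div, Nat.abs_cast]
    exact div_le_one_of_le₀ ha (Nat.cast_nonneg N)
  have habsorb := neg_le_of_abs_le <| (abs_mul _ _).trans_le <|
    (mul_le_of_le_one_left (abs_nonneg _) hcoeff).trans hlog
  rw [energy_eq_energy_coveringMap_add ν a hN hv]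
  gcongr
  linarith

lemma integral_radPart_sq_nonneg (D : Plane → Mat) :
    0 ≤ ∫ x, ∑ i, radPart (D x) (angle x) i ^ 2 ∂discMeasure :=
  integral_nonneg fun _ => Finset.sum_nonneg fun _ _ => sq_nonneg _

theorem energy_coveringMap_le {ν a : ℝ} (hν : 0 ≤ ν) (ha0 : 0 ≤ a) (hN : N ≠ 0)
    (ha : |(N : ℝ) ^ 2 - a| ≤ N) (hv : v ∈ Admissible (boundaryData N b)) :
    energy (integrand ν a) (coveringMap N b) ≤ energy (integrand ν a) v :=
  (le_add_of_nonneg_right (mul_nonneg hν (mul_nonneg ha0 (integral_radPart_sq_nonneg _)))).trans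
    (energy_coveringMap_add_le hν hN ha hv)

theorem ae_eq_coveringMap_of_energy_eq {ν a : ℝ} (hν : 0 < ν) (ha0 : 0 < a) (hN : N ≠ 0)
    (ha : |(N : ℝ) ^ 2 - a| ≤ N) (hv : v ∈ Admissible (boundaryData N b))
    (hE : energy (integrand ν a) v = energy (integrand ν a) (coveringMap N b)) :
    v =ᵐ[discMeasure] coveringMap N b := by
  obtain ⟨ψ, hψ⟩ := exists_zeroTraceTendsto_gradDiff hN hv
  have hexcess := energy_coveringMap_add_le hν.le hN ha hv
  rw [hE, add_le_iff_nonpos_right, ← mul_assoc] at hexcess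
  have hrad := le_antisymm (nonpos_of_mul_nonpos_right hexcess (mul_pos hν ha0))
    (integral_radPart_sq_nonneg _)
  filter_upwards [hψ.ae_eq_zero_of_integral_radPart_sq hrad] with x hx using sub_eq_zero.1 hx

end Competitor

end IncompressibleDisc

end

theorem mainTheorem10_general (ν : ℝ) (hν : 0 < ν) (b : Plane) (N : ℕ) (hN : 2 ≤ N) (a : ℝ)
    (ha : a ∈ Icc ((N : ℝ) ^ 2 - N) ((N : ℝ) ^ 2 + N)) :
    ((∀ i j k l, MemLp (fun x => coeff a x i j k l) ⊤ discMeasure) ∧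
      (∀ x ∈ disc \ {0}, ∀ ξ : Mat,
        integrand ν a x ξ = ν * frob ((coeff a x).act ξ) ξ ∧
        ν * frob ξ ξ ≤ ν * frob ((coeff a x).act ξ) ξ)) ∧
    ((¬ ∃ L : Tensor, Tendsto (coeff a) (𝓝[≠] 0) (𝓝 L)) ∧
      (∀ ξ : Mat, ¬ IsConformalMat ξ →
        ¬ ∃ l : ℝ, Tendsto (fun x => integrand ν a x ξ) (𝓝[≠] 0) (𝓝 l))) ∧
    (((∀ q : ℝ≥0∞, 1 ≤ q → q < 2 → TensorMemW1 q (coeff a)) ∧ ¬ TensorMemW1 2 (coeff a)) ∧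
      (∀ ξ : Mat, ¬ IsConformalMat ξ →
        (∀ q : ℝ≥0∞, 1 ≤ q → q < 2 → MemW1 q fun x => integrand ν a x ξ) ∧
        ¬ MemW1 2 fun x => integrand ν a x ξ)) ∧
    ((∃ K, LipschitzOnWith K (coveringMap N b) disc) ∧
      ¬ ContDiffOn ℝ 1 (coveringMap N b) disc ∧
      IsStationaryPoint (integrand ν a) (coveringMap N b) ∧
      ∃ p : Plane → ℝ, (∀ q : ℝ≥0∞, 1 ≤ q → q < 2 → MemW1 q p) ∧
        IsPressure (fun x => ν • coeff a x) (coveringMap N b) p) ∧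
    (coveringMap N b ∈ Admissible (boundaryData N b) ∧
      (∀ v ∈ Admissible (boundaryData N b),
        energy (integrand ν a) (coveringMap N b) ≤ energy (integrand ν a) v) ∧
      (∀ v ∈ Admissible (boundaryData N b),
        energy (integrand ν a) v = energy (integrand ν a) (coveringMap N b) →
          v =ᵐ[discMeasure] coveringMap N b)) ∧
    IsLeast (energy (integrand ν a) '' Admissible (boundaryData N b))
      (ν * Real.pi * (a / N + N)) := by
  have hN2 : (2 : ℝ) ≤ N := by exact_mod_cast hN
  have hN0 : N ≠ 0 := by omega
  have ha1 : 1 < a := by nlinarith [ha.1]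
  have haN : |(N : ℝ) ^ 2 - a| ≤ N := abs_le.2 ⟨by linarith [ha.2], by linarith [ha.1]⟩
  have hadm := coveringMap_mem_admissible hN0 b
  have hmin v (hv : v ∈ Admissible (boundaryData N b)) :=
    energy_coveringMap_le hν.le (by linarith : 0 ≤ a) hN0 haN hv
  refine ⟨⟨coeff_memLp_top a, fun x _ ξ => ⟨integrand_eq_frob_coeff_act ν a x ξ,
      mul_le_mul_of_nonneg_left (frob_self_le_frob_coeff_act ha1.le x ξ) hν.le⟩⟩,
    ⟨coeff_not_tendsto ha1.ne', fun ξ => integrand_not_tendsto hν.ne' ha1.ne'⟩,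
    ⟨⟨fun _ => coeff_memW1 a, coeff_not_memW1 ha1.ne'⟩, fun ξ hξ =>
      ⟨fun _ => integrand_memW1 ν a ξ, integrand_not_memW1 hν.ne' ha1.ne' hξ⟩⟩,
    ⟨⟨_, (lipschitzWith_coveringMap N b).lipschitzOnWith⟩, not_contDiffOn_coveringMap hN b,
      isStationaryPoint_coveringMap ν a hN0 b, _, fun _ => memW1_const_mul_log_norm _,
      isPressure_log ν a hN0 b⟩,
    ⟨hadm, hmin, fun _ => ae_eq_coveringMap_of_energy_eq hν (by linarith) hN0 haN⟩, ?_⟩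
  rw [← energy_coveringMap ν a N b]
  exact ⟨⟨_, hadm, rfl⟩, forall_mem_image.2 hmin⟩

theorem mainTheorem10 (ν : ℝ) (hν : 0 < ν) (b : Plane) (N : ℕ) (hN : 2 ≤ N) (a : ℝ)
    (ha : a ∈ Ioo ((N : ℝ) ^ 2 - N) ((N : ℝ) ^ 2 + N)) :
    -- (i) the integrand is given by a bounded, uniformly positive coefficient tensor
    ((∀ i j k l, MemLp (fun x => coeff a x i j k l) ⊤ discMeasure) ∧
      (∀ x ∈ disc \ {0}, ∀ ξ : Mat,
        integrand ν a x ξ = ν * frob ((coeff a x).act ξ) ξ ∧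
        ν * frob ξ ξ ≤ ν * frob ((coeff a x).act ξ) ξ)) ∧
    -- (ii) the coefficients and the integrand are discontinuous at the origin
    ((¬ ∃ L : Tensor, Tendsto (coeff a) (𝓝[≠] 0) (𝓝 L)) ∧
      (∀ ξ : Mat, ¬ IsConformalMat ξ →
        ¬ ∃ l : ℝ, Tendsto (fun x => integrand ν a x ξ) (𝓝[≠] 0) (𝓝 l))) ∧
    -- (iii) the Sobolev regularity of the coefficients and of the integrand
    (((∀ q : ℝ≥0∞, 1 ≤ q → q < 2 → TensorMemW1 q (coeff a)) ∧ ¬ TensorMemW1 2 (coeff a)) ∧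
      (∀ ξ : Mat, ¬ IsConformalMat ξ →
        (∀ q : ℝ≥0∞, 1 ≤ q → q < 2 → MemW1 q fun x => integrand ν a x ξ) ∧
        ¬ MemW1 2 fun x => integrand ν a x ξ)) ∧
    -- (iv) the covering map is Lipschitz, not continuously differentiable, and stationary
    ((∃ K, LipschitzOnWith K (coveringMap N b) disc) ∧
      ¬ ContDiffOn ℝ 1 (coveringMap N b) disc ∧
      IsStationaryPoint (integrand ν a) (coveringMap N b) ∧
      ∃ p : Plane → ℝ, (∀ q : ℝ≥0∞, 1 ≤ q → q < 2 → MemW1 q p) ∧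
        IsPressure (fun x => ν • coeff a x) (coveringMap N b) p) ∧
    -- (v) the covering map is the unique global minimizer
    (coveringMap N b ∈ Admissible (boundaryData N b) ∧
      (∀ v ∈ Admissible (boundaryData N b),
        energy (integrand ν a) (coveringMap N b) ≤ energy (integrand ν a) v) ∧
      (∀ v ∈ Admissible (boundaryData N b),
        energy (integrand ν a) v = energy (integrand ν a) (coveringMap N b) →
          v =ᵐ[discMeasure] coveringMap N b)) ∧
    -- (vi) the minimal energy
    IsLeast (energy (integrand ν a) '' Admissible (boundaryData N b))
      (ν * Real.pi * (a / N + N)) :=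
  mainTheorem10_general ν hν b N hN a (Ioo_subset_Icc_self ha)
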